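/- **Theorem 10.2.** Let $K_*=(K_m)_{m\ge 0}$ be an extended N-series, i.e. a descending series of groups $K_0\ge K_1\ge K_2\ge\cdots$ with $[K_m,K_n]\le K_{m+n}$ for all $m,n\ge 0$, where $[a,b]=aba^{-1}b^{-1}$. Let $\operatorname{gr}_+(K_*)=\bigoplus_{m\ge 1}K_m/K_{m+1}$ be its graded Lie ring, with bracket $[aK_{m+1},bK_{n+1}]=[a,b]K_{m+n+1}$, on which $\bar K_0=K_0/K_1$ acts by conjugation, ${}^{aK_1}(bK_{m+1})=aba^{-1}K_{m+1}$. Let $U(\operatorname{gr}_\bullet(K_*))=U(\operatorname{gr}_+(K_*))\,\sharp\,\mathbb Z[\bar K_0]$ be the crossed product of the universal enveloping algebra with the group ring, i.e. $U(\operatorname{gr}_+(K_*))\otimes\mathbb Z[\bar K_0]$ with multiplication $(u\otimes g)(u'\otimes g')=u\,({}^g u')\otimes gg'$. For $m\ge1$ let $I_m(K_*)=\ker(\mathbb Z[K_0]\to\mathbb Z[K_0/K_m])$. Let $J_*(K_*)$ be the filtration of $\mathbb Z[K_0]$ given by $J_0(K_*)=\mathbb Z[K_0]$ and, for $m\ge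 1$, $$J_m(K_*)=\sum_{\substack{p\ge1,\ m_1,\dots,m_p\ge 1\\ m_1+\cdots+m_p\ge m}} I_{m_1}(K_*)\cdots I_{m_p}(K_*),$$ and let $\operatorname{gr}_\bullet(J_*(K_*))=\bigoplus_{m\ge0}J_m(K_*)/J_{m+1}(K_*)$ be its associated graded ring. Then there is a unique ring homomorphism $$\Upsilon: U(\operatorname{gr}_\bullet(K_*))\longrightarrow \operatorname{gr}_\bullet(J_*(K_*))$$ such that $\Upsilon(gK_1)=g+J_1(K_*)$ for all $g\in K_0$, and $\Upsilon(xK_{i+1})=(x-1)+J_{i+1}(K_*)$ (in degree $i$) for all $x\in K_i$, $i\ge 1$. Furthermore, let $J_*^{\mathbb Q}(K_*)$ be the filtration of $\mathbb Q[K_0]$ defined in the same way, and let $U(\operatorname{gr}^{\mathbb Q}_\bullet(K_*))=U(\operatorname{gr}_+(K_*)\otimes\mathbb Q)\,\sharp\,\mathbb Q[\bar K_0]$, where the enveloping algebra is taken over $\mathbb Q$. Then the rational version $$\Upsilon^{\mathbb Q}: U(\operatorname{gr}^{\mathbb Q}_\bullet(K_*))\longrightarrow \operatorname{gr}_\bullet(J^{\mathbb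 Q}_*(K_*)),$$ i.e. the unique $\mathbb Q$-algebra homomorphism with $\Upsilon^{\mathbb Q}(gK_1)=g+J_1^{\mathbb Q}(K_*)$ for all $g\in K_0$ and $\Upsilon^{\mathbb Q}(xK_{i+1}\otimes 1)=(x-1)+J^{\mathbb Q}_{i+1}(K_*)$ for all $x\in K_i$, $i\ge1$, exists and is an isomorphism of $\mathbb Q$-algebras. -/

import Mathlib

open scoped TensorProduct DirectSum commutatorElement

universe u v

/-! ### Filtered algebras and their associated graded algebras -/

/-- A filtered `R`-algebra structure on `A`: a decreasing sequence `A = J 0 ⊇ J 1 ⊇ ⋯` of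
`R`-submodules with `J m * J n ⊆ J (m + n)`. For `R = ℤ` the submodules are just the additive
subgroups. -/
structure AlgFiltration (R : Type u) (A : Type v) [CommRing R] [Ring A] [Algebra R A] where
  toFun : ℕ → Submodule R A
  zero_eq_top : toFun 0 = ⊤
  anti : ∀ m, toFun (m + 1) ≤ toFun m
  mul_mem : ∀ {m n : ℕ} {a b : A}, a ∈ toFun m → b ∈ toFun n → a * b ∈ toFun (m + n)

namespace AlgFiltration

variable {R : Type u} {A : Type v} [CommRing R] [Ring A] [Algebra R A]

instance : CoeFun (AlgFiltration R A) (fun _ => ℕ → Submodule R A) := ⟨toFun⟩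

/-- The degree `m` part `J m / J (m + 1)` of the associated graded. -/
def grPiece (J : AlgFiltration R A) (m : ℕ) : Type v :=
  J m ⧸ (J (m + 1)).submoduleOf (J m)

variable (J : AlgFiltration R A)

instance (m : ℕ) : AddCommGroup (J.grPiece m) :=
  inferInstanceAs (AddCommGroup (J m ⧸ (J (m + 1)).submoduleOf (J m)))

instance (m : ℕ) : Module R (J.grPiece m) :=
  inferInstanceAs (Module R (J m ⧸ (J (m + 1)).submoduleOf (J m)))

/-- The projection `J m → J m / J (m + 1)`. -/
def proj (m : ℕ) : J m →ₗ[R] J.grPiece m := Submodule.mkQ _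

/-- The class `a + J (m + 1)` of `a ∈ J m`. -/
def cls (m : ℕ) (a : A) (ha : a ∈ J m) : J.grPiece m := J.proj m ⟨a, ha⟩

theorem proj_surjective (m : ℕ) : Function.Surjective (J.proj m) := Submodule.mkQ_surjective _

theorem proj_eq_zero_iff {m : ℕ} (a : J m) : J.proj m a = 0 ↔ (a : A) ∈ J (m + 1) :=
  (Submodule.Quotient.mk_eq_zero _).trans Iff.rfl

theorem one_mem_zero : (1 : A) ∈ J 0 := by rw [J.zero_eq_top]; trivial

/-- Multiplication `J m × J n → J (m + n)`. -/
def mulSub (m n : ℕ) : J m →ₗ[R] J n →ₗ[R] J (m + n) :=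
  LinearMap.mk₂ R (fun a b => ⟨(a : A) * b, J.mul_mem a.2 b.2⟩)
    (fun _ _ _ => Subtype.ext (add_mul _ _ _)) (fun _ _ _ => Subtype.ext (smul_mul_assoc _ _ _))
    (fun _ _ _ => Subtype.ext (mul_add _ _ _)) (fun _ _ _ => Subtype.ext (mul_smul_comm _ _ _))

/-- Multiplication `(J m / J (m + 1)) × (J n / J (n + 1)) → J (m + n) / J (m + n + 1)`
induced by the multiplication of `A`. -/
def grMul (m n : ℕ) : J.grPiece m →ₗ[R] J.grPiece n →ₗ[R] J.grPiece (m + n) :=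
  Submodule.liftQ _
    (LinearMap.flip (Submodule.liftQ _
      (LinearMap.flip ((J.mulSub m n).compr₂ (J.proj (m + n))))
      (fun b hb => by
        rw [LinearMap.mem_ker]
        ext a
        have h : (a : A) * b ∈ J (m + (n + 1)) := J.mul_mem a.2 hb
        exact (J.proj_eq_zero_iff _).2 h)))
    (fun a ha => by
      rw [LinearMap.mem_ker]
      refine LinearMap.ext fun y => ?_
      obtain ⟨b, rfl⟩ := J.proj_surjective n y
      refine (J.proj_eq_zero_iff _).2 ?_
      have h := J.mul_mem (show (a : A) ∈ J (m + 1) from ha) b.2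
      have e : m + 1 + n = m + n + 1 := by omega
      rw [e] at h
      exact h)

theorem grMul_cls {m n : ℕ} (a b : A) (ha : a ∈ J m) (hb : b ∈ J n) :
    J.grMul m n (J.cls m a ha) (J.cls n b hb) = J.cls (m + n) (a * b) (J.mul_mem ha hb) := rfl

theorem cls_ind {m : ℕ} {p : J.grPiece m → Prop} (h : ∀ a ha, p (J.cls m a ha)) (x) : p x := by
  obtain ⟨a, rfl⟩ := J.proj_surjective m x
  exact h a.1 a.2

theorem graded_mk_cls_eq {m n : ℕ} {a b : A} (ha : a ∈ J m) (hb : b ∈ J n) (h : m = n)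
    (h' : a = b) : GradedMonoid.mk (A := J.grPiece) m (J.cls m a ha) =
      GradedMonoid.mk n (J.cls n b hb) := by
  subst h; subst h'; rfl

instance : GradedMonoid.GOne J.grPiece := ⟨J.cls 0 1 J.one_mem_zero⟩

instance : GradedMonoid.GMul J.grPiece := ⟨fun x y => J.grMul _ _ x y⟩

instance : DirectSum.GRing J.grPiece where
  mul x y := J.grMul _ _ x y
  mul_zero x := map_zero _
  zero_mul y := by simp
  mul_add x y z := map_add _ _ _
  add_mul x y z := by simp
  one := J.cls 0 1 J.one_mem_zero
  one_mul := by
    rintro ⟨m, x⟩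
    induction x using J.cls_ind with | h a ha =>
    exact J.graded_mk_cls_eq _ _ (zero_add m) (one_mul a)
  mul_one := by
    rintro ⟨m, x⟩
    induction x using J.cls_ind with | h a ha =>
    exact J.graded_mk_cls_eq _ _ (add_zero m) (mul_one a)
  mul_assoc := by
    rintro ⟨m, x⟩ ⟨n, y⟩ ⟨p, z⟩
    induction x using J.cls_ind with | h a ha =>
    induction y using J.cls_ind with | h b hb =>
    induction z using J.cls_ind with | h c hc =>
    exact J.graded_mk_cls_eq _ _ (add_assoc m n p) (mul_assoc a b c)
  natCast n := n • J.cls 0 1 J.one_mem_zero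
  natCast_zero := zero_smul _ _
  natCast_succ n := succ_nsmul _ n
  intCast n := n • J.cls 0 1 J.one_mem_zero
  intCast_ofNat n := natCast_zsmul _ n
  intCast_negSucc_ofNat n := negSucc_zsmul _ n

instance : DirectSum.GAlgebra R J.grPiece where
  toFun :=
    { toFun r := r • J.cls 0 1 J.one_mem_zero
      map_zero' := zero_smul R _
      map_add' r s := add_smul r s _ }
  map_one := one_smul R _
  map_mul r s := by
    have h : ∀ t : R, t • J.cls 0 1 J.one_mem_zero =
        J.cls 0 (t • 1) (Submodule.smul_mem _ t J.one_mem_zero) := fun t => rfl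
    change GradedMonoid.mk (A := J.grPiece) 0 ((r * s) • J.cls 0 1 J.one_mem_zero) =
      GradedMonoid.mk (0 + 0) (J.grMul 0 0 (r • J.cls 0 1 J.one_mem_zero)
        (s • J.cls 0 1 J.one_mem_zero))
    rw [h, h, h, J.grMul_cls]
    exact J.graded_mk_cls_eq _ _ rfl (by simp [mul_smul, smul_comm r s])
  commutes := by
    rintro r ⟨m, x⟩
    induction x using J.cls_ind with | h a ha =>
    change GradedMonoid.mk (0 + m) (J.grMul 0 m (J.cls 0 (r • 1) (Submodule.smul_mem _ r
      J.one_mem_zero)) _) = GradedMonoid.mk (m + 0) (J.grMul m 0 _ (J.cls 0 (r • 1)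
        (Submodule.smul_mem _ r J.one_mem_zero)))
    rw [J.grMul_cls, J.grMul_cls]
    exact J.graded_mk_cls_eq _ _ (by omega) (by simp)
  smul_def := by
    rintro r ⟨m, x⟩
    induction x using J.cls_ind with | h a ha =>
    change GradedMonoid.mk m (J.cls m (r • a) (Submodule.smul_mem _ r ha)) =
      GradedMonoid.mk (0 + m) (J.grMul 0 m (J.cls 0 (r • 1) (Submodule.smul_mem _ r
      J.one_mem_zero)) _)
    rw [J.grMul_cls]
    exact J.graded_mk_cls_eq _ _ (by omega) (by simp)

/-- The associated graded `R`-algebra `⨁ₘ J m / J (m + 1)`, with the multiplication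
`(a + J (m + 1)) (b + J (n + 1)) = a b + J (m + n + 1)`. -/
abbrev Gr : Type v := ⨁ m, J.grPiece m

/-- The class `a + J (m + 1)` of `a ∈ J m`, as a homogeneous element of degree `m` of the
associated graded. -/
def toGr (m : ℕ) (a : A) (ha : a ∈ J m) : J.Gr := DirectSum.of J.grPiece m (J.cls m a ha)

theorem toGr_mul_toGr {m n : ℕ} (a b : A) (ha : a ∈ J m) (hb : b ∈ J n) :
    J.toGr m a ha * J.toGr n b hb = J.toGr (m + n) (a * b) (J.mul_mem ha hb) :=
  DirectSum.of_mul_of _ _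

end AlgFiltration

/-! ### Crossed products of enveloping algebras with group rings -/

/-- A group action on a Lie ring by additive maps is by Lie automorphisms. -/
class IsLieSMul (H : Type u) (L : Type v) [Group H] [LieRing L] [DistribMulAction H L] :
    Prop where
  smul_lie : ∀ (h : H) (x y : L), h • ⁅x, y⁆ = ⁅h • x, h • y⁆

namespace LieEnveloping

attribute [local instance 100] LieRing.ofAssociativeRing

variable (R : Type*) (H : Type*) (L : Type*) [CommRing R] [Group H] [LieRing L] [LieAlgebra R L]
  [DistribMulAction H L] [SMulCommClass H R L] [IsLieSMul H L]

variable {H L} in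
/-- The Lie algebra endomorphism of `L` given by a group element. -/
def smulLieHom (h : H) : L →ₗ⁅R⁆ L where
  toFun x := h • x
  map_add' := smul_add h
  map_smul' r x := smul_comm h r x
  map_lie' := IsLieSMul.smul_lie h _ _

variable {H L} in
/-- The algebra endomorphism of `U(L)` given by a group element `h`; it sends `ι x` to
`ι (h • x)`. -/
noncomputable def smulAlgHom (h : H) :
    UniversalEnvelopingAlgebra R L →ₐ[R] UniversalEnvelopingAlgebra R L :=
  UniversalEnvelopingAlgebra.lift R (L := L) ((UniversalEnvelopingAlgebra.ι R).comp (smulLieHom R h))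

theorem smulAlgHom_ι (h : H) (x : L) :
    smulAlgHom R h (UniversalEnvelopingAlgebra.ι R x) =
      UniversalEnvelopingAlgebra.ι R (h • x) := by
  simp only [smulAlgHom, UniversalEnvelopingAlgebra.lift_ι_apply]
  rfl

theorem smulAlgHom_one : smulAlgHom (L := L) R (1 : H) = AlgHom.id R _ := by
  refine UniversalEnvelopingAlgebra.hom_ext R (LieHom.ext fun x => ?_)
  change smulAlgHom R (1 : H) (UniversalEnvelopingAlgebra.ι R x) =
    UniversalEnvelopingAlgebra.ι R x
  rw [smulAlgHom_ι, one_smul]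

theorem smulAlgHom_mul (g h : H) :
    smulAlgHom (L := L) R (g * h) = (smulAlgHom R g).comp (smulAlgHom R h) := by
  refine UniversalEnvelopingAlgebra.hom_ext R (LieHom.ext fun x => ?_)
  change smulAlgHom R (g * h) (UniversalEnvelopingAlgebra.ι R x) =
    smulAlgHom R g (smulAlgHom R h (UniversalEnvelopingAlgebra.ι R x))
  rw [smulAlgHom_ι, smulAlgHom_ι, smulAlgHom_ι, mul_smul]

/-- The action on `U(L)` induced by the action on `L`. -/
noncomputable instance : MulSemiringAction H (UniversalEnvelopingAlgebra R L) where
  smul h u := smulAlgHom R h u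
  one_smul u := DFunLike.congr_fun (smulAlgHom_one R H L) u
  mul_smul g h u := DFunLike.congr_fun (smulAlgHom_mul R H L g h) u
  smul_zero h := map_zero (smulAlgHom R h)
  smul_add h := map_add (smulAlgHom R h)
  smul_one h := map_one (smulAlgHom R h)
  smul_mul h := map_mul (smulAlgHom R h)

instance : SMulCommClass H R (UniversalEnvelopingAlgebra R L) where
  smul_comm h r u := map_smul (smulAlgHom R h) r u

theorem smul_ι (h : H) (x : L) : h • UniversalEnvelopingAlgebra.ι R x =
    UniversalEnvelopingAlgebra.ι R (h • x) := smulAlgHom_ι R H L h x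

/-- The crossed (smash) product `U(L) ♯ R[H]`, realised as the skew group algebra of `H` over
`U(L)`: it is the free left `U(L)`-module `⨁ₕ U(L) h = U(L) ⊗ R[H]` on `H`, `single h u` stands
for `u ⊗ h`, and `(u ⊗ g) (u' ⊗ h) = u (g • u') ⊗ g h`. -/
abbrev Crossed : Type _ := SkewMonoidAlgebra (UniversalEnvelopingAlgebra R L) H

variable {H} in
/-- A group element in the crossed product. -/
noncomputable def ofGroup (h : H) : Crossed R H L := SkewMonoidAlgebra.single h 1

variable {L} in
/-- A Lie algebra element in the crossed product. -/
noncomputable def ofLie (x : L) : Crossed R H L :=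
  SkewMonoidAlgebra.single 1 (UniversalEnvelopingAlgebra.ι R x)

theorem single_mul_single (g h : H) (u w : UniversalEnvelopingAlgebra R L) :
    (SkewMonoidAlgebra.single g u * SkewMonoidAlgebra.single h w : Crossed R H L) =
      SkewMonoidAlgebra.single (g * h) (u * g • w) :=
  SkewMonoidAlgebra.single_mul_single

end LieEnveloping

/-! ### Extended N-series -/

/-- An extended N-series `G = K 0 ≥ K 1 ≥ K 2 ≥ ⋯` of the group `G`: a descending series of
subgroups such that `[K m, K n] ≤ K (m + n)` for all `m, n ≥ 0`. -/
structure ExtendedNSeries (G : Type u) [Group G] where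
  toFun : ℕ → Subgroup G
  zero_eq_top : toFun 0 = ⊤
  anti : ∀ m, toFun (m + 1) ≤ toFun m
  commutator_le : ∀ m n, ⁅toFun m, toFun n⁆ ≤ toFun (m + n)

namespace ExtendedNSeries

variable {G : Type u} [Group G]

instance : CoeFun (ExtendedNSeries G) (fun _ => ℕ → Subgroup G) := ⟨toFun⟩

variable (K : ExtendedNSeries G)

theorem antitone {m n : ℕ} (h : m ≤ n) : K n ≤ K m := antitone_nat_of_succ_le K.anti h

theorem mem_zero (g : G) : g ∈ K 0 := by rw [K.zero_eq_top]; trivial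

theorem lie_mem {m n : ℕ} {a b : G} (ha : a ∈ K m) (hb : b ∈ K n) : ⁅a, b⁆ ∈ K (m + n) :=
  K.commutator_le m n (Subgroup.commutator_mem_commutator ha hb)

theorem conj_eq_lie_mul (g x : G) : g * x * g⁻¹ = ⁅g, x⁆ * x := by
  simp [commutatorElement_def]

theorem conj_mem {m : ℕ} (g : G) {x : G} (hx : x ∈ K m) : g * x * g⁻¹ ∈ K m := by
  rw [conj_eq_lie_mul]
  have h := K.lie_mem (K.mem_zero g) hx
  rw [zero_add] at h
  exact mul_mem h hx

instance normal (m : ℕ) : (K m).Normal := ⟨fun _ hx g => K.conj_mem g hx⟩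

/-- The degree `0` part `K 0 / K 1` of the associated extended graded Lie algebra. -/
abbrev grZero : Type u := G ⧸ K 1

/-- The degree `m` part `K m / K (m + 1)`, `m ≥ 1`, of the associated graded Lie algebra. -/
def gr (m : ℕ+) : Type u := Additive (K m ⧸ (K (m + 1)).subgroupOf (K m))

theorem pos_le (m : ℕ+) {n k : ℕ} (h : k ≤ n) : k + 1 ≤ m + n := by
  have := m.pos; omega

/-- `K m / K (m + 1)` is abelian for `m ≥ 1`. -/
instance (m : ℕ+) : AddCommGroup (K.gr m) :=
  { (inferInstanceAs (AddGroup (Additive (K m ⧸ (K (m + 1)).subgroupOf (K m)))) :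
      AddGroup (K.gr m)) with
    add_comm := by
      intro x y
      change K m ⧸ (K (m + 1)).subgroupOf (K m) at x y
      change (x * y : K m ⧸ (K (m + 1)).subgroupOf (K m)) = y * x
      induction x using QuotientGroup.induction_on with | H a =>
      induction y using QuotientGroup.induction_on with | H b =>
      rw [← QuotientGroup.mk_mul, ← QuotientGroup.mk_mul, QuotientGroup.eq]
      have h := K.antitone (pos_le m (le_refl _)) (K.lie_mem (inv_mem b.2) (inv_mem a.2))
      rw [Subgroup.mem_subgroupOf]
      simpa [commutatorElement_def, mul_assoc] using h }

/-- The class `x K (m + 1)` of `x ∈ K m`. -/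
def cls (m : ℕ+) (x : G) (hx : x ∈ K m) : K.gr m :=
  Additive.ofMul (QuotientGroup.mk (⟨x, hx⟩ : K m))

theorem cls_mul {m : ℕ+} {x y : G} (hx : x ∈ K m) (hy : y ∈ K m) :
    K.cls m (x * y) (mul_mem hx hy) = K.cls m x hx + K.cls m y hy := rfl

theorem cls_eq_zero_iff {m : ℕ+} {x : G} (hx : x ∈ K m) :
    K.cls m x hx = 0 ↔ x ∈ K (m + 1) :=
  (QuotientGroup.eq_one_iff (⟨x, hx⟩ : K m)).trans Iff.rfl

theorem cls_ind {m : ℕ+} {p : K.gr m → Prop} (h : ∀ x hx, p (K.cls m x hx)) (a) : p a :=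
  QuotientGroup.induction_on (C := fun a => p a) a fun x => h x.1 x.2

theorem exists_cls {m : ℕ+} (a : K.gr m) : ∃ x hx, a = K.cls m x hx :=
  K.cls_ind (p := fun a => ∃ x hx, a = K.cls m x hx) (fun x hx => ⟨x, hx, rfl⟩) a

/-- The universal property of `K m / K (m + 1)`. -/
def liftGr {A : Type*} [AddCommGroup A] (m : ℕ+) (f : ∀ x, x ∈ K m → A)
    (hmul : ∀ x hx y hy, f (x * y) (mul_mem hx hy) = f x hx + f y hy)
    (hker : ∀ x hx, x ∈ K (m + 1) → f x hx = 0) : K.gr m →+ A :=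
  MonoidHom.toAdditiveLeft (QuotientGroup.lift ((K (m + 1)).subgroupOf (K m))
    (MonoidHom.mk' (fun x : K m => Multiplicative.ofAdd (f x.1 x.2))
      (fun x y => hmul x.1 x.2 y.1 y.2))
    (fun x hx => hker x.1 x.2 hx))

@[simp]
theorem liftGr_cls {A : Type*} [AddCommGroup A] (m : ℕ+) (f : ∀ x, x ∈ K m → A) (hmul hker)
    (x : G) (hx : x ∈ K m) : K.liftGr m f hmul hker (K.cls m x hx) = f x hx := rfl

theorem cls_conj {m : ℕ+} {n : ℕ} {g x : G} (hg : g ∈ K (n + 1)) (hx : x ∈ K m) :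
    K.cls m (g * x * g⁻¹) (K.conj_mem g hx) = K.cls m x hx := by
  have h : ⁅g, x⁆ ∈ K (m + 1) := K.antitone (by omega) (K.lie_mem hg hx)
  have h' : ⁅g, x⁆ ∈ K m := K.anti _ h
  have e : K.cls m (g * x * g⁻¹) (K.conj_mem g hx) = K.cls m (⁅g, x⁆ * x) (mul_mem h' hx) := by
    congr 1; exact conj_eq_lie_mul g x
  rw [e, K.cls_mul h' hx, (K.cls_eq_zero_iff h').2 h, zero_add]

theorem cls_congr {m : ℕ+} {x y : G} (hx : x ∈ K m) (h : x = y) :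
    K.cls m x hx = K.cls m y (h ▸ hx) := by subst h; rfl

theorem mem_of_pos {m : ℕ+} {x : G} (hx : x ∈ K m) : x ∈ K (0 + 1) :=
  K.antitone (by have := m.pos; omega) hx

theorem lie_mem' {i j : ℕ+} {a b : G} (ha : a ∈ K i) (hb : b ∈ K j) :
    ⁅a, b⁆ ∈ K ((i + j : ℕ+) : ℕ) := K.lie_mem ha hb

/-- The Lie bracket `[a K (i + 1), b K (j + 1)] = [a, b] K (i + j + 1)`, where
`[a, b] = a b a⁻¹ b⁻¹`. -/
def grBracket (i j : ℕ+) : K.gr i →+ K.gr j →+ K.gr (i + j) :=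
  K.liftGr i
    (fun a ha => K.liftGr j (fun b hb => K.cls (i + j) ⁅a, b⁆ (K.lie_mem' ha hb))
      (fun x hx y hy => by
        have e : ⁅a, x * y⁆ = ⁅a, x⁆ * (x * ⁅a, y⁆ * x⁻¹) := by
          simp [commutatorElement_def, mul_assoc]
        rw [K.cls_congr _ e, K.cls_mul (K.lie_mem' ha hx) (K.conj_mem x (K.lie_mem' ha hy)),
          K.cls_conj (K.mem_of_pos hx)])
      (fun x hx hx' => (K.cls_eq_zero_iff (K.lie_mem' ha hx)).2 (K.lie_mem (n := j + 1) ha hx')))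
    (fun x hx y hy => by
      ext b
      induction b using K.cls_ind with | h b hb =>
      have e : ⁅x * y, b⁆ = (x * ⁅y, b⁆ * x⁻¹) * ⁅x, b⁆ := by
        simp [commutatorElement_def, mul_assoc]
      simp only [liftGr_cls, AddMonoidHom.add_apply]
      rw [K.cls_congr _ e, K.cls_mul (K.conj_mem x (K.lie_mem' hy hb)) (K.lie_mem' hx hb),
        K.cls_conj (K.mem_of_pos hx) (K.lie_mem' hy hb)]
      exact add_comm _ _)
    (fun x hx hx' => by
      ext b
      induction b using K.cls_ind with | h b hb =>
      simp only [liftGr_cls, AddMonoidHom.zero_apply]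
      rw [K.cls_eq_zero_iff]
      have e : (i : ℕ) + 1 + j = ((i + j : ℕ+) : ℕ) + 1 := by simp; omega
      exact e ▸ K.lie_mem hx' hb)

@[simp]
theorem grBracket_cls {i j : ℕ+} {a b : G} (ha : a ∈ K i) (hb : b ∈ K j) :
    K.grBracket i j (K.cls i a ha) (K.cls j b hb) = K.cls (i + j) ⁅a, b⁆ (K.lie_mem' ha hb) :=
  rfl

/-- The associated graded Lie ring `⨁_{m ≥ 1} K m / K (m + 1)`. -/
def GrPlus : Type u := ⨁ m : ℕ+, K.gr m

noncomputable instance : AddCommGroup K.GrPlus := inferInstanceAs (AddCommGroup (⨁ m : ℕ+, K.gr m))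

/-- The inclusion of `K m / K (m + 1)` in the direct sum. -/
noncomputable def incl (m : ℕ+) : K.gr m →+ K.GrPlus := DirectSum.of K.gr m

/-- The class `x K (m + 1)` of `x ∈ K m` as an element of the direct sum, homogeneous of
degree `m`. -/
noncomputable def toGr (m : ℕ+) (x : G) (hx : x ∈ K m) : K.GrPlus := K.incl m (K.cls m x hx)

theorem toGr_congr {m n : ℕ+} {x y : G} (hx : x ∈ K m) (hy : y ∈ K n) (h : m = n) (h' : x = y) :
    K.toGr m x hx = K.toGr n y hy := by subst h; subst h'; rfl

/-- Additive maps out of the direct sum. -/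
noncomputable def liftPlus {A : Type*} [AddCommGroup A] (f : ∀ m, K.gr m →+ A) : K.GrPlus →+ A :=
  DirectSum.toAddMonoid f

@[simp]
theorem liftPlus_toGr {A : Type*} [AddCommGroup A] (f : ∀ m, K.gr m →+ A) (m : ℕ+) (x : G)
    (hx : x ∈ K m) : K.liftPlus f (K.toGr m x hx) = f m (K.cls m x hx) :=
  DirectSum.toAddMonoid_of _ _ _

theorem hom_ext {A : Type*} [AddCommGroup A] {f g : K.GrPlus →+ A}
    (h : ∀ m x hx, f (K.toGr m x hx) = g (K.toGr m x hx)) : f = g :=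
  DirectSum.addHom_ext fun m y => by
    obtain ⟨x, hx, rfl⟩ := K.exists_cls y
    exact h m x hx

theorem plus_ind {p : K.GrPlus → Prop} (h0 : p 0) (h : ∀ m x hx, p (K.toGr m x hx))
    (hadd : ∀ x y, p x → p y → p (x + y)) (x) : p x :=
  DirectSum.induction_on x h0 (fun m y => by
      obtain ⟨x, hx, rfl⟩ := K.exists_cls y
      exact h m x hx) hadd

/-- The biadditive extension of the brackets to the direct sum. -/
noncomputable def bracketHom : K.GrPlus →+ K.GrPlus →+ K.GrPlus :=
  K.liftPlus fun i => AddMonoidHom.flip <| K.liftPlus fun j => AddMonoidHom.flip <|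
    (AddMonoidHom.compHom (K.incl (i + j))).comp (K.grBracket i j)

theorem bracketHom_toGr {i j : ℕ+} {a b : G} (ha : a ∈ K i) (hb : b ∈ K j) :
    K.bracketHom (K.toGr i a ha) (K.toGr j b hb) =
      K.toGr (i + j) ⁅a, b⁆ (K.lie_mem' ha hb) := by
  simp only [bracketHom, liftPlus_toGr, AddMonoidHom.flip_apply]
  rfl

theorem toGr_mul {m : ℕ+} {x y : G} (hx : x ∈ K m) (hy : y ∈ K m) :
    K.toGr m (x * y) (mul_mem hx hy) = K.toGr m x hx + K.toGr m y hy := by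
  simp only [toGr, K.cls_mul hx hy, map_add]

theorem toGr_one {m : ℕ+} : K.toGr m 1 (one_mem _) = 0 := by
  rw [toGr, (K.cls_eq_zero_iff (one_mem _)).2 (one_mem _), map_zero]

theorem toGr_conj {m : ℕ+} {n : ℕ} {g x : G} (hg : g ∈ K (n + 1)) (hx : x ∈ K m) :
    K.toGr m (g * x * g⁻¹) (K.conj_mem g hx) = K.toGr m x hx := by
  rw [toGr, toGr, K.cls_conj hg hx]

theorem bracketHom_skew (x y : K.GrPlus) : K.bracketHom x y + K.bracketHom y x = 0 := by
  have : K.bracketHom + K.bracketHom.flip = 0 := by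
    refine K.hom_ext fun i a ha => K.hom_ext fun j b hb => ?_
    simp only [AddMonoidHom.add_apply, AddMonoidHom.flip_apply, bracketHom_toGr,
      AddMonoidHom.zero_apply]
    have hba : ⁅b, a⁆ ∈ K ((i + j : ℕ+) : ℕ) := add_comm j i ▸ K.lie_mem' hb ha
    rw [K.toGr_congr (K.lie_mem' hb ha) hba (add_comm _ _) rfl, ← K.toGr_mul]
    rw [K.toGr_congr _ (one_mem (K ((i + j : ℕ+) : ℕ))) rfl
      (by simp [commutatorElement_def, mul_assoc]),
      K.toGr_one]
  exact DFunLike.congr_fun (DFunLike.congr_fun this x) y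

theorem bracketHom_self (x : K.GrPlus) : K.bracketHom x x = 0 := by
  induction x using K.plus_ind with
  | h0 => simp
  | h m x hx =>
    rw [K.bracketHom_toGr, K.toGr_congr _ (one_mem _) rfl (commutatorElement_self x), K.toGr_one]
  | hadd x y hx hy =>
    simp only [map_add, AddMonoidHom.add_apply, hx, hy, zero_add, add_zero]
    rw [K.bracketHom_skew]

theorem bracketHom_jacobi (x y z : K.GrPlus) :
    K.bracketHom (K.bracketHom x y) z + K.bracketHom (K.bracketHom y z) x +
      K.bracketHom (K.bracketHom z x) y = 0 := by
  induction x using K.plus_ind with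
  | h0 => simp
  | hadd x x' hx hx' =>
    simp only [map_add, AddMonoidHom.add_apply]
    rw [← add_zero (0 : K.GrPlus)]
    nth_rewrite 1 [← hx]
    rw [← hx']
    abel
  | h i a ha =>
  induction y using K.plus_ind with
  | h0 => simp
  | hadd x x' hx hx' =>
    simp only [map_add, AddMonoidHom.add_apply]
    rw [← add_zero (0 : K.GrPlus)]
    nth_rewrite 1 [← hx]
    rw [← hx']
    abel
  | h j b hb =>
  induction z using K.plus_ind with
  | h0 => simp
  | hadd x x' hx hx' =>
    simp only [map_add, AddMonoidHom.add_apply]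
    rw [← add_zero (0 : K.GrPlus)]
    nth_rewrite 1 [← hx]
    rw [← hx']
    abel
  | h k c hc =>
    have hc' := K.conj_mem b hc
    have ha' := K.conj_mem c ha
    have hb' := K.conj_mem a hb
    have e2 : j + k + i = i + j + k := by ac_rfl
    have e3 : k + i + j = i + j + k := by ac_rfl
    simp only [bracketHom_toGr]
    have key : ∀ {i j k : ℕ+} {a b c g : G} (ha : a ∈ K i) (hb : b ∈ K j) (hc : c ∈ K k)
        (hg : g ∈ K (0 + 1)),
        K.toGr (i + j + k) ⁅⁅a, b⁆, c⁆ (K.lie_mem' (K.lie_mem' ha hb) hc) =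
        K.toGr (i + j + k) ⁅⁅a, b⁆, g * c * g⁻¹⁆
          (K.lie_mem' (K.lie_mem' ha hb) (K.conj_mem g hc)) := by
      intro i j k a b c g ha hb hc hg
      rw [← K.bracketHom_toGr (K.lie_mem' ha hb) hc,
        ← K.bracketHom_toGr (K.lie_mem' ha hb) (K.conj_mem g hc), K.toGr_conj hg hc]
    rw [key ha hb hc (K.mem_of_pos hb), key hb hc ha (K.mem_of_pos hc),
      key hc ha hb (K.mem_of_pos ha)]
    have m2 : ⁅⁅b, c⁆, c * a * c⁻¹⁆ ∈ K ((i + j + k : ℕ+) : ℕ) :=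
      e2 ▸ K.lie_mem' (K.lie_mem' hb hc) ha'
    have m3 : ⁅⁅c, a⁆, a * b * a⁻¹⁆ ∈ K ((i + j + k : ℕ+) : ℕ) :=
      e3 ▸ K.lie_mem' (K.lie_mem' hc ha) hb'
    rw [K.toGr_congr _ m2 e2 rfl, K.toGr_congr _ m3 e3 rfl, ← K.toGr_mul, ← K.toGr_mul,
      K.toGr_congr _ (one_mem _) rfl (commutatorElement_commutatorElement_conj_mul a b c),
      K.toGr_one]

noncomputable instance : LieRing K.GrPlus where
  bracket x y := K.bracketHom x y
  add_lie x y z := by simp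
  lie_add x y z := map_add _ _ _
  lie_self := K.bracketHom_self
  leibniz_lie x y z := by
    change K.bracketHom x (K.bracketHom y z) = K.bracketHom (K.bracketHom x y) z +
      K.bracketHom y (K.bracketHom x z)
    have h1 := K.bracketHom_jacobi x y z
    have h2 := K.bracketHom_skew x (K.bracketHom y z)
    have h3 := K.bracketHom_skew y (K.bracketHom x z)
    have h4 : K.bracketHom (K.bracketHom z x) y = - K.bracketHom (K.bracketHom x z) y := by
      rw [eq_neg_of_add_eq_zero_left (K.bracketHom_skew z x)]; simp
    rw [h4] at h1
    rw [eq_neg_of_add_eq_zero_left h2, eq_neg_of_add_eq_zero_left h3, ← sub_eq_zero]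
    rw [← neg_eq_zero, ← h1]
    abel

theorem lie_toGr {i j : ℕ+} {a b : G} (ha : a ∈ K i) (hb : b ∈ K j) :
    ⁅K.toGr i a ha, K.toGr j b hb⁆ = K.toGr (i + j) ⁅a, b⁆ (K.lie_mem' ha hb) :=
  K.bracketHom_toGr ha hb

/-- Conjugation by `g` on `K m / K (m + 1)`. -/
def conjGr (g : G) (m : ℕ+) : K.gr m →+ K.gr m :=
  K.liftGr m (fun x hx => K.cls m (g * x * g⁻¹) (K.conj_mem g hx))
    (fun x hx y hy => by
      rw [← K.cls_mul]
      exact K.cls_congr _ (by simp [mul_assoc]))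
    (fun x hx hx' => (K.cls_eq_zero_iff _).2 (K.conj_mem g hx'))

/-- Conjugation by `g` on the direct sum. -/
noncomputable def conjPlus (g : G) : K.GrPlus →+ K.GrPlus :=
  K.liftPlus fun m => (K.incl m).comp (K.conjGr g m)

theorem conjPlus_toGr (g : G) {m : ℕ+} {x : G} (hx : x ∈ K m) :
    K.conjPlus g (K.toGr m x hx) = K.toGr m (g * x * g⁻¹) (K.conj_mem g hx) := by
  simp only [conjPlus, liftPlus_toGr]
  rfl

/-- The action of `K 0` on the direct sum by conjugation. -/
noncomputable def conjHom : G →* AddMonoid.End K.GrPlus where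
  toFun := K.conjPlus
  map_one' := K.hom_ext fun m x hx => by
    change K.conjPlus 1 (K.toGr m x hx) = K.toGr m x hx
    rw [K.conjPlus_toGr]
    exact K.toGr_congr _ _ rfl (by simp)
  map_mul' g h := K.hom_ext fun m x hx => by
    change K.conjPlus (g * h) (K.toGr m x hx) = K.conjPlus g (K.conjPlus h (K.toGr m x hx))
    rw [K.conjPlus_toGr, K.conjPlus_toGr, K.conjPlus_toGr]
    exact K.toGr_congr _ _ rfl (by simp [mul_assoc])

/-- The induced action of `K 0 / K 1`. -/
noncomputable def grZeroHom : K.grZero →* AddMonoid.End K.GrPlus :=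
  QuotientGroup.lift (K 1) K.conjHom fun g hg => K.hom_ext fun m x hx => by
    change K.conjPlus g (K.toGr m x hx) = K.toGr m x hx
    rw [K.conjPlus_toGr, K.toGr_conj (n := 0) hg]

/-- `K 0 / K 1` acts on the associated graded Lie ring, through conjugation. -/
noncomputable instance : DistribMulAction K.grZero K.GrPlus :=
  DistribMulAction.compHom K.GrPlus K.grZeroHom

theorem smul_toGr (g : G) {m : ℕ+} {x : G} (hx : x ∈ K m) :
    (QuotientGroup.mk g : K.grZero) • K.toGr m x hx =
      K.toGr m (g * x * g⁻¹) (K.conj_mem g hx) :=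
  K.conjPlus_toGr g hx

instance : IsLieSMul K.grZero K.GrPlus where
  smul_lie h x y := by
    induction h using QuotientGroup.induction_on with | H g =>
    induction x using K.plus_ind with
    | h0 => simp
    | hadd x x' hx hx' => simp only [add_lie, smul_add, hx, hx']
    | h i a ha =>
    induction y using K.plus_ind with
    | h0 => simp
    | hadd x x' hx hx' => simp only [lie_add, smul_add, hx, hx']
    | h j b hb =>
    rw [K.lie_toGr, K.smul_toGr, K.smul_toGr, K.smul_toGr, K.lie_toGr]
    exact K.toGr_congr _ _ rfl (by simp [commutatorElement_def, mul_assoc])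

/-- The rational graded Lie algebra `⨁_{m ≥ 1} (K m / K (m + 1)) ⊗ ℚ`, as the base change to
`ℚ` of the graded Lie ring. -/
abbrev GrPlusRat : Type u := ℚ ⊗[ℤ] K.GrPlus

/-- The action of `K 0 / K 1` on the rational graded Lie algebra, `g • (q ⊗ x) = q ⊗ (g • x)`. -/
noncomputable instance : DistribMulAction K.grZero K.GrPlusRat where
  smul g := (DistribSMul.toAddMonoidHom K.GrPlus g).toIntLinearMap.baseChange ℚ
  one_smul y := by
    change (DistribSMul.toAddMonoidHom K.GrPlus (1 : K.grZero)).toIntLinearMap.baseChange ℚ y = y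
    have : (DistribSMul.toAddMonoidHom K.GrPlus (1 : K.grZero)).toIntLinearMap =
        LinearMap.id := by ext; simp
    rw [this, LinearMap.baseChange_id, LinearMap.id_apply]
  mul_smul g h y := by
    change (DistribSMul.toAddMonoidHom K.GrPlus (g * h)).toIntLinearMap.baseChange ℚ y =
      (DistribSMul.toAddMonoidHom K.GrPlus g).toIntLinearMap.baseChange ℚ
        ((DistribSMul.toAddMonoidHom K.GrPlus h).toIntLinearMap.baseChange ℚ y)
    have : (DistribSMul.toAddMonoidHom K.GrPlus (g * h)).toIntLinearMap =
        (DistribSMul.toAddMonoidHom K.GrPlus g).toIntLinearMap.comp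
          (DistribSMul.toAddMonoidHom K.GrPlus h).toIntLinearMap := by
      ext; simp [mul_smul]
    rw [this, LinearMap.baseChange_comp, LinearMap.comp_apply]
  smul_zero g := map_zero _
  smul_add g := map_add _

theorem smul_tmul_rat (g : K.grZero) (q : ℚ) (x : K.GrPlus) :
    g • (q ⊗ₜ[ℤ] x : K.GrPlusRat) = q ⊗ₜ[ℤ] (g • x) := rfl

instance : SMulCommClass K.grZero ℚ K.GrPlusRat where
  smul_comm g q y :=
    map_smul ((DistribSMul.toAddMonoidHom K.GrPlus g).toIntLinearMap.baseChange ℚ) q y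

instance : IsLieSMul K.grZero K.GrPlusRat where
  smul_lie g x y := by
    induction x using TensorProduct.induction_on with
    | zero => simp
    | add x x' hx hx' => simp only [add_lie, smul_add, hx, hx']
    | tmul q x =>
    induction y using TensorProduct.induction_on with
    | zero => simp
    | add x x' hx hx' => simp only [lie_add, smul_add, hx, hx']
    | tmul r y =>
    simp only [LieAlgebra.ExtendScalars.bracket_tmul, smul_tmul_rat, IsLieSMul.smul_lie]

/-- The universal enveloping algebra `U(gr_•(K)) = U(gr_+(K)) ♯ ℤ[K 0 / K 1]`. -/
abbrev U : Type u := LieEnveloping.Crossed ℤ K.grZero K.GrPlus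

/-- The rational universal enveloping algebra `U(gr_+(K) ⊗ ℚ) ♯ ℚ[K 0 / K 1]`. -/
abbrev URat : Type u := LieEnveloping.Crossed ℚ K.grZero K.GrPlusRat

/-! ### The induced filtration of the group ring -/

variable (R : Type v) [CommRing R]

/-- The kernel of `R[K 0] → R[K 0 / K m]`. -/
noncomputable def I (m : ℕ) : Submodule R (MonoidAlgebra R G) :=
  LinearMap.ker (MonoidAlgebra.mapDomainAlgHom R R (QuotientGroup.mk' (K m))).toLinearMap

/-- `J 0 = R[K 0]`, and for `m ≥ 1`, `J m` is the sum of the products `I m₁ ⋯ I mₚ` over all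
`p ≥ 1` and `m₁, …, mₚ ≥ 1` with `m₁ + ⋯ + mₚ ≥ m`. -/
noncomputable def J (m : ℕ) : Submodule R (MonoidAlgebra R G) :=
  if m = 0 then ⊤ else
    ⨆ l : {l : List ℕ // l ≠ [] ∧ (∀ k ∈ l, 1 ≤ k) ∧ m ≤ l.sum}, (l.1.map (K.I R)).prod

theorem J_zero : K.J R 0 = ⊤ := if_pos rfl

theorem J_of_ne {m : ℕ} (hm : m ≠ 0) : K.J R m =
    ⨆ l : {l : List ℕ // l ≠ [] ∧ (∀ k ∈ l, 1 ≤ k) ∧ m ≤ l.sum}, (l.1.map (K.I R)).prod :=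
  if_neg hm

theorem prod_le_J {m : ℕ} {l : List ℕ} (h : l ≠ []) (h1 : ∀ k ∈ l, 1 ≤ k) (h2 : m ≤ l.sum) :
    (l.map (K.I R)).prod ≤ K.J R m := by
  rcases eq_or_ne m 0 with rfl | hm
  · rw [J_zero]; exact le_top
  · rw [J_of_ne K R hm]
    exact le_iSup (fun l : {l : List ℕ // l ≠ [] ∧ (∀ k ∈ l, 1 ≤ k) ∧ m ≤ l.sum} =>
      (l.1.map (K.I R)).prod) ⟨l, h, h1, h2⟩

theorem J_anti (m : ℕ) : K.J R (m + 1) ≤ K.J R m := by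
  rw [J_of_ne K R m.succ_ne_zero]
  exact iSup_le fun l => K.prod_le_J R l.2.1 l.2.2.1 (by have := l.2.2.2; omega)

theorem top_mul_I (m : ℕ) : (⊤ : Submodule R (MonoidAlgebra R G)) * K.I R m ≤ K.I R m := by
  rw [Submodule.mul_le]
  intro a _ b hb
  have hb' : MonoidAlgebra.mapDomainAlgHom R R (QuotientGroup.mk' (K m)) b = 0 := hb
  change MonoidAlgebra.mapDomainAlgHom R R (QuotientGroup.mk' (K m)) (a * b) = 0
  rw [map_mul, hb', mul_zero]

theorem I_mul_top (m : ℕ) : K.I R m * (⊤ : Submodule R (MonoidAlgebra R G)) ≤ K.I R m := by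
  rw [Submodule.mul_le]
  intro b hb a _
  have hb' : MonoidAlgebra.mapDomainAlgHom R R (QuotientGroup.mk' (K m)) b = 0 := hb
  change MonoidAlgebra.mapDomainAlgHom R R (QuotientGroup.mk' (K m)) (b * a) = 0
  rw [map_mul, hb', zero_mul]

theorem J_mul_le (m n : ℕ) : K.J R m * K.J R n ≤ K.J R (m + n) := by
  rcases eq_or_ne m 0 with rfl | hm
  · rcases eq_or_ne n 0 with rfl | hn
    · rw [add_zero, J_zero]; exact le_top
    · rw [zero_add, J_zero, J_of_ne K R hn, Submodule.mul_iSup]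
      refine iSup_mono ?_
      rintro ⟨l, hl, -, -⟩
      obtain ⟨k, t, rfl⟩ := List.exists_cons_of_ne_nil hl
      simp only [List.map_cons, List.prod_cons]
      rw [← mul_assoc]
      exact mul_le_mul_left (K.top_mul_I R k) _
  · rcases eq_or_ne n 0 with rfl | hn
    · rw [add_zero, J_zero, J_of_ne K R hm, Submodule.iSup_mul]
      refine iSup_mono ?_
      rintro ⟨l, hl, -, -⟩
      obtain ⟨t, k, rfl⟩ := List.eq_nil_or_concat' l |>.resolve_left hl
      simp only [List.map_append, List.prod_append, List.map_cons, List.prod_cons, List.map_nil,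
        List.prod_nil, mul_one]
      rw [mul_assoc]
      exact mul_le_mul_right (K.I_mul_top R k) _
    · rw [J_of_ne K R hm, J_of_ne K R hn, Submodule.iSup_mul]
      refine iSup_le fun l => ?_
      rw [Submodule.mul_iSup]
      refine iSup_le fun l' => ?_
      rw [← List.prod_append, ← List.map_append]
      refine K.prod_le_J R (by simp [l.2.1]) ?_ ?_
      · intro k hk
        rcases List.mem_append.1 hk with h | h
        exacts [l.2.2.1 k h, l'.2.2.1 k h]
      · rw [List.sum_append]
        exact add_le_add l.2.2.2 l'.2.2.2

/-- The filtered algebra `J_*(K)` on the group ring `R[K 0]`. -/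
noncomputable def groupRingFiltration : AlgFiltration R (MonoidAlgebra R G) where
  toFun := K.J R
  zero_eq_top := K.J_zero R
  anti := K.J_anti R
  mul_mem ha hb := K.J_mul_le R _ _ (Submodule.mul_mem_mul ha hb)

/-- The associated graded of the filtration `J_*(K)` of `R[K 0]`. -/
abbrev GrJ : Type (max v u) := (K.groupRingFiltration R).Gr

theorem of_mem_J_zero (g : G) : MonoidAlgebra.of R G g ∈ K.groupRingFiltration R 0 := by
  rw [(K.groupRingFiltration R).zero_eq_top]; trivial

theorem of_sub_one_mem_J {m : ℕ+} {x : G} (hx : x ∈ K m) :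
    MonoidAlgebra.of R G x - 1 ∈ K.groupRingFiltration R m := by
  refine K.prod_le_J R (l := [(m : ℕ)]) (by simp)
    (by simpa using Nat.succ_le_of_lt m.pos) (by simp) ?_
  rw [List.map_singleton, List.prod_singleton]
  change MonoidAlgebra.mapDomainAlgHom R R (QuotientGroup.mk' (K m)) _ = 0
  have h : (QuotientGroup.mk x : G ⧸ K m) = 1 := (QuotientGroup.eq_one_iff x).2 hx
  rw [map_sub, map_one, sub_eq_zero]
  simp [MonoidAlgebra.of_apply, MonoidAlgebra.one_def, h]

/-- The element `g + J 1` of degree `0`, for `g ∈ K 0`. -/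
noncomputable def grJOfGroup (g : G) : K.GrJ R :=
  (K.groupRingFiltration R).toGr 0 (MonoidAlgebra.of R G g) (K.of_mem_J_zero R g)

/-- The element `(x - 1) + J (m + 1)` of degree `m`, for `x ∈ K m` and `m ≥ 1`. -/
noncomputable def grJOfLie (m : ℕ+) (x : G) (hx : x ∈ K m) : K.GrJ R :=
  (K.groupRingFiltration R).toGr m (MonoidAlgebra.of R G x - 1) (K.of_sub_one_mem_J R hx)

/-- The defining property of the map `Υ`: it sends `g K 1` to `g + J 1` for `g ∈ K 0`, and
`x K (m + 1)` to `(x - 1) + J (m + 1)` for `x ∈ K m`, `m ≥ 1`. -/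
def IsUpsilon (Υ : K.U →+* K.GrJ ℤ) : Prop :=
  (∀ g : G, Υ (LieEnveloping.ofGroup ℤ K.GrPlus (QuotientGroup.mk g : K.grZero)) =
    K.grJOfGroup ℤ g) ∧
  ∀ (m : ℕ+) (x : G) (hx : x ∈ K m),
    Υ (LieEnveloping.ofLie ℤ K.grZero (K.toGr m x hx)) = K.grJOfLie ℤ m x hx

/-- The defining property of the rational version of `Υ`: it sends `g K 1` to `g + J 1` for
`g ∈ K 0`, and `x K (m + 1) ⊗ 1` to `(x - 1) + J (m + 1)` for `x ∈ K m`, `m ≥ 1`. -/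
def IsUpsilonRat (Υ : K.URat →ₐ[ℚ] K.GrJ ℚ) : Prop :=
  (∀ g : G, Υ (LieEnveloping.ofGroup ℚ K.GrPlusRat (QuotientGroup.mk g : K.grZero)) =
    K.grJOfGroup ℚ g) ∧
  ∀ (m : ℕ+) (x : G) (hx : x ∈ K m),
    Υ (LieEnveloping.ofLie ℚ K.grZero ((1 : ℚ) ⊗ₜ[ℤ] K.toGr m x hx : K.GrPlusRat)) =
      K.grJOfLie ℚ m x hx

end ExtendedNSeries

/-!
The map `Υ` exists and is unique by the universal properties of the enveloping algebra and of the
crossed product: `x ↦ x - 1` is additive and compatible with brackets and conjugation to leading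
order (`lieHom_lie`, `lieHom_smul`), and the crossed product is generated by the Lie algebra and
the group (`crossed_hom_ext`).

Since `K m` is normal, `J k` is spanned by the products `(x₁ - 1) ⋯ (xₚ - 1) g` with `xᵢ ∈ K mᵢ`,
`m₁ + ⋯ + mₚ ≥ k` (`J_eq_wordSpan`). The leading terms of these products are values of `Υ`, so the
rational `Υ` is surjective (`upsilonRat_surjective`).

The substance of the proof of injectivity is the statement that, for `x ∈ K m`, the condition
`x - 1 ∈ J (m + 1)` forces `x` to be torsion modulo `K (m + 1)` (`hom_cls_eq_zero_of_mem_J`, in the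
form that all homomorphisms `K m / K (m + 1) → ℚ` kill `x`). For this one shows that, if the induced
filtrations are used, `x - 1` keeps its degree when the group `K 0` is replaced by `K 1`, `K 2`, …,
`K m`; in `K m` the assertion is evident from two-dimensional unipotent representations. The step to
`K 1` is a projection. The step from `K w` to `K (w + 1)` involves only finitely many elements of
`K w`, which can be removed one at a time; so let `H` be normal in `H ⟨t⟩` with cyclic quotient. The
left regular representation of `H` on `ℚ[H] / J k` extends to `H ⟨t⟩`: let `t` act by conjugation if
no power of `t` lies in `H`, and otherwise, if `t ^ n = h ∈ H`, by conjugation composed with the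
unipotent `n`-th root of right multiplication by `h` (`mem_J_of_map_mem_J`). That root exists and is
unique because all the operators involved are unipotent for a nilpotent filtration, over a field of
characteristic zero (`exists_unip_pow_eq`, `unip_eq_of_pow_eq`). The extended representation respects
the filtrations, hence nothing outside `J k` for `H` can lie in `J k` for `H ⟨t⟩`.

It follows that `x ↦ x - 1` embeds `ℚ ⊗ (K m / K (m + 1))` into `ℚ[G] / J (m + 1)`, so there are
functions on the group, polynomial of weighted degree at most `m`, that are dual to a basis of
`ℚ ⊗ (K m / K (m + 1))` (`exists_dualFamily`). To leading order, difference operators act on products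
of such functions as derivations do on monomials (`diff_mono`). Hence the monomials in these
functions pair with the ordered products of the basis elements, one for each multiset, in a
triangular way with factorials on the diagonal (`diffWord_mono_of_lt`, `diffWord_mono`). The ordered
products span the enveloping algebra (`span_listProd_toList`), so the pairing proves that `Υ` is
injective (`upsilonRat_injective`). Together with indicator functions of the cosets of `K 1` this
covers the crossed product. Linear independence of the ordered monomials, the hard half of the
Poincaré–Birkhoff–Witt theorem, is not needed.
-/

namespace ExtendedNSeries

/-! ### Weighted words and a spanning set of the filtration -/

section Words

variable {G : Type u}

/-- The total weight of a list of elements with assigned weights. -/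
def wt (l : List (ℕ × G)) : ℕ := (l.map Prod.fst).sum

@[simp] theorem wt_nil : wt ([] : List (ℕ × G)) = 0 := rfl

@[simp] theorem wt_cons (p : ℕ × G) (l : List (ℕ × G)) : wt (p :: l) = p.1 + wt l := by
  simp [wt]

@[simp] theorem wt_append (l l' : List (ℕ × G)) : wt (l ++ l') = wt l + wt l' := by
  simp [wt]

variable [Group G] (K : ExtendedNSeries G)

/-- A weighted word in the N-series: a list of group elements `x`, each recorded together with
a weight `m ≥ 1` such that `x ∈ K m`. The same element may occur with different weights. -/
def IsWord (l : List (ℕ × G)) : Prop := ∀ p ∈ l, 1 ≤ p.1 ∧ p.2 ∈ K p.1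

theorem isWord_nil : K.IsWord [] := fun _ h => absurd h List.not_mem_nil

theorem isWord_cons {p : ℕ × G} {l : List (ℕ × G)} :
    K.IsWord (p :: l) ↔ (1 ≤ p.1 ∧ p.2 ∈ K p.1) ∧ K.IsWord l :=
  List.forall_mem_cons

theorem IsWord.append {K : ExtendedNSeries G} {l l' : List (ℕ × G)} (h : K.IsWord l)
    (h' : K.IsWord l') : K.IsWord (l ++ l') :=
  fun p hp => (List.mem_append.1 hp).elim (h p) (h' p)

variable (R : Type v) [CommRing R]

/-- The product `(x₁ - 1) ⋯ (xₚ - 1)` in the group ring, for a weighted word. -/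
noncomputable def augProd (l : List (ℕ × G)) : MonoidAlgebra R G :=
  (l.map fun p => MonoidAlgebra.of R G p.2 - 1).prod

@[simp] theorem augProd_nil : augProd R ([] : List (ℕ × G)) = 1 := rfl

@[simp] theorem augProd_cons (p : ℕ × G) (l : List (ℕ × G)) :
    augProd R (p :: l) = (MonoidAlgebra.of R G p.2 - 1) * augProd R l := by
  simp [augProd]

@[simp] theorem augProd_append (l l' : List (ℕ × G)) :
    augProd R (l ++ l') = augProd R l * augProd R l' := by
  simp [augProd]

/-- Conjugation of all the letters of a weighted word. -/
def conjWord (g : G) (l : List (ℕ × G)) : List (ℕ × G) := l.map fun p => (p.1, g * p.2 * g⁻¹)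

theorem wt_conjWord (g : G) (l : List (ℕ × G)) : wt (conjWord g l) = wt l := by
  simp [wt, conjWord, Function.comp_def]

theorem IsWord.conjWord {K : ExtendedNSeries G} {l : List (ℕ × G)} (h : K.IsWord l) (g : G) :
    K.IsWord (conjWord g l) := by
  intro p hp
  obtain ⟨q, hq, rfl⟩ := List.mem_map.1 hp
  exact ⟨(h q hq).1, K.conj_mem g (h q hq).2⟩

theorem of_mul_augProd (g : G) (l : List (ℕ × G)) :
    MonoidAlgebra.of R G g * augProd R l =
      augProd R (conjWord g l) * MonoidAlgebra.of R G g := by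
  induction l with
  | nil => simp [conjWord]
  | cons p l ih =>
    have e : MonoidAlgebra.of R G g * (MonoidAlgebra.of R G p.2 - 1) =
        (MonoidAlgebra.of R G (g * p.2 * g⁻¹) - 1) * MonoidAlgebra.of R G g := by
      rw [mul_sub, sub_mul, ← map_mul, ← map_mul, inv_mul_cancel_right, mul_one, one_mul]
    have e' : conjWord g (p :: l) = (p.1, g * p.2 * g⁻¹) :: conjWord g l := rfl
    rw [e', augProd_cons, augProd_cons, ← mul_assoc, e, mul_assoc, ih, ← mul_assoc]

/-- The span of the products `(x₁ - 1) ⋯ (xₚ - 1) g`, for the weighted words of weight at least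
`k` with letters in a subgroup `M`, and `g ∈ M`. -/
noncomputable def wordSpan (M : Subgroup G) (k : ℕ) : Submodule R (MonoidAlgebra R G) :=
  Submodule.span R {a | ∃ l g, K.IsWord l ∧ (∀ p ∈ l, p.2 ∈ M) ∧ g ∈ M ∧ k ≤ wt l ∧
    a = augProd R l * MonoidAlgebra.of R G g}

theorem wordSpan_mul_le (j k : ℕ) :
    K.wordSpan R ⊤ j * K.wordSpan R ⊤ k ≤ K.wordSpan R ⊤ (j + k) := by
  rw [wordSpan, wordSpan, Submodule.span_mul_span, Submodule.span_le]
  rintro _ ⟨_, ⟨l, g, hl, -, -, hlj, rfl⟩, _, ⟨l', g', hl', -, -, hlk, rfl⟩, rfl⟩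
  refine Submodule.subset_span ⟨l ++ conjWord g l', g * g', hl.append (hl'.conjWord g),
    fun _ _ => trivial, trivial, ?_, ?_⟩
  · rw [wt_append, wt_conjWord]; exact add_le_add hlj hlk
  · simp only [augProd_append, map_mul, ← mul_assoc]
    rw [mul_assoc (augProd R l), of_mul_augProd, ← mul_assoc (augProd R l)]

theorem wordSpan_anti (M : Subgroup G) {j k : ℕ} (h : j ≤ k) :
    K.wordSpan R M k ≤ K.wordSpan R M j := by
  refine Submodule.span_mono ?_
  rintro _ ⟨l, g, h1, h2, h3, h4, rfl⟩
  exact ⟨l, g, h1, h2, h3, h.trans h4, rfl⟩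

theorem wordSpan_zero : K.wordSpan R ⊤ 0 = ⊤ := by
  rw [eq_top_iff]
  intro a _
  induction a using MonoidAlgebra.induction_linear with
  | zero => exact zero_mem _
  | add x y hx hy => exact add_mem (hx trivial) (hy trivial)
  | single g r =>
    have : MonoidAlgebra.single g r = r • MonoidAlgebra.of R G g := by simp
    rw [this]
    refine Submodule.smul_mem _ _ (Submodule.subset_span ⟨[], g, K.isWord_nil, ?_, trivial,
      le_rfl, by simp⟩)
    simp

theorem I_le_wordSpan {m : ℕ} (hm : 1 ≤ m) : K.I R m ≤ K.wordSpan R ⊤ m := by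
  -- the chosen coset representatives give a linear section `σ` of `R[G] → R[G / K m]`, and
  -- `a - σ (π a)` is a combination of elements `(x - 1) g` with `x ∈ K m`
  let f := (MonoidAlgebra.mapDomainAlgHom R R (QuotientGroup.mk' (K m))).toLinearMap
  have key : ∀ a : MonoidAlgebra R G,
      a - MonoidAlgebra.mapDomain Quotient.out (f a) ∈ K.wordSpan R ⊤ m := by
    intro a
    induction a using MonoidAlgebra.induction_linear with
    | zero => simp
    | add x y hx hy =>
      rw [map_add, MonoidAlgebra.mapDomain_add, add_sub_add_comm]
      exact add_mem hx hy
    | single g r =>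
      set h : G := Quotient.out (QuotientGroup.mk g : G ⧸ K m) with hh
      have e1 : MonoidAlgebra.mapDomain Quotient.out (f (MonoidAlgebra.single g r)) =
          MonoidAlgebra.single h r := by
        simp [f, hh]
      have hx : g * h⁻¹ ∈ K m := by
        have h0 : (QuotientGroup.mk h : G ⧸ K m) = QuotientGroup.mk g := Quotient.out_eq _
        rw [← QuotientGroup.eq_one_iff, QuotientGroup.mk_mul, QuotientGroup.mk_inv, h0,
          mul_inv_cancel]
      have e2 : MonoidAlgebra.single g r - MonoidAlgebra.single h r =
          r • (augProd R [(m, g * h⁻¹)] * MonoidAlgebra.of R G h) := by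
        simp [sub_mul, smul_sub, MonoidAlgebra.single_mul_single]
      rw [e1, e2]
      refine Submodule.smul_mem _ _ (Submodule.subset_span ⟨_, h, ?_, fun _ _ => trivial,
        trivial, by simp, rfl⟩)
      exact K.isWord_cons.2 ⟨⟨hm, hx⟩, K.isWord_nil⟩
  intro a ha
  have h0 : f a = 0 := ha
  simpa [h0] using key a

theorem augProd_mem_J {l : List (ℕ × G)} (h : K.IsWord l) : augProd R l ∈ K.J R (wt l) := by
  induction l with
  | nil => rw [wt_nil, J_zero]; trivial
  | cons p l ih =>
    obtain ⟨⟨h1, h2⟩, h3⟩ := K.isWord_cons.1 h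
    rw [wt_cons, augProd_cons]
    exact K.J_mul_le R _ _ (Submodule.mul_mem_mul
      (K.of_sub_one_mem_J R (m := ⟨p.1, h1⟩) h2) (ih h3))

theorem J_antitone {j k : ℕ} (h : j ≤ k) : K.J R k ≤ K.J R j :=
  antitone_nat_of_succ_le (K.J_anti R) h

theorem mul_of_mem_J {k : ℕ} {a : MonoidAlgebra R G} (ha : a ∈ K.J R k) (b : MonoidAlgebra R G) :
    a * b ∈ K.J R k :=
  K.J_mul_le R k 0 (Submodule.mul_mem_mul ha (by rw [J_zero]; trivial))

theorem of_mul_mem_J {k : ℕ} {a : MonoidAlgebra R G} (ha : a ∈ K.J R k) (b : MonoidAlgebra R G) :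
    b * a ∈ K.J R k := by
  have := K.J_mul_le R 0 k (Submodule.mul_mem_mul (show b ∈ K.J R 0 by rw [J_zero]; trivial) ha)
  rwa [zero_add] at this

/-- The filtration is spanned by the products `(x₁ - 1) ⋯ (xₚ - 1) g`, since `K m` is normal. -/
theorem J_eq_wordSpan (k : ℕ) : K.J R k = K.wordSpan R ⊤ k := by
  apply le_antisymm
  · rcases eq_or_ne k 0 with rfl | hk
    · rw [wordSpan_zero]; exact le_top
    · rw [J_of_ne K R hk]
      refine iSup_le ?_
      rintro ⟨l, hne, hl, hlk⟩
      refine le_trans ?_ (K.wordSpan_anti R ⊤ hlk)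
      change (l.map (K.I R)).prod ≤ _
      clear hlk hne
      induction l with
      | nil => rw [List.sum_nil, wordSpan_zero]; exact le_top
      | cons m l ih =>
        rw [List.map_cons, List.prod_cons, List.sum_cons]
        exact (mul_le_mul' (K.I_le_wordSpan R (hl m (by simp)))
          (ih fun k hk => hl k (by simp [hk]))).trans (K.wordSpan_mul_le R _ _)
  · refine Submodule.span_le.2 ?_
    rintro _ ⟨l, g, h1, -, -, h4, rfl⟩
    exact K.J_antitone R h4 (K.mul_of_mem_J R (K.augProd_mem_J R h1) _)

/-- Universal property of the filtration: it maps into any multiplicative filtration of an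
algebra for which every `x - 1`, `x ∈ K i`, goes to the `i`-th step. -/
theorem map_J_mem {B : Type*} [Ring B] [Algebra R B] (ρ : MonoidAlgebra R G →ₐ[R] B)
    (E : ℕ → Submodule R B) (hE : ∀ i j a b, a ∈ E i → b ∈ E j → a * b ∈ E (i + j))
    (hanti : ∀ i, E (i + 1) ≤ E i) (h0 : ∀ g, ρ (MonoidAlgebra.of R G g) ∈ E 0)
    (h1 : ∀ i x, 1 ≤ i → x ∈ K i → ρ (MonoidAlgebra.of R G x) - 1 ∈ E i)
    {k : ℕ} {a : MonoidAlgebra R G} (ha : a ∈ K.J R k) : ρ a ∈ E k := by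
  rw [J_eq_wordSpan] at ha
  induction ha using Submodule.span_induction with
  | zero => rw [map_zero]; exact zero_mem _
  | add x y _ _ hx hy => rw [map_add]; exact add_mem hx hy
  | smul r x _ hx => rw [map_smul]; exact Submodule.smul_mem _ _ hx
  | mem x hx =>
    obtain ⟨l, g, hl, -, -, hk, rfl⟩ := hx
    refine antitone_nat_of_succ_le hanti hk ?_
    clear hk
    induction l with
    | nil => simpa using h0 g
    | cons p l ih =>
      obtain ⟨⟨h2, h3⟩, h4⟩ := K.isWord_cons.1 hl
      rw [augProd_cons, mul_assoc, map_mul, map_sub, map_one, wt_cons]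
      exact hE _ _ _ _ (h1 _ _ h2 h3) (ih h4)

end Words

end ExtendedNSeries

/-! ### Homomorphisms out of crossed products -/

namespace LieEnveloping

section Lift

attribute [local instance 100] LieRing.ofAssociativeRing

variable (R : Type*) (H : Type*) (L : Type*) [CommRing R] [Group H] [LieRing L] [LieAlgebra R L]

/-- The enveloping algebra is generated by the image of the Lie algebra: the universal property
splits the inclusion of the generated subalgebra. -/
theorem adjoin_range_ι :
    Algebra.adjoin R (Set.range (UniversalEnvelopingAlgebra.ι R (L := L))) = ⊤ := by
  set S := Algebra.adjoin R (Set.range (UniversalEnvelopingAlgebra.ι R (L := L)))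
  let f : L →ₗ⁅R⁆ S :=
    { toFun x := ⟨UniversalEnvelopingAlgebra.ι R x, Algebra.subset_adjoin ⟨x, rfl⟩⟩
      map_add' x y := Subtype.ext (map_add _ x y)
      map_smul' r x := Subtype.ext (map_smul _ r x)
      map_lie' := fun {x y} => Subtype.ext (LieHom.map_lie _ x y) }
  have h : S.val.comp (UniversalEnvelopingAlgebra.lift R f) = AlgHom.id R _ := by
    refine UniversalEnvelopingAlgebra.hom_ext R (LieHom.ext fun x => ?_)
    change (UniversalEnvelopingAlgebra.lift R f (UniversalEnvelopingAlgebra.ι R x) :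
      UniversalEnvelopingAlgebra R L) = UniversalEnvelopingAlgebra.ι R x
    rw [UniversalEnvelopingAlgebra.lift_ι_apply]
    rfl
  rw [eq_top_iff]
  intro u _
  have := DFunLike.congr_fun h u
  rw [← show _ = u from this]
  exact (UniversalEnvelopingAlgebra.lift R f u).2

variable [DistribMulAction H L] [SMulCommClass H R L] [IsLieSMul H L]

variable {R H L} {C : Type*} [Ring C] [Algebra R C]

/-- A Lie algebra homomorphism `L → C` and a compatible monoid homomorphism `H → C` induce an
algebra homomorphism on the crossed product `U(L) ♯ R[H]`. -/
noncomputable def crossedLift (f : L →ₗ⁅R⁆ C) (φ : H →* C)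
    (h : ∀ g x, f (g • x) * φ g = φ g * f x) : Crossed R H L →ₐ[R] C :=
  SkewMonoidAlgebra.liftNCAlgHom (UniversalEnvelopingAlgebra.lift R f) φ (by
    intro u g
    have hu : u ∈ Algebra.adjoin R (Set.range (UniversalEnvelopingAlgebra.ι R (L := L))) := by
      rw [adjoin_range_ι]; trivial
    induction hu using Algebra.adjoin_induction with
    | mem x hx =>
      obtain ⟨x, rfl⟩ := hx
      rw [smul_ι, UniversalEnvelopingAlgebra.lift_ι_apply,
        UniversalEnvelopingAlgebra.lift_ι_apply, h]
    | algebraMap r =>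
      rw [smul_algebraMap, AlgHom.commutes, Algebra.commutes]
    | add x y _ _ hx hy => rw [smul_add, map_add, map_add, add_mul, mul_add, hx, hy]
    | mul x y _ _ hx hy =>
      rw [MulSemiringAction.smul_mul, map_mul, map_mul, mul_assoc, hy, ← mul_assoc, hx,
        mul_assoc])

theorem crossedLift_single (f : L →ₗ⁅R⁆ C) (φ : H →* C) (h) (g : H)
    (u : UniversalEnvelopingAlgebra R L) :
    crossedLift f φ h (SkewMonoidAlgebra.single g u) =
      UniversalEnvelopingAlgebra.lift R f u * φ g :=
  SkewMonoidAlgebra.liftNC_single _ _ _ _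

theorem crossedLift_ofGroup (f : L →ₗ⁅R⁆ C) (φ : H →* C) (h) (g : H) :
    crossedLift f φ h (ofGroup R L g) = φ g := by
  rw [ofGroup, crossedLift_single, map_one, one_mul]

theorem crossedLift_ofLie (f : L →ₗ⁅R⁆ C) (φ : H →* C) (h) (x : L) :
    crossedLift f φ h (ofLie R H x) = f x := by
  rw [ofLie, crossedLift_single, UniversalEnvelopingAlgebra.lift_ι_apply, map_one, mul_one]

theorem crossed_hom_ext {F F' : Crossed R H L →ₐ[R] C}
    (h1 : ∀ g, F (ofGroup R L g) = F' (ofGroup R L g))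
    (h2 : ∀ x, F (ofLie R H x) = F' (ofLie R H x)) : F = F' := by
  have h3 : ∀ u : UniversalEnvelopingAlgebra R L,
      F (SkewMonoidAlgebra.single 1 u) = F' (SkewMonoidAlgebra.single 1 u) := by
    intro u
    have hu : u ∈ Algebra.adjoin R (Set.range (UniversalEnvelopingAlgebra.ι R (L := L))) := by
      rw [adjoin_range_ι]; trivial
    induction hu using Algebra.adjoin_induction with
    | mem x hx =>
      obtain ⟨x, rfl⟩ := hx
      exact h2 x
    | algebraMap r =>
      have : (SkewMonoidAlgebra.single 1 (algebraMap R _ r) : Crossed R H L) =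
          algebraMap R _ r := rfl
      rw [this, AlgHom.commutes, AlgHom.commutes]
    | add x y _ _ hx hy => rw [SkewMonoidAlgebra.single_add, map_add, map_add, hx, hy]
    | mul x y _ _ hx hy =>
      have : (SkewMonoidAlgebra.single 1 (x * y) : Crossed R H L) =
          SkewMonoidAlgebra.single 1 x * SkewMonoidAlgebra.single 1 y := by
        rw [single_mul_single, one_smul, mul_one]
      rw [this, map_mul, map_mul, hx, hy]
  refine AlgHom.ext fun a => ?_
  induction a using SkewMonoidAlgebra.induction_on with
  | zero => simp
  | single g u =>
    have : (SkewMonoidAlgebra.single g u : Crossed R H L) =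
        SkewMonoidAlgebra.single 1 u * ofGroup R L g := by
      rw [ofGroup, single_mul_single, one_smul, mul_one, one_mul]
    rw [this, map_mul, map_mul, h3, h1]
  | add x y hx hy => rw [map_add, map_add, hx, hy]

end Lift

end LieEnveloping

namespace AlgFiltration

variable {R : Type u} {A : Type v} [CommRing R] [Ring A] [Algebra R A] (J : AlgFiltration R A)

theorem toGr_add {m : ℕ} {a b : A} (ha : a ∈ J m) (hb : b ∈ J m) :
    J.toGr m (a + b) (add_mem ha hb) = J.toGr m a ha + J.toGr m b hb := by
  rw [toGr, toGr, toGr, ← map_add]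
  rfl

theorem toGr_sub {m : ℕ} {a b : A} (ha : a ∈ J m) (hb : b ∈ J m) :
    J.toGr m (a - b) (sub_mem ha hb) = J.toGr m a ha - J.toGr m b hb := by
  rw [toGr, toGr, toGr, ← map_sub]
  rfl

theorem toGr_eq_zero {m : ℕ} {a : A} (ha : a ∈ J m) (h : a ∈ J (m + 1)) : J.toGr m a ha = 0 := by
  rw [toGr, show J.cls m a ha = 0 from (J.proj_eq_zero_iff ⟨a, ha⟩).2 h, map_zero]

theorem toGr_congr {m n : ℕ} {a b : A} (ha : a ∈ J m) (hb : b ∈ J n) (hmn : m = n)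
    (h : a - b ∈ J (m + 1)) : J.toGr m a ha = J.toGr n b hb := by
  subst hmn
  rw [← sub_eq_zero, ← J.toGr_sub, J.toGr_eq_zero _ h]

end AlgFiltration

/-! ### The homomorphism `Υ` -/

namespace ExtendedNSeries

section Upsilon

attribute [local instance 100] LieRing.ofAssociativeRing

variable {G : Type u} [Group G] (K : ExtendedNSeries G) (R : Type v) [CommRing R]

/-- The homomorphism `g K 1 ↦ g + J 1` of `K 0 / K 1` into the degree `0` part. -/
noncomputable def groupHom : K.grZero →* K.GrJ R :=
  QuotientGroup.lift (K 1)
    { toFun := K.grJOfGroup R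
      map_one' := (K.groupRingFiltration R).toGr_congr _ _ rfl
        (by rw [map_one, sub_self]; exact zero_mem _)
      map_mul' g h := by
        rw [grJOfGroup, grJOfGroup, grJOfGroup, AlgFiltration.toGr_mul_toGr]
        exact (K.groupRingFiltration R).toGr_congr _ _ rfl (by simp) }
    (fun g hg => (K.groupRingFiltration R).toGr_congr _ _ rfl
      (K.of_sub_one_mem_J R (m := 1) hg))

@[simp] theorem groupHom_mk (g : G) : K.groupHom R (QuotientGroup.mk g) = K.grJOfGroup R g := rfl

/-- The additive map `x K (m + 1) ↦ (x - 1) + J (m + 1)`. -/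
noncomputable def lieHom : K.GrPlus →+ K.GrJ R :=
  K.liftPlus fun m => K.liftGr m (fun x hx => K.grJOfLie R m x hx)
    (fun x hx y hy => by
      rw [grJOfLie, grJOfLie, grJOfLie, ← AlgFiltration.toGr_add]
      refine (K.groupRingFiltration R).toGr_congr _ _ rfl ?_
      have e : MonoidAlgebra.of R G (x * y) - 1 -
          (MonoidAlgebra.of R G x - 1 + (MonoidAlgebra.of R G y - 1)) =
          (MonoidAlgebra.of R G x - 1) * (MonoidAlgebra.of R G y - 1) := by
        rw [map_mul]; noncomm_ring
      rw [e]
      exact K.J_antitone R (by have := m.pos; omega)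
        ((K.groupRingFiltration R).mul_mem (K.of_sub_one_mem_J R hx) (K.of_sub_one_mem_J R hy)))
    (fun x hx hx' => show K.grJOfLie R m x hx = 0 from
      (K.groupRingFiltration R).toGr_eq_zero _ (K.of_sub_one_mem_J R (m := m + 1) hx'))

@[simp] theorem lieHom_toGr {m : ℕ+} {x : G} (hx : x ∈ K m) :
    K.lieHom R (K.toGr m x hx) = K.grJOfLie R m x hx := by
  rw [lieHom, liftPlus_toGr]
  rfl

theorem lieHom_lie (x y : K.GrPlus) : K.lieHom R ⁅x, y⁆ = ⁅K.lieHom R x, K.lieHom R y⁆ := by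
  induction x using K.plus_ind with
  | h0 => simp
  | hadd x x' hx hx' => simp only [add_lie, map_add, hx, hx']
  | h i a ha =>
  induction y using K.plus_ind with
  | h0 => simp
  | hadd x x' hx hx' => simp only [lie_add, map_add, hx, hx']
  | h j b hb =>
    have hba := K.lie_mem' ha hb
    have ha1 := K.of_sub_one_mem_J R ha
    have hb1 := K.of_sub_one_mem_J R hb
    have h2 := (K.groupRingFiltration R).mul_mem ha1 hb1
    have h3 : (MonoidAlgebra.of R G b - 1) * (MonoidAlgebra.of R G a - 1) ∈
        K.groupRingFiltration R (i + j) := by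
      rw [add_comm (i : ℕ)]; exact (K.groupRingFiltration R).mul_mem hb1 ha1
    rw [lie_toGr, lieHom_toGr, lieHom_toGr, lieHom_toGr, LieRing.of_associative_ring_bracket,
      grJOfLie, grJOfLie, grJOfLie, AlgFiltration.toGr_mul_toGr, AlgFiltration.toGr_mul_toGr,
      (K.groupRingFiltration R).toGr_congr _ h3 (add_comm _ _) (by simp),
      ← AlgFiltration.toGr_sub]
    refine (K.groupRingFiltration R).toGr_congr _ _ rfl ?_
    -- `[a, b] - 1 = ((a - 1) (b - 1) - (b - 1) (a - 1)) a⁻¹ b⁻¹`, and `a⁻¹ b⁻¹ - 1 ∈ J 1`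
    set c := MonoidAlgebra.of R G (a⁻¹ * b⁻¹) with hc
    have e : MonoidAlgebra.of R G ⁅a, b⁆ - 1 -
        ((MonoidAlgebra.of R G a - 1) * (MonoidAlgebra.of R G b - 1) -
          (MonoidAlgebra.of R G b - 1) * (MonoidAlgebra.of R G a - 1)) =
        ((MonoidAlgebra.of R G a - 1) * (MonoidAlgebra.of R G b - 1) -
          (MonoidAlgebra.of R G b - 1) * (MonoidAlgebra.of R G a - 1)) * (c - 1) := by
      have e1 : MonoidAlgebra.of R G a * MonoidAlgebra.of R G b * c =
          MonoidAlgebra.of R G ⁅a, b⁆ := by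
        rw [hc, ← map_mul, ← map_mul, commutatorElement_def]; simp only [mul_assoc]
      have e2 : MonoidAlgebra.of R G b * MonoidAlgebra.of R G a * c = 1 := by
        rw [hc, ← map_mul, ← map_mul, ← map_one (MonoidAlgebra.of R G)]
        congr 1; group
      have e3 : (MonoidAlgebra.of R G a - 1) * (MonoidAlgebra.of R G b - 1) -
          (MonoidAlgebra.of R G b - 1) * (MonoidAlgebra.of R G a - 1) =
          MonoidAlgebra.of R G a * MonoidAlgebra.of R G b -
            MonoidAlgebra.of R G b * MonoidAlgebra.of R G a := by noncomm_ring
      rw [e3, mul_sub, sub_mul, e1, e2, mul_one]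
    rw [e]
    have hc1 : c - 1 ∈ K.groupRingFiltration R 1 :=
      K.of_sub_one_mem_J R (m := 1)
        (mul_mem (inv_mem (K.mem_of_pos ha)) (inv_mem (K.mem_of_pos hb)))
    exact (K.groupRingFiltration R).mul_mem (sub_mem h2 h3) hc1

theorem lieHom_smul (g : K.grZero) (x : K.GrPlus) :
    K.lieHom R (g • x) * K.groupHom R g = K.groupHom R g * K.lieHom R x := by
  induction g using QuotientGroup.induction_on with | H g =>
  induction x using K.plus_ind with
  | h0 => simp
  | hadd x x' hx hx' => simp only [smul_add, map_add, add_mul, mul_add, hx, hx']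
  | h i a ha =>
    rw [smul_toGr, lieHom_toGr, lieHom_toGr, groupHom_mk, grJOfLie, grJOfLie, grJOfGroup,
      AlgFiltration.toGr_mul_toGr, AlgFiltration.toGr_mul_toGr]
    refine (K.groupRingFiltration R).toGr_congr _ _ (add_comm _ _) ?_
    rw [sub_mul, mul_sub, ← map_mul, ← map_mul, inv_mul_cancel_right]
    simp

/-- The Lie ring homomorphism `x K (m + 1) ↦ (x - 1) + J (m + 1)`. -/
noncomputable def lieHomInt : K.GrPlus →ₗ⁅ℤ⁆ K.GrJ ℤ :=
  { (K.lieHom ℤ).toIntLinearMap with map_lie' := fun {x y} => K.lieHom_lie ℤ x y }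

/-- The homomorphism `Υ`, as a `ℤ`-algebra homomorphism. -/
noncomputable def upsilon : K.U →ₐ[ℤ] K.GrJ ℤ :=
  LieEnveloping.crossedLift K.lieHomInt (K.groupHom ℤ) (K.lieHom_smul ℤ)

theorem upsilon_ofGroup (g : G) :
    K.upsilon (LieEnveloping.ofGroup ℤ K.GrPlus (QuotientGroup.mk g : K.grZero)) =
      K.grJOfGroup ℤ g :=
  LieEnveloping.crossedLift_ofGroup K.lieHomInt (K.groupHom ℤ) (K.lieHom_smul ℤ) _

theorem upsilon_ofLie (x : K.GrPlus) :
    K.upsilon (LieEnveloping.ofLie ℤ K.grZero x) = K.lieHom ℤ x :=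
  LieEnveloping.crossedLift_ofLie K.lieHomInt (K.groupHom ℤ) (K.lieHom_smul ℤ) x

theorem existsUnique_upsilon : ∃! Υ : K.U →+* K.GrJ ℤ, K.IsUpsilon Υ := by
  refine ⟨K.upsilon.toRingHom, ⟨K.upsilon_ofGroup, fun m x hx => ?_⟩, ?_⟩
  · exact (K.upsilon_ofLie _).trans (K.lieHom_toGr ℤ hx)
  · rintro F ⟨h1, h2⟩
    let F' : K.U →ₐ[ℤ] K.GrJ ℤ :=
      { F with
        commutes' := fun n => by
          change F _ = _
          rw [eq_intCast (algebraMap ℤ K.U), eq_intCast (algebraMap ℤ (K.GrJ ℤ))]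
          exact map_intCast F n }
    have : F' = K.upsilon := by
      refine LieEnveloping.crossed_hom_ext (fun g => ?_) (fun x => ?_)
      · induction g using QuotientGroup.induction_on with | H g =>
        exact (h1 g).trans (K.upsilon_ofGroup g).symm
      · rw [upsilon_ofLie]
        change F _ = K.lieHom ℤ x
        induction x using K.plus_ind with
        | h0 => simp [LieEnveloping.ofLie]
        | hadd x y hx hy =>
          rw [map_add, ← hx, ← hy, ← map_add]
          simp [LieEnveloping.ofLie]
        | h m x hx => rw [h2, lieHom_toGr]
    rw [← this]

/-- The rational version of the map `x K (m + 1) ↦ (x - 1) + J (m + 1)`. -/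
noncomputable def lieHomRat : K.GrPlusRat →ₗ⁅ℚ⁆ K.GrJ ℚ :=
  { (K.lieHom ℚ).toIntLinearMap.liftBaseChange ℚ with
    map_lie' := fun {x y} => by
      change (K.lieHom ℚ).toIntLinearMap.liftBaseChange ℚ _ =
        ⁅(K.lieHom ℚ).toIntLinearMap.liftBaseChange ℚ x,
          (K.lieHom ℚ).toIntLinearMap.liftBaseChange ℚ y⁆
      induction x using TensorProduct.induction_on with
      | zero => simp
      | add x x' hx hx' => simp only [add_lie, map_add, hx, hx']
      | tmul q x =>
      induction y using TensorProduct.induction_on with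
      | zero => simp
      | add x x' hx hx' => simp only [lie_add, map_add, hx, hx']
      | tmul r y =>
      simp only [LieAlgebra.ExtendScalars.bracket_tmul, LinearMap.liftBaseChange_tmul,
        AddMonoidHom.coe_toIntLinearMap, lieHom_lie, smul_lie, lie_smul, mul_smul]
      exact smul_comm _ _ _ }

@[simp] theorem lieHomRat_tmul (q : ℚ) (x : K.GrPlus) :
    K.lieHomRat (q ⊗ₜ[ℤ] x) = q • K.lieHom ℚ x :=
  LinearMap.liftBaseChange_tmul _ _ _ _

theorem lieHomRat_smul (g : K.grZero) (x : K.GrPlusRat) :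
    K.lieHomRat (g • x) * K.groupHom ℚ g = K.groupHom ℚ g * K.lieHomRat x := by
  induction x using TensorProduct.induction_on with
  | zero => simp
  | add x x' hx hx' => simp only [smul_add, map_add, add_mul, mul_add, hx, hx']
  | tmul q x =>
    rw [smul_tmul_rat, lieHomRat_tmul, lieHomRat_tmul, smul_mul_assoc, lieHom_smul,
      mul_smul_comm]

/-- The rational version of `Υ`. -/
noncomputable def upsilonRat : K.URat →ₐ[ℚ] K.GrJ ℚ :=
  LieEnveloping.crossedLift K.lieHomRat (K.groupHom ℚ) K.lieHomRat_smul

theorem upsilonRat_ofGroup (g : G) :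
    K.upsilonRat (LieEnveloping.ofGroup ℚ K.GrPlusRat (QuotientGroup.mk g : K.grZero)) =
      K.grJOfGroup ℚ g :=
  LieEnveloping.crossedLift_ofGroup K.lieHomRat (K.groupHom ℚ) K.lieHomRat_smul _

theorem upsilonRat_ofLie (x : K.GrPlusRat) :
    K.upsilonRat (LieEnveloping.ofLie ℚ K.grZero x) = K.lieHomRat x :=
  LieEnveloping.crossedLift_ofLie K.lieHomRat (K.groupHom ℚ) K.lieHomRat_smul x

theorem upsilonRat_single (g : K.grZero) (u : UniversalEnvelopingAlgebra ℚ K.GrPlusRat) :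
    K.upsilonRat (SkewMonoidAlgebra.single g u) =
      UniversalEnvelopingAlgebra.lift ℚ K.lieHomRat u * K.groupHom ℚ g :=
  LieEnveloping.crossedLift_single _ _ _ _ _

theorem isUpsilonRat_upsilonRat : K.IsUpsilonRat K.upsilonRat := by
  refine ⟨K.upsilonRat_ofGroup, fun m x hx => ?_⟩
  rw [upsilonRat_ofLie, lieHomRat_tmul, one_smul, lieHom_toGr]

theorem eq_upsilonRat {F : K.URat →ₐ[ℚ] K.GrJ ℚ} (h : K.IsUpsilonRat F) : F = K.upsilonRat := by
  obtain ⟨h1, h2⟩ := h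
  refine LieEnveloping.crossed_hom_ext (fun g => ?_) (fun x => ?_)
  · induction g using QuotientGroup.induction_on with | H g =>
    exact (h1 g).trans (K.upsilonRat_ofGroup g).symm
  · rw [upsilonRat_ofLie]
    have hadd : ∀ x y : K.GrPlusRat, F (LieEnveloping.ofLie ℚ K.grZero (x + y)) =
        F (LieEnveloping.ofLie ℚ K.grZero x) + F (LieEnveloping.ofLie ℚ K.grZero y) := by
      intro x y
      rw [← map_add]
      simp [LieEnveloping.ofLie]
    have hzero : F (LieEnveloping.ofLie ℚ K.grZero (0 : K.GrPlusRat)) = 0 := by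
      simp [LieEnveloping.ofLie]
    induction x using TensorProduct.induction_on with
    | zero => rw [hzero, map_zero]
    | add x y hx hy => rw [hadd, map_add, hx, hy]
    | tmul q x =>
      induction x using K.plus_ind with
      | h0 => rw [TensorProduct.tmul_zero, hzero, map_zero]
      | hadd x y hx hy => rw [TensorProduct.tmul_add, hadd, map_add, hx, hy]
      | h m x hx =>
        have e : LieEnveloping.ofLie ℚ K.grZero (q ⊗ₜ[ℤ] K.toGr m x hx : K.GrPlusRat) =
            q • LieEnveloping.ofLie ℚ K.grZero ((1 : ℚ) ⊗ₜ[ℤ] K.toGr m x hx : K.GrPlusRat) := by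
          rw [LieEnveloping.ofLie, LieEnveloping.ofLie, SkewMonoidAlgebra.smul_single,
            ← map_smul, TensorProduct.smul_tmul', smul_eq_mul, mul_one]
        rw [e, map_smul, h2, lieHomRat_tmul, lieHom_toGr]

end Upsilon

end ExtendedNSeries

/-! ### Roots of unipotent elements in nilpotently filtered algebras -/

section Roots

variable {B : Type*} [Ring B] [Algebra ℚ B]

/-- A decreasing multiplicative filtration of a `ℚ`-algebra `B` by subspaces, with `1 ∈ E 0` and
`E k = 0`. In contrast to `AlgFiltration`, the step `E 0` need not be all of `B`. -/
structure IsNilpotentFiltration (E : ℕ → Submodule ℚ B) (k : ℕ) : Prop where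
  mul_mem : ∀ {i j : ℕ} {a b : B}, a ∈ E i → b ∈ E j → a * b ∈ E (i + j)
  antitone : Antitone E
  one_mem : 1 ∈ E 0
  eq_bot : E k = ⊥

namespace IsNilpotentFiltration

variable {E : ℕ → Submodule ℚ B} {k : ℕ} (hE : IsNilpotentFiltration E k)

include hE

theorem mul_mem_left {i j : ℕ} {a b : B} (ha : a ∈ E i) (hb : b ∈ E j) : a * b ∈ E i :=
  hE.antitone (Nat.le_add_right i j) (hE.mul_mem ha hb)

theorem pow_sub_one_mem {w : ℕ} {a : B} (ha : a - 1 ∈ E w) (n : ℕ) : a ^ n - 1 ∈ E w := by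
  induction n with
  | zero => simp
  | succ n ih =>
    have e : a ^ (n + 1) - 1 = (a ^ n - 1) + (a - 1) + (a ^ n - 1) * (a - 1) := by
      rw [pow_succ]; noncomm_ring
    rw [e]
    exact add_mem (add_mem ih ha) (hE.mul_mem_left ih ha)

/-- For unipotent `a` and `b`, the difference `a ^ n - b ^ n` is `n (a - b)` to leading order. -/
theorem pow_sub_pow_mem {j : ℕ} {a b : B} (ha : a - 1 ∈ E 1) (hb : b - 1 ∈ E 1)
    (hab : a - b ∈ E j) (n : ℕ) : a ^ n - b ^ n - n • (a - b) ∈ E (j + 1) := by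
  induction n with
  | zero => simp
  | succ n ih =>
    have h1 : a ^ n - b ^ n ∈ E j := by
      have := add_mem (hE.antitone (Nat.le_succ j) ih) (Submodule.smul_of_tower_mem (E j) n hab)
      rwa [sub_add_cancel] at this
    have e : a ^ (n + 1) - b ^ (n + 1) - (n + 1) • (a - b) =
        (a ^ n - b ^ n - n • (a - b)) + (a ^ n - b ^ n) * (a - 1) + (b ^ n - 1) * (a - b) := by
      rw [pow_succ, pow_succ, add_smul]; noncomm_ring
    rw [e]
    refine add_mem (add_mem ih (hE.mul_mem h1 ha)) ?_
    rw [add_comm j]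
    exact hE.mul_mem (hE.pow_sub_one_mem hb n) hab

/-- Unipotent elements have at most one `n`-th root that is unipotent. -/
theorem eq_of_pow_eq {a b : B} (ha : a - 1 ∈ E 1) (hb : b - 1 ∈ E 1) {n : ℕ} (hn : n ≠ 0)
    (h : a ^ n = b ^ n) : a = b := by
  have key : ∀ j, a - b ∈ E (j + 1) := by
    intro j
    induction j with
    | zero => simpa using sub_mem ha hb
    | succ j ih =>
      have := hE.pow_sub_pow_mem ha hb ih n
      rw [h, sub_self, zero_sub] at this
      have h2 := Submodule.smul_mem _ (-(n : ℚ)⁻¹) this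
      rwa [← Nat.cast_smul_eq_nsmul ℚ, smul_neg, neg_smul, neg_neg, smul_smul,
        inv_mul_cancel₀ (Nat.cast_ne_zero.2 hn), one_smul] at h2
  have := hE.antitone (Nat.le_succ k) (key k)
  rw [hE.eq_bot, Submodule.mem_bot, sub_eq_zero] at this
  exact this

theorem exists_pow_eq {w : ℕ} (hw : 1 ≤ w) {g : B} (hg : g - 1 ∈ E w) {n : ℕ} (hn : n ≠ 0) :
    ∃ a, a - 1 ∈ E w ∧ a ^ n = g := by
  -- successive approximation: Newton's correction `a - (a ^ n - g) / n` gains a degree each time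
  have key : ∀ j, ∃ a, a - 1 ∈ E w ∧ a ^ n - g ∈ E (w + j) := by
    intro j
    induction j with
    | zero => exact ⟨1, by simp, by simpa using neg_mem hg⟩
    | succ j ih =>
      obtain ⟨a, h1, h2⟩ := ih
      set d := (n : ℚ)⁻¹ • (a ^ n - g) with hd
      have hdj : d ∈ E (w + j) := Submodule.smul_mem _ _ h2
      have h3 : (a - d) - 1 ∈ E w := by
        rw [sub_right_comm]
        exact sub_mem h1 (hE.antitone (Nat.le_add_right _ _) hdj)
      refine ⟨a - d, h3, ?_⟩
      have := hE.pow_sub_pow_mem (a := a - d) (b := a) (hE.antitone hw h3) (hE.antitone hw h1)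
        (by simpa using hdj) n
      have e : n • (a - d - a) = -(a ^ n - g) := by
        rw [sub_sub_cancel_left, hd, smul_neg, ← Nat.cast_smul_eq_nsmul ℚ, smul_smul,
          mul_inv_cancel₀ (Nat.cast_ne_zero.2 hn), one_smul]
      rw [e, sub_neg_eq_add, sub_add_sub_cancel] at this
      exact this
  obtain ⟨a, h1, h2⟩ := key k
  refine ⟨a, h1, ?_⟩
  have := hE.antitone (Nat.le_add_left k w) h2
  rwa [hE.eq_bot, Submodule.mem_bot, sub_eq_zero] at this

theorem inv_sub_one_mem {w : ℕ} (hw : 1 ≤ w) {u : Bˣ} (hu : (u : B) - 1 ∈ E w) :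
    ((u⁻¹ : Bˣ) : B) - 1 ∈ E w := by
  -- the inverse is the finite geometric series in `1 - u`
  have h1 : ∀ j, (1 - (u : B)) ^ (j + 1) ∈ E (w + j) := by
    intro j
    have hu' : 1 - (u : B) ∈ E w := by simpa using neg_mem hu
    induction j with
    | zero => simpa using hu'
    | succ j ih =>
      rw [pow_succ]
      exact hE.antitone (by omega) (hE.mul_mem ih hu')
  have h2 : (1 - (u : B)) ^ (k + 1) = 0 := by
    have := hE.antitone (Nat.le_add_left k w) (h1 k)
    rwa [hE.eq_bot, Submodule.mem_bot] at this
  have h3 : ((u⁻¹ : Bˣ) : B) = ∑ i ∈ Finset.range (k + 1), (1 - (u : B)) ^ i := by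
    have := mul_neg_geom_sum (1 - (u : B)) (k + 1)
    rw [h2, sub_zero, sub_sub_cancel] at this
    exact Units.inv_eq_of_mul_eq_one_right this
  rw [h3, Finset.sum_range_succ', pow_zero, add_sub_cancel_right]
  exact sum_mem fun i _ => hE.antitone (Nat.le_add_right _ _) (h1 i)

/-- The group of units `u` with `u - 1 ∈ E w`, for `w ≥ 1`. -/
def unip (w : ℕ) (hw : 1 ≤ w) : Subgroup Bˣ where
  carrier := {u | (u : B) - 1 ∈ E w}
  one_mem' := by simp
  mul_mem' := by
    intro a b ha hb
    have e : ((a * b : Bˣ) : B) - 1 = (a - 1 : B) + (b - 1) + (a - 1) * (b - 1) := by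
      rw [Units.val_mul]; noncomm_ring
    change _ ∈ E w
    rw [e]
    exact add_mem (add_mem ha hb) (hE.mul_mem_left ha hb)
  inv_mem' := fun h => hE.inv_sub_one_mem hw h

theorem unip_eq_of_pow_eq {w : ℕ} {hw : 1 ≤ w} {a b : Bˣ} (ha : a ∈ hE.unip w hw)
    (hb : b ∈ hE.unip w hw) {n : ℕ} (hn : n ≠ 0) (h : a ^ n = b ^ n) : a = b :=
  Units.ext (hE.eq_of_pow_eq (hE.antitone hw ha) (hE.antitone hw hb) hn
    (by rw [← Units.val_pow_eq_pow_val, h, Units.val_pow_eq_pow_val]))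

theorem exists_unip_pow_eq {w : ℕ} {hw : 1 ≤ w} {g : Bˣ} (hg : g ∈ hE.unip w hw) {n : ℕ}
    (hn : n ≠ 0) : ∃ a ∈ hE.unip w hw, a ^ n = g := by
  obtain ⟨a, h1, h2⟩ := hE.exists_pow_eq hw hg hn
  have hu : IsUnit a := (isUnit_pow_iff hn).1 (h2 ▸ g.isUnit)
  exact ⟨hu.unit, h1, Units.ext h2⟩

end IsNilpotentFiltration

end Roots

/-! ### Extending homomorphisms to cyclic extensions -/

section CyclicExtension

variable {H G X : Type*} [Group H] [Group G] [Group X]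

theorem map_zpow_mulAut (f : H →* X) (c : MulAut H) (t : X) (h : ∀ x, f (c x) = t * f x * t⁻¹)
    (n : ℤ) (x : H) : f ((c ^ n) x) = t ^ n * f x * (t ^ n)⁻¹ := by
  have h' : ∀ x, f (c⁻¹ x) = t⁻¹ * f x * t := by
    intro x
    have := h (c⁻¹ x)
    rw [MulAut.apply_inv_self] at this
    rw [this]; group
  induction n using Int.induction_on generalizing x with
  | zero => simp
  | succ i ih =>
    rw [zpow_add_one, MulAut.mul_apply, ih, h]; group
  | pred i ih =>
    rw [zpow_sub_one, MulAut.mul_apply, ih, h']; group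

/-- A homomorphism `ρ` on a normal subgroup `H` of `G = H ⟨t⟩` extends to `G` by `t ↦ T`, as soon
as `T` acts on `ρ(H)` as `t` acts on `H`, and `T ^ n = ρ(t ^ n)` whenever `t ^ n ∈ H`. -/
theorem exists_hom_extension {κ : H →* G} (t : G)
    (hgen : ∀ y : G, ∃ (x : H) (n : ℤ), y = κ x * t ^ n) (c : MulAut H)
    (hc : ∀ x, κ (c x) = t * κ x * t⁻¹) (ρ : H →* X) (T : X)
    (hT : ∀ x, ρ (c x) = T * ρ x * T⁻¹) (hTn : ∀ x (n : ℤ), κ x = t ^ n → ρ x = T ^ n) :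
    ∃ ρ' : G →* X, ∀ x (n : ℤ), ρ' (κ x * t ^ n) = ρ x * T ^ n := by
  -- the extension is independent of the way an element is written as `x t ^ n`
  choose a n han using hgen
  have key : ∀ (x : H) (m : ℤ),
      ρ (a (κ x * t ^ m)) * T ^ (n (κ x * t ^ m)) = ρ x * T ^ m := by
    intro x m
    set y := κ x * t ^ m with hy
    have h1 : κ (x⁻¹ * a y) = t ^ (m - n y) := by
      rw [map_mul, map_inv, zpow_sub, eq_mul_inv_iff_mul_eq, mul_assoc, ← han y, hy,
        inv_mul_cancel_left]
    have h2 := hTn _ _ h1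
    rw [map_mul, map_inv, zpow_sub, eq_mul_inv_iff_mul_eq, mul_assoc, inv_mul_eq_iff_eq_mul]
      at h2
    exact h2
  refine ⟨MonoidHom.mk' (fun y => ρ (a y) * T ^ n y) fun y y' => ?_, key⟩
  have h3 : y * y' = κ (a y * (c ^ n y) (a y')) * t ^ (n y + n y') := by
    rw [map_mul, map_zpow_mulAut κ c t hc, zpow_add]
    conv_lhs => rw [han y, han y']
    group
  have h4 := key (a y * (c ^ n y) (a y')) (n y + n y')
  rw [← h3] at h4
  rw [h4, map_mul, map_zpow_mulAut ρ c T hT, zpow_add]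
  group

end CyclicExtension

namespace ExtendedNSeries

/-! ### The filtration of a cyclic extension -/

section CyclicStep

variable {G H : Type*} [Group G] [Group H]

/-- The preimage of an extended N-series under a group homomorphism. -/
def comap (K : ExtendedNSeries G) (κ : H →* G) : ExtendedNSeries H where
  toFun m := (K m).comap κ
  zero_eq_top := by rw [K.zero_eq_top, Subgroup.comap_top]
  anti m := Subgroup.comap_mono (K.anti m)
  commutator_le m n := by
    rw [Subgroup.commutator_le]
    intro a ha b hb
    rw [Subgroup.mem_comap, map_commutatorElement]
    exact K.lie_mem ha hb

theorem mem_comap {K : ExtendedNSeries G} {κ : H →* G} {m : ℕ} {x : H} :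
    x ∈ K.comap κ m ↔ κ x ∈ K m := Iff.rfl

variable (N : ExtendedNSeries H) (k : ℕ)

/-- The quotient `ℚ[H] / J k`. -/
abbrev Quo : Type _ := MonoidAlgebra ℚ H ⧸ N.J ℚ k

/-- The image of `J j` in `ℚ[H] / J k`. -/
noncomputable def quoFil (j : ℕ) : Submodule ℚ (N.Quo k) := (N.J ℚ j).map (N.J ℚ k).mkQ

/-- The endomorphisms of `ℚ[H] / J k` that raise the filtration degree by `i`. -/
noncomputable def endFil (i : ℕ) : Submodule ℚ (Module.End ℚ (N.Quo k)) where
  carrier := {T | ∀ j, ∀ v ∈ N.quoFil k j, T v ∈ N.quoFil k (j + i)}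
  zero_mem' := fun _ _ _ => zero_mem _
  add_mem' := fun ha hb j v hv => add_mem (ha j v hv) (hb j v hv)
  smul_mem' := fun q _ ha j v hv => Submodule.smul_mem _ q (ha j v hv)

theorem quoFil_anti {i j : ℕ} (h : i ≤ j) : N.quoFil k j ≤ N.quoFil k i :=
  Submodule.map_mono (N.J_antitone ℚ h)

theorem isNilpotentFiltration_endFil : IsNilpotentFiltration (N.endFil k) k where
  mul_mem := by
    intro i j a b ha hb l v hv
    have := ha _ _ (hb l v hv)
    rwa [add_assoc, add_comm j] at this
  antitone := fun i j h a ha l v hv => N.quoFil_anti k (Nat.add_le_add_left h l) (ha l v hv)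
  one_mem := fun _ _ hv => hv
  eq_bot := by
    rw [eq_bot_iff]
    intro T hT
    refine (Submodule.mem_bot ℚ).2 (LinearMap.ext fun v => ?_)
    have h0 : v ∈ N.quoFil k 0 := by
      rw [quoFil, J_zero, Submodule.map_top, Submodule.range_mkQ]; trivial
    have := hT 0 v h0
    rw [zero_add, quoFil, Submodule.mkQ_map_self] at this
    simpa using this

/-- Left multiplication by `x` on `ℚ[H] / J k`. -/
noncomputable def leftMul : H →* (Module.End ℚ (N.Quo k))ˣ :=
  MonoidHom.toHomUnits
    { toFun x := (N.J ℚ k).mapQ (N.J ℚ k) (LinearMap.mulLeft ℚ (MonoidAlgebra.of ℚ H x))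
        (fun _ ha => N.of_mul_mem_J ℚ ha _)
      map_one' := by
        refine Submodule.linearMap_qext _ (LinearMap.ext fun a => ?_)
        simp [← MonoidAlgebra.one_def]
      map_mul' x y := by
        refine Submodule.linearMap_qext _ (LinearMap.ext fun a => ?_)
        change Submodule.Quotient.mk _ = Submodule.Quotient.mk _
        rw [map_mul]
        exact congrArg _ (mul_assoc _ _ _) }

/-- Right multiplication by `x⁻¹` on `ℚ[H] / J k`. -/
noncomputable def rightMul : H →* (Module.End ℚ (N.Quo k))ˣ :=
  MonoidHom.toHomUnits
    { toFun x := (N.J ℚ k).mapQ (N.J ℚ k) (LinearMap.mulRight ℚ (MonoidAlgebra.of ℚ H x⁻¹))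
        (fun _ ha => N.mul_of_mem_J ℚ ha _)
      map_one' := by
        refine Submodule.linearMap_qext _ (LinearMap.ext fun a => ?_)
        simp [← MonoidAlgebra.one_def]
      map_mul' x y := by
        refine Submodule.linearMap_qext _ (LinearMap.ext fun a => ?_)
        change Submodule.Quotient.mk _ = Submodule.Quotient.mk _
        rw [mul_inv_rev, map_mul]
        exact congrArg _ (mul_assoc _ _ _).symm }

theorem leftMul_mk (x : H) (a : MonoidAlgebra ℚ H) :
    (N.leftMul k x : Module.End ℚ (N.Quo k)) (Submodule.Quotient.mk a) =
      Submodule.Quotient.mk (MonoidAlgebra.of ℚ H x * a) := rfl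

theorem rightMul_mk (x : H) (a : MonoidAlgebra ℚ H) :
    (N.rightMul k x : Module.End ℚ (N.Quo k)) (Submodule.Quotient.mk a) =
      Submodule.Quotient.mk (a * MonoidAlgebra.of ℚ H x⁻¹) := rfl

theorem units_ext_mk {S T : (Module.End ℚ (N.Quo k))ˣ}
    (h : ∀ a : MonoidAlgebra ℚ H, (S : Module.End ℚ (N.Quo k)) (Submodule.Quotient.mk a) =
      (T : Module.End ℚ (N.Quo k)) (Submodule.Quotient.mk a)) : S = T :=
  Units.ext (Submodule.linearMap_qext _ (LinearMap.ext h))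

theorem mem_endFil_of_mk {i : ℕ} {T : Module.End ℚ (N.Quo k)}
    (h : ∀ j, ∀ a ∈ N.J ℚ j, ∃ b ∈ N.J ℚ (j + i),
      T (Submodule.Quotient.mk a) = Submodule.Quotient.mk b) : T ∈ N.endFil k i := by
  rintro j _ ⟨a, ha, rfl⟩
  obtain ⟨b, hb, hab⟩ := h j a ha
  exact ⟨b, hb, hab.symm⟩

theorem of_sub_one_mem {i : ℕ} (hi : 1 ≤ i) {x : H} (hx : x ∈ N i) :
    MonoidAlgebra.of ℚ H x - 1 ∈ N.J ℚ i :=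
  N.of_sub_one_mem_J ℚ (m := ⟨i, hi⟩) hx

theorem leftMul_sub_one_mem {i : ℕ} (hi : 1 ≤ i) {x : H} (hx : x ∈ N i) :
    (N.leftMul k x : Module.End ℚ (N.Quo k)) - 1 ∈ N.endFil k i := by
  refine N.mem_endFil_of_mk k fun j a ha => ⟨(MonoidAlgebra.of ℚ H x - 1) * a, ?_, ?_⟩
  · rw [add_comm]
    exact N.J_mul_le ℚ _ _ (Submodule.mul_mem_mul (N.of_sub_one_mem hi hx) ha)
  · rw [sub_mul, one_mul, Submodule.Quotient.mk_sub, ← leftMul_mk]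
    rfl

theorem rightMul_sub_one_mem {i : ℕ} (hi : 1 ≤ i) {x : H} (hx : x ∈ N i) :
    (N.rightMul k x : Module.End ℚ (N.Quo k)) - 1 ∈ N.endFil k i := by
  refine N.mem_endFil_of_mk k fun j a ha => ⟨a * (MonoidAlgebra.of ℚ H x⁻¹ - 1), ?_, ?_⟩
  · exact N.J_mul_le ℚ _ _ (Submodule.mul_mem_mul ha (N.of_sub_one_mem hi (inv_mem hx)))
  · rw [mul_sub, mul_one, Submodule.Quotient.mk_sub, ← rightMul_mk]
    rfl

/-- For an endomorphism `φ` of `H` such that `φ x x⁻¹` lies `w` steps deeper than `x`, the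
operator `φ - 1` on the group ring raises the filtration degree by `w`. -/
theorem mapDomain_sub_mem_J {w : ℕ} (φ : H →* H)
    (hφ : ∀ i x, x ∈ N i → φ x * x⁻¹ ∈ N (w + i)) (hw : 1 ≤ w) {j : ℕ}
    {a : MonoidAlgebra ℚ H} (ha : a ∈ N.J ℚ j) :
    MonoidAlgebra.mapDomainAlgHom ℚ ℚ φ a ∈ N.J ℚ j ∧
      MonoidAlgebra.mapDomainAlgHom ℚ ℚ φ a - a ∈ N.J ℚ (j + w) := by
  -- the pairs `(a, b)` in `J i × J i` with `b - a ∈ J (i + w)` form a multiplicative filtration,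
  -- and `a ↦ (a, φ a)` satisfies the condition on generators
  let E : ℕ → Submodule ℚ (MonoidAlgebra ℚ H × MonoidAlgebra ℚ H) := fun i =>
    { carrier := {p | p.1 ∈ N.J ℚ i ∧ p.2 ∈ N.J ℚ i ∧ p.2 - p.1 ∈ N.J ℚ (i + w)}
      zero_mem' := ⟨zero_mem _, zero_mem _, by simp⟩
      add_mem' := fun ha hb => ⟨add_mem ha.1 hb.1, add_mem ha.2.1 hb.2.1, by
        rw [Prod.snd_add, Prod.fst_add, add_sub_add_comm]
        exact add_mem ha.2.2 hb.2.2⟩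
      smul_mem' := fun q _ ha => ⟨Submodule.smul_mem _ q ha.1, Submodule.smul_mem _ q ha.2.1, by
        rw [Prod.smul_snd, Prod.smul_fst, ← smul_sub]
        exact Submodule.smul_mem _ q ha.2.2⟩ }
  have hsub : ∀ i x, x ∈ N i → MonoidAlgebra.of ℚ H (φ x) - MonoidAlgebra.of ℚ H x ∈
      N.J ℚ (i + w) := by
    intro i x hx
    have e : MonoidAlgebra.of ℚ H (φ x) - MonoidAlgebra.of ℚ H x =
        (MonoidAlgebra.of ℚ H (φ x * x⁻¹) - 1) * MonoidAlgebra.of ℚ H x := by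
      rw [sub_mul, ← map_mul, inv_mul_cancel_right, one_mul]
    rw [e, add_comm]
    exact N.mul_of_mem_J ℚ (N.of_sub_one_mem (by omega) (hφ i x hx)) _
  have hmul : ∀ {i j : ℕ} {a b : MonoidAlgebra ℚ H}, a ∈ N.J ℚ i → b ∈ N.J ℚ j →
      a * b ∈ N.J ℚ (i + j) := fun ha hb => N.J_mul_le ℚ _ _ (Submodule.mul_mem_mul ha hb)
  have hψ : ∀ x, (MonoidAlgebra.mapDomainAlgHom ℚ ℚ φ) (MonoidAlgebra.of ℚ H x) =
      MonoidAlgebra.of ℚ H (φ x) := fun x => by simp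
  have := N.map_J_mem ℚ ((AlgHom.id ℚ _).prod (MonoidAlgebra.mapDomainAlgHom ℚ ℚ φ)) E
    (fun i j a b ha hb => ⟨hmul ha.1 hb.1, hmul ha.2.1 hb.2.1, by
      have e : (a * b).2 - (a * b).1 = (a.2 - a.1) * b.2 + a.1 * (b.2 - b.1) := by
        rw [Prod.snd_mul, Prod.fst_mul]; noncomm_ring
      rw [e]
      refine add_mem ?_ ?_
      · rw [add_right_comm]; exact hmul ha.2.2 hb.2.1
      · rw [add_assoc]; exact hmul ha.1 hb.2.2⟩)
    (fun i a ha => ⟨N.J_anti ℚ i ha.1, N.J_anti ℚ i ha.2.1,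
      N.J_antitone ℚ (by omega) ha.2.2⟩)
    (fun g => ⟨by rw [J_zero]; trivial, by rw [J_zero]; trivial, by
      change MonoidAlgebra.mapDomainAlgHom ℚ ℚ φ (MonoidAlgebra.of ℚ H g) - _ ∈ _
      rw [hψ]; exact hsub 0 g (N.mem_zero g)⟩)
    (fun i x hi hx => ⟨N.of_sub_one_mem hi hx, by
      change MonoidAlgebra.mapDomainAlgHom ℚ ℚ φ (MonoidAlgebra.of ℚ H x) - 1 ∈ _
      rw [hψ]
      have := add_mem (N.J_antitone ℚ (Nat.le_add_right i w) (hsub i x hx))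
        (N.of_sub_one_mem hi hx)
      rwa [sub_add_sub_cancel] at this, by
      change MonoidAlgebra.mapDomainAlgHom ℚ ℚ φ (MonoidAlgebra.of ℚ H x) - 1 -
        (MonoidAlgebra.of ℚ H x - 1) ∈ _
      rw [hψ, sub_sub_sub_cancel_right]; exact hsub i x hx⟩) ha
  exact this.2

theorem mapDomain_J_le (φ : H →* H) (hφ : ∀ i x, x ∈ N i → φ x ∈ N i) {j : ℕ}
    {a : MonoidAlgebra ℚ H} (ha : a ∈ N.J ℚ j) :
    MonoidAlgebra.mapDomainAlgHom ℚ ℚ φ a ∈ N.J ℚ j :=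
  N.map_J_mem ℚ (MonoidAlgebra.mapDomainAlgHom ℚ ℚ φ) (N.J ℚ)
    (fun _ _ _ _ ha hb => N.J_mul_le ℚ _ _ (Submodule.mul_mem_mul ha hb)) (N.J_anti ℚ)
    (fun g => by rw [J_zero]; trivial)
    (fun i x hi hx => by simpa using N.of_sub_one_mem hi (hφ i x hx)) ha

/-- The action on `ℚ[H] / J k` of a group of automorphisms that preserve the N-series. -/
noncomputable def autAct {X : Type*} [Group X] (φ : X →* MulAut H)
    (hφ : ∀ g i x, x ∈ N i → φ g x ∈ N i) : X →* (Module.End ℚ (N.Quo k))ˣ :=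
  MonoidHom.toHomUnits
    { toFun g := (N.J ℚ k).mapQ (N.J ℚ k)
        (MonoidAlgebra.mapDomainAlgHom ℚ ℚ (φ g).toMonoidHom).toLinearMap
        (fun _ ha => N.mapDomain_J_le (φ g).toMonoidHom (hφ g) ha)
      map_one' := by
        refine Submodule.linearMap_qext _ (LinearMap.ext fun a => ?_)
        change Submodule.Quotient.mk (MonoidAlgebra.mapDomainAlgHom ℚ ℚ _ a) =
          Submodule.Quotient.mk a
        rw [map_one, show (1 : MulAut H).toMonoidHom = MonoidHom.id H from rfl,
          MonoidAlgebra.mapDomainAlgHom_id]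
        rfl
      map_mul' g h := by
        refine Submodule.linearMap_qext _ (LinearMap.ext fun a => ?_)
        change Submodule.Quotient.mk (MonoidAlgebra.mapDomainAlgHom ℚ ℚ _ a) =
          Submodule.Quotient.mk (MonoidAlgebra.mapDomainAlgHom ℚ ℚ _
            (MonoidAlgebra.mapDomainAlgHom ℚ ℚ _ a))
        rw [map_mul, show (φ g * φ h).toMonoidHom =
          (φ g).toMonoidHom.comp (φ h).toMonoidHom from rfl, MonoidAlgebra.mapDomainAlgHom_comp]
        rfl }

end CyclicStep

end ExtendedNSeries

namespace ExtendedNSeries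

section CyclicStep

variable {G H : Type*} [Group G] [Group H]

/-- Let `G = H ⟨t⟩`, where `H` is normal in `G = K w` and contains `K (w + 1)`. Then the
filtration of `ℚ[G]` restricts to a filtration of `ℚ[H]` no larger than the one induced by the
N-series `K i ∩ H`. The left regular representation of `H` on `ℚ[H] / J k` is extended to `G`:
`t` acts by conjugation, composed with an `n`-th root of right multiplication by `t ^ n` if
some `t ^ n`, `n ≥ 1`, lies in `H`. The extension still respects the filtrations, so `a ∈ J k`
acts as zero; but it sends the class of `1` to the class of `a`. -/
theorem mem_J_of_map_mem_J (K : ExtendedNSeries G) {κ : H →* G} (hκ : Function.Injective κ)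
    {w : ℕ} (hw : 1 ≤ w) (hKw : K w = ⊤) (hle : K (w + 1) ≤ κ.range) (t : G)
    (hgen : ∀ y : G, ∃ (x : H) (n : ℤ), y = κ x * t ^ n) {k : ℕ} {a : MonoidAlgebra ℚ H}
    (ha : MonoidAlgebra.mapDomainAlgHom ℚ ℚ κ a ∈ K.J ℚ k) : a ∈ (K.comap κ).J ℚ k := by
  set N := K.comap κ with hN
  have hmem : ∀ g : G, g ∈ K w := fun g => by rw [hKw]; trivial
  have hnormal : κ.range.Normal := ⟨fun x hx g => by
    rw [conj_eq_lie_mul]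
    exact mul_mem (hle (K.antitone (by omega) (K.lie_mem (hmem g) (hmem x)))) hx⟩
  -- the conjugation action of `G` on `H`
  let e : H ≃* κ.range := MonoidHom.ofInjective hκ
  let φ : G →* MulAut H := (MulAut.congr e.symm).toMonoidHom.comp MulAut.conjNormal
  have hφ : ∀ g x, κ (φ g x) = g * κ x * g⁻¹ := by
    intro g x
    have h1 : ∀ y, κ (e.symm y) = y := fun y => by
      conv_rhs => rw [← e.apply_symm_apply y]
      rfl
    change κ (e.symm (MulAut.conjNormal g (e x))) = _
    rw [h1, MulAut.conjNormal_apply]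
    rfl
  have hφN : ∀ g i x, x ∈ N i → φ g x ∈ N i := by
    intro g i x hx
    rw [hN, mem_comap, hφ]
    exact K.conj_mem g hx
  have hφw : ∀ g i x, x ∈ N i → φ g x * x⁻¹ ∈ N (w + i) := by
    intro g i x hx
    rw [hN, mem_comap, map_mul, hφ, map_inv]
    exact K.lie_mem (hmem g) hx
  have hE := N.isNilpotentFiltration_endFil k
  set U := hE.unip w hw with hU
  set L := N.leftMul k with hL
  set Rm := N.rightMul k with hRm
  set C := N.autAct k φ hφN with hC
  have hLU : ∀ x, L x ∈ U := fun x => N.leftMul_sub_one_mem k hw (hmem (κ x))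
  have hRU : ∀ x, Rm x ∈ U := fun x => N.rightMul_sub_one_mem k hw (hmem (κ x))
  have hCU : ∀ g, C g ∈ U := fun g => by
    refine N.mem_endFil_of_mk k fun j b hb => ⟨_, (N.mapDomain_sub_mem_J (φ g).toMonoidHom
      (hφw g) hw hb).2, ?_⟩
    rw [Submodule.Quotient.mk_sub]
    rfl
  have hLR : ∀ x y, L x * Rm y = Rm y * L x := fun x y => N.units_ext_mk k fun b =>
    congrArg Submodule.Quotient.mk (mul_assoc _ _ _).symm
  have hCL : ∀ g x, C g * L x = L (φ g x) * C g := fun g x => N.units_ext_mk k fun b => by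
    change Submodule.Quotient.mk (MonoidAlgebra.mapDomainAlgHom ℚ ℚ (φ g).toMonoidHom
        (MonoidAlgebra.of ℚ H x * b)) = Submodule.Quotient.mk (MonoidAlgebra.of ℚ H (φ g x) *
        MonoidAlgebra.mapDomainAlgHom ℚ ℚ (φ g).toMonoidHom b)
    rw [map_mul]
    simp
  have hCR : ∀ g x, C g * Rm x = Rm (φ g x) * C g := fun g x => N.units_ext_mk k fun b => by
    change Submodule.Quotient.mk (MonoidAlgebra.mapDomainAlgHom ℚ ℚ (φ g).toMonoidHom
        (b * MonoidAlgebra.of ℚ H x⁻¹)) = Submodule.Quotient.mk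
        (MonoidAlgebra.mapDomainAlgHom ℚ ℚ (φ g).toMonoidHom b *
          MonoidAlgebra.of ℚ H (φ g x)⁻¹)
    rw [map_mul]
    simp
  have hCκ : ∀ h, C (κ h) = L h * Rm h := fun h => N.units_ext_mk k fun b => by
    change Submodule.Quotient.mk (MonoidAlgebra.mapDomainAlgHom ℚ ℚ _ b) =
      Submodule.Quotient.mk (MonoidAlgebra.of ℚ H h * (b * MonoidAlgebra.of ℚ H h⁻¹))
    congr 1
    have hφh : ∀ x, φ (κ h) x = h * x * h⁻¹ := fun x => hκ (by simp [hφ])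
    induction b using MonoidAlgebra.induction_linear with
    | zero => simp
    | add x y hx hy => rw [map_add, hx, hy, add_mul, mul_add]
    | single g r => simp [hφh, MonoidAlgebra.single_mul_single, mul_assoc]
  -- `C t` is conjugation by `t`; on powers `t ^ n = κ h` it is `L h * Rm h` instead of `L h`, and
  -- `S` is the unipotent `n`-th root of `(Rm h)⁻¹` that corrects this. By uniqueness of roots, `S`
  -- commutes with every unipotent operator that commutes with `Rm h`.
  obtain ⟨S, hSU, hSL, hSC, hSt⟩ : ∃ S ∈ U, (∀ x, S * L x = L x * S) ∧
      C t * S = S * C t ∧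
      ∀ x (m : ℤ), κ x = t ^ m → L x = (C t * S) ^ m := by
    by_cases hex : ∃ (n : ℕ) (h : H), n ≠ 0 ∧ κ h = t ^ n
    · obtain ⟨n, h, hn, hh⟩ := hex
      obtain ⟨S, hSU, hSn⟩ := hE.exists_unip_pow_eq (inv_mem (hRU h)) hn
      have hcomm : ∀ V ∈ U, V * Rm h = Rm h * V → V * S = S * V := by
        intro V hV hVR
        rw [← mul_inv_eq_iff_eq_mul]
        refine hE.unip_eq_of_pow_eq (mul_mem (mul_mem hV hSU) (inv_mem hV)) hSU hn ?_
        rw [conj_pow, hSn, mul_inv_eq_iff_eq_mul]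
        exact (Commute.inv_right (show Commute V (Rm h) from hVR)).eq
      have hφh : φ t h = h := hκ (by rw [hφ, hh]; group)
      have hSC : C t * S = S * C t := hcomm _ (hCU t) (by rw [hCR, hφh])
      have hTn : (C t * S) ^ n = L h := by
        rw [(show Commute (C t) S from hSC).mul_pow, ← map_pow, ← hh, hCκ, hSn,
          mul_inv_cancel_right]
      refine ⟨S, hSU, fun x => (hcomm _ (hLU x) (hLR x h)).symm, hSC, fun x m hx => ?_⟩
      refine hE.unip_eq_of_pow_eq (hLU x) (zpow_mem (mul_mem (hCU t) hSU) m) hn ?_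
      have hxh : x ^ n = h ^ m := hκ (by
        rw [map_pow, map_zpow, hx, hh, ← zpow_natCast, ← zpow_natCast, ← zpow_mul, ← zpow_mul,
          mul_comm])
      rw [← map_pow, hxh, map_zpow, ← hTn, ← zpow_natCast, ← zpow_natCast, ← zpow_mul,
        ← zpow_mul, mul_comm]
    · refine ⟨1, one_mem _, by simp, by simp, fun x m hx => ?_⟩
      have hm : m = 0 := by
        by_contra hm
        rcases Int.natAbs_eq m with h | h
        · exact hex ⟨m.natAbs, x, by omega, by rw [hx, ← zpow_natCast, ← h]⟩
        · refine hex ⟨m.natAbs, x⁻¹, by omega, ?_⟩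
          rw [map_inv, hx, ← zpow_natCast, ← zpow_neg, eq_neg_iff_add_eq_zero.1 h |>
            eq_neg_of_add_eq_zero_right]
      subst hm
      rw [zpow_zero] at hx ⊢
      rw [hκ (hx.trans (map_one κ).symm), map_one]
  obtain ⟨ρ, hρ⟩ := exists_hom_extension t hgen (φ t) (hφ t) L (C t * S)
    (fun x => by
      rw [eq_mul_inv_iff_mul_eq, mul_assoc (C t), hSL, ← mul_assoc (C t), hCL, mul_assoc]) hSt
  have hρκ : ∀ x, ρ (κ x) = L x := fun x => by
    have := hρ x 0
    rwa [zpow_zero, zpow_zero, mul_one, mul_one] at this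
  have hρU : ∀ y, ρ y ∈ U := by
    intro y
    obtain ⟨x, n, rfl⟩ := hgen y
    rw [hρ]
    exact mul_mem (hLU x) (zpow_mem (mul_mem (hCU t) hSU) n)
  let Ψ : MonoidAlgebra ℚ G →ₐ[ℚ] Module.End ℚ (N.Quo k) :=
    MonoidAlgebra.lift ℚ _ G ((Units.coeHom _).comp ρ)
  have hΨ : ∀ y, Ψ (MonoidAlgebra.of ℚ G y) = (ρ y : Module.End ℚ (N.Quo k)) := fun y =>
    MonoidAlgebra.lift_of _ _
  have h1 : Ψ (MonoidAlgebra.mapDomainAlgHom ℚ ℚ κ a) ∈ N.endFil k k := by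
    refine K.map_J_mem ℚ Ψ (N.endFil k) (fun _ _ _ _ hx hy => hE.mul_mem hx hy)
      (fun i => hE.antitone (Nat.le_succ i)) (fun g => ?_) (fun i y hi hy => ?_) ha
    · rw [hΨ]
      have := add_mem (hE.antitone (Nat.zero_le w) (hρU g)) hE.one_mem
      rwa [sub_add_cancel] at this
    · rw [hΨ]
      rcases le_or_gt i w with h | h
      · exact hE.antitone h (hρU y)
      · obtain ⟨x, rfl⟩ := hle (K.antitone h hy)
        rw [hρκ]
        exact N.leftMul_sub_one_mem k hi hy
  have h2 : ∀ b : MonoidAlgebra ℚ H, Ψ (MonoidAlgebra.mapDomainAlgHom ℚ ℚ κ b)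
      (Submodule.Quotient.mk 1) = Submodule.Quotient.mk b := by
    intro b
    induction b using MonoidAlgebra.induction_on with
    | of x =>
      rw [show MonoidAlgebra.mapDomainAlgHom ℚ ℚ κ (MonoidAlgebra.of ℚ H x) =
        MonoidAlgebra.of ℚ G (κ x) by simp, hΨ, hρκ, hL, leftMul_mk, mul_one]
    | add x y hx hy =>
      rw [map_add, map_add, LinearMap.add_apply, hx, hy, Submodule.Quotient.mk_add]
    | smul r x hx =>
      rw [map_smul, map_smul, LinearMap.smul_apply, hx, Submodule.Quotient.mk_smul]
  have h3 := h2 a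
  rw [hE.eq_bot, Submodule.mem_bot] at h1
  rw [h1, LinearMap.zero_apply] at h3
  exact (Submodule.Quotient.mk_eq_zero _).1 h3.symm

end CyclicStep

/-! ### Restriction of the filtration to the terms of the N-series -/

section Restriction

variable {G : Type*} [Group G] (K : ExtendedNSeries G)

theorem mapDomainAlgHom_of {H : Type*} [Group H] (κ : H →* G) (x : H) :
    MonoidAlgebra.mapDomainAlgHom ℚ ℚ κ (MonoidAlgebra.of ℚ H x) =
      MonoidAlgebra.of ℚ G (κ x) := by simp

theorem map_augProd (M : Subgroup G) (l : List (ℕ × M)) :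
    MonoidAlgebra.mapDomainAlgHom ℚ ℚ M.subtype (augProd ℚ l) =
      augProd ℚ (l.map fun p => (p.1, (p.2 : G))) := by
  induction l with
  | nil => exact map_one _
  | cons p l ih =>
    rw [List.map_cons, augProd_cons, augProd_cons, map_mul, ih, map_sub, map_one,
      mapDomainAlgHom_of]
    rfl

/-- The filtration of `ℚ[M]` for the induced N-series, viewed in `ℚ[G]`. -/
theorem map_J_comap (M : Subgroup G) (k : ℕ) :
    ((K.comap M.subtype).J ℚ k).map
      (MonoidAlgebra.mapDomainAlgHom ℚ ℚ M.subtype).toLinearMap = K.wordSpan ℚ M k := by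
  rw [J_eq_wordSpan, wordSpan, wordSpan, Submodule.map_span]
  congr 1
  ext a
  constructor
  · rintro ⟨_, ⟨l, g, h1, -, -, h4, rfl⟩, rfl⟩
    refine ⟨l.map fun p => (p.1, (p.2 : G)), g, ?_, ?_, g.2, ?_, ?_⟩
    · intro p hp
      obtain ⟨q, hq, rfl⟩ := List.mem_map.1 hp
      exact h1 q hq
    · intro p hp
      obtain ⟨q, hq, rfl⟩ := List.mem_map.1 hp
      exact q.2.2
    · simpa [wt, Function.comp_def] using h4
    · rw [← map_augProd, AlgHom.toLinearMap_apply, map_mul, mapDomainAlgHom_of]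
      rfl
  · rintro ⟨l, g, h1, h2, h3, h4, rfl⟩
    obtain ⟨l, rfl⟩ : ∃ l' : List (ℕ × M), l'.map (fun p => (p.1, (p.2 : G))) = l :=
      ⟨l.pmap (fun p hp => (p.1, ⟨p.2, hp⟩)) h2, by simp [List.map_pmap]⟩
    refine ⟨_, ⟨l, ⟨g, h3⟩, fun p hp => ?_, fun _ _ => trivial, trivial, ?_, rfl⟩, ?_⟩
    · exact h1 _ (List.mem_map_of_mem (f := fun p : ℕ × M => (p.1, (p.2 : G))) hp)
    · simpa [wt, Function.comp_def] using h4
    · rw [← map_augProd, AlgHom.toLinearMap_apply, map_mul, mapDomainAlgHom_of]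
      rfl

theorem mem_J_comap_iff (M : Subgroup G) {k : ℕ} {a : MonoidAlgebra ℚ M} :
    a ∈ (K.comap M.subtype).J ℚ k ↔
      MonoidAlgebra.mapDomainAlgHom ℚ ℚ M.subtype a ∈ K.wordSpan ℚ M k := by
  rw [← map_J_comap]
  refine ⟨fun h => ⟨a, h, rfl⟩, ?_⟩
  rintro ⟨b, hb, hab⟩
  have := MonoidAlgebra.mapDomain_injective (R := ℚ) M.subtype_injective hab
  rwa [← this]

/-- The element `x - 1` lies in the `k`-th step of the filtration for the induced N-series of
the subgroup `M ∋ x`. -/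
def SubOneMem (M : Subgroup G) (k : ℕ) (x : G) : Prop :=
  MonoidAlgebra.of ℚ G x - 1 ∈ K.wordSpan ℚ M k

/-- Removing one generator `t ∈ K w` from a subgroup between `K (w + 1)` and `K w`. -/
theorem subOneMem_of_cyclic {w : ℕ} (hw : 1 ≤ w) {M : Subgroup G} (hM : K (w + 1) ≤ M)
    (hMw : M ≤ K w) {t : G} (ht : t ∈ K w) {k : ℕ} {x : G} (hx : x ∈ M)
    (h : K.SubOneMem (M ⊔ Subgroup.zpowers t) k x) : K.SubOneMem M k x := by
  set M' := M ⊔ Subgroup.zpowers t with hM'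
  have hle : M ≤ M' := le_sup_left
  have htM' : Subgroup.zpowers t ≤ M' := le_sup_right
  have htmem : t ∈ M' := htM' (Subgroup.mem_zpowers t)
  have hM'w : M' ≤ K w := sup_le hMw (Subgroup.zpowers_le.2 ht)
  have hsub : ∀ {N : Subgroup G} (hx : x ∈ N), MonoidAlgebra.of ℚ G x - 1 =
      MonoidAlgebra.mapDomainAlgHom ℚ ℚ N.subtype (MonoidAlgebra.of ℚ N ⟨x, hx⟩ - 1) := by
    intro N hx
    rw [map_sub, map_one, mapDomainAlgHom_of]
    rfl
  unfold SubOneMem at h ⊢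
  rw [hsub (hle hx), ← mem_J_comap_iff] at h
  rw [hsub hx, ← mem_J_comap_iff]
  have hnormal : (M.subgroupOf M').Normal := ⟨fun y hy g => by
    rw [Subgroup.mem_subgroupOf] at hy ⊢
    push_cast
    rw [conj_eq_lie_mul]
    exact mul_mem (hM (K.antitone (by omega) (K.lie_mem (hM'w g.2) (hMw hy)))) hy⟩
  have hgen : ∀ y : M', ∃ (x : M) (n : ℤ),
      y = Subgroup.inclusion hle x * (⟨t, htmem⟩ : M') ^ n := by
    intro y
    have hy : y ∈ M.subgroupOf M' ⊔ (Subgroup.zpowers t).subgroupOf M' := by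
      rw [← Subgroup.subgroupOf_sup hle htM', ← hM', Subgroup.subgroupOf_self]; trivial
    obtain ⟨a, ha, b, hb, rfl⟩ := Subgroup.mem_sup_of_normal_left.1 hy
    obtain ⟨n, hn⟩ := Subgroup.mem_zpowers_iff.1 (Subgroup.mem_subgroupOf.1 hb)
    exact ⟨⟨a, ha⟩, n, Subtype.ext (by simp [hn])⟩
  have key := mem_J_of_map_mem_J (K.comap M'.subtype) (Subgroup.inclusion_injective hle) hw
    (by
      rw [eq_top_iff]
      exact fun y _ => hM'w y.2)
    (fun y hy => ⟨⟨y, hM hy⟩, rfl⟩) ⟨t, htmem⟩ hgen (k := k)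
    (a := MonoidAlgebra.of ℚ M ⟨x, hx⟩ - 1)
    (by
      rw [map_sub, map_one, mapDomainAlgHom_of]
      exact h)
  exact key

theorem subOneMem_of_finset {w : ℕ} (hw : 1 ≤ w) {k : ℕ} {x : G} (hx : x ∈ K (w + 1))
    (T : Finset G) (hT : ∀ t ∈ T, t ∈ K w)
    (h : K.SubOneMem (K (w + 1) ⊔ Subgroup.closure T) k x) : K.SubOneMem (K (w + 1)) k x := by
  classical
  induction T using Finset.induction_on with
  | empty => simpa using h
  | insert t T _ ih =>
    refine ih (fun s hs => hT s (Finset.mem_insert_of_mem hs)) ?_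
    refine K.subOneMem_of_cyclic hw le_sup_left
      (sup_le (K.anti w) ((Subgroup.closure_le _).2 fun s hs =>
        hT s (Finset.mem_insert_of_mem hs)))
      (hT t (Finset.mem_insert_self t T)) (Subgroup.mem_sup_left hx) ?_
    rwa [sup_assoc, Subgroup.zpowers_eq_closure, ← Subgroup.closure_union, Set.union_comm,
      ← Set.insert_eq, ← Finset.coe_insert]

theorem wordSpan_mono {M M' : Subgroup G} (h : M ≤ M') (k : ℕ) :
    K.wordSpan ℚ M k ≤ K.wordSpan ℚ M' k := by
  refine Submodule.span_mono ?_
  rintro _ ⟨l, g, h1, h2, h3, h4, rfl⟩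
  exact ⟨l, g, h1, fun p hp => h (h2 p hp), h h3, h4, rfl⟩

/-- An element of the filtration involves finitely many group elements only. -/
theorem exists_finset_of_mem_wordSpan {M N : Subgroup G} {k : ℕ} {a : MonoidAlgebra ℚ G}
    (ha : a ∈ K.wordSpan ℚ M k) :
    ∃ T : Finset G, (∀ t ∈ T, t ∈ M) ∧ a ∈ K.wordSpan ℚ (N ⊔ Subgroup.closure T) k := by
  classical
  induction ha using Submodule.span_induction with
  | zero => exact ⟨∅, by simp, zero_mem _⟩
  | smul r x _ hx =>
    obtain ⟨T, h1, h2⟩ := hx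
    exact ⟨T, h1, Submodule.smul_mem _ _ h2⟩
  | add x y _ _ hx hy =>
    obtain ⟨T, h1, h2⟩ := hx
    obtain ⟨T', h1', h2'⟩ := hy
    refine ⟨T ∪ T', fun t ht => (Finset.mem_union.1 ht).elim (h1 t) (h1' t), add_mem ?_ ?_⟩
    · exact K.wordSpan_mono (sup_le_sup_left (Subgroup.closure_mono (by simp)) N) k h2
    · exact K.wordSpan_mono (sup_le_sup_left (Subgroup.closure_mono (by simp)) N) k h2'
  | mem x hx =>
    obtain ⟨l, g, h1, h2, h3, h4, rfl⟩ := hx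
    refine ⟨insert g (l.map Prod.snd).toFinset, ?_, Submodule.subset_span
      ⟨l, g, h1, fun p hp => ?_, ?_, h4, rfl⟩⟩
    · intro t ht
      rcases Finset.mem_insert.1 ht with rfl | ht
      · exact h3
      · obtain ⟨p, hp, rfl⟩ := List.mem_map.1 (List.mem_toFinset.1 ht)
        exact h2 p hp
    · refine Subgroup.mem_sup_right (Subgroup.subset_closure ?_)
      exact Finset.mem_insert_of_mem (List.mem_toFinset.2 (List.mem_map_of_mem hp))
    · exact Subgroup.mem_sup_right (Subgroup.subset_closure (Finset.mem_insert_self _ _))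

/-- Passage from `K w` to `K (w + 1)`: the generators are removed one at a time. -/
theorem subOneMem_succ {w : ℕ} (hw : 1 ≤ w) {k : ℕ} {x : G} (hx : x ∈ K (w + 1))
    (h : K.SubOneMem (K w) k x) : K.SubOneMem (K (w + 1)) k x := by
  obtain ⟨T, h1, h2⟩ := K.exists_finset_of_mem_wordSpan (N := K (w + 1)) h
  exact K.subOneMem_of_finset hw hx T h1 h2

/-- The linear extension to the group ring of a function on the group. -/
noncomputable def linLift {V : Type*} [AddCommGroup V] [Module ℚ V] (f : G → V) :
    MonoidAlgebra ℚ G →ₗ[ℚ] V :=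
  Finsupp.linearCombination ℚ f ∘ₗ (MonoidAlgebra.coeffLinearEquiv ℚ).toLinearMap

@[simp] theorem linLift_of {V : Type*} [AddCommGroup V] [Module ℚ V] (f : G → V) (g : G) :
    linLift f (MonoidAlgebra.of ℚ G g) = f g := by
  change Finsupp.linearCombination ℚ f (Finsupp.single g 1) = f g
  simp

theorem linearMap_ext_of {V : Type*} [AddCommGroup V] [Module ℚ V]
    {f f' : MonoidAlgebra ℚ G →ₗ[ℚ] V}
    (h : ∀ g, f (MonoidAlgebra.of ℚ G g) = f' (MonoidAlgebra.of ℚ G g)) : f = f' := by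
  refine LinearMap.ext fun a => ?_
  induction a using MonoidAlgebra.induction_on with
  | of x => exact h x
  | add x y hx hy => rw [map_add, map_add, hx, hy]
  | smul r x hx => rw [map_smul, map_smul, hx]

/-- Passage from `K 0` to `K 1`: the projection of `ℚ[K 0]` onto `ℚ[K 1]` along the other cosets
preserves the filtration. -/
theorem subOneMem_one {k : ℕ} {x : G} (hx : x ∈ K 1) (h : K.SubOneMem ⊤ k x) :
    K.SubOneMem (K 1) k x := by
  classical
  let π : MonoidAlgebra ℚ G →ₗ[ℚ] MonoidAlgebra ℚ G :=
    linLift fun g => if g ∈ K 1 then MonoidAlgebra.of ℚ G g else 0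
  have hπ : ∀ g, π (MonoidAlgebra.of ℚ G g) = if g ∈ K 1 then MonoidAlgebra.of ℚ G g else 0 :=
    fun g => linLift_of _ g
  have hπmul : ∀ y ∈ K 1, ∀ b, π (MonoidAlgebra.of ℚ G y * b) = MonoidAlgebra.of ℚ G y * π b := by
    intro y hy b
    have : π ∘ₗ LinearMap.mulLeft ℚ (MonoidAlgebra.of ℚ G y) =
        LinearMap.mulLeft ℚ (MonoidAlgebra.of ℚ G y) ∘ₗ π := by
      refine linearMap_ext_of fun g => ?_
      simp only [LinearMap.comp_apply, LinearMap.mulLeft_apply]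
      rw [← map_mul, hπ, hπ, Subgroup.mul_mem_cancel_left _ hy, mul_ite, mul_zero, ← map_mul]
    exact LinearMap.congr_fun this b
  have hπJ : K.wordSpan ℚ ⊤ k ≤ (K.wordSpan ℚ (K 1) k).comap π := by
    refine Submodule.span_le.2 ?_
    rintro _ ⟨l, g, h1, -, -, h4, rfl⟩
    have e : π (augProd ℚ l * MonoidAlgebra.of ℚ G g) =
        augProd ℚ l * π (MonoidAlgebra.of ℚ G g) := by
      clear h4
      induction l with
      | nil => simp only [augProd_nil, one_mul]
      | cons p l ih =>
        obtain ⟨⟨h2, h3⟩, h4⟩ := K.isWord_cons.1 h1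
        rw [augProd_cons, mul_assoc, sub_mul, one_mul, map_sub, hπmul _ (K.antitone h2 h3), ih h4,
          mul_assoc, sub_mul, one_mul]
    rw [SetLike.mem_coe, Submodule.mem_comap, e, hπ]
    split_ifs with hg
    · exact Submodule.subset_span ⟨l, g, h1, fun p hp => K.antitone (h1 p hp).1 (h1 p hp).2,
        hg, h4, rfl⟩
    · rw [mul_zero]; exact zero_mem _
  have := hπJ h
  rwa [Submodule.mem_comap, map_sub, ← map_one (MonoidAlgebra.of ℚ G), hπ, hπ, if_pos hx,
    if_pos (one_mem _), map_one] at this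

theorem subOneMem_of_mem_J {k m : ℕ} (hm : 1 ≤ m) {x : G} (hx : x ∈ K m)
    (h : MonoidAlgebra.of ℚ G x - 1 ∈ K.J ℚ k) : K.SubOneMem (K m) k x := by
  induction m, hm using Nat.le_induction with
  | base =>
    refine K.subOneMem_one hx ?_
    rwa [SubOneMem, ← J_eq_wordSpan]
  | succ w hw ih => exact K.subOneMem_succ hw hx (ih (K.anti w hx))

/-- If `x ∈ K m` and `x - 1 ∈ J (m + 1)`, then the class of `x` is killed by all homomorphisms
`K m / K (m + 1) → ℚ`: by restriction one may replace `K 0` by `K m`, and there each such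
homomorphism is visible in a representation over the dual numbers. -/
theorem hom_cls_eq_zero_of_mem_J {m : ℕ+} {x : G} (hx : x ∈ K m)
    (h : MonoidAlgebra.of ℚ G x - 1 ∈ K.J ℚ (m + 1)) (φ : K.gr m →+ ℚ) :
    φ (K.cls m x hx) = 0 := by
  have h1 := K.subOneMem_of_mem_J m.pos hx h
  have e : MonoidAlgebra.of ℚ G x - 1 =
      MonoidAlgebra.mapDomainAlgHom ℚ ℚ (K m).subtype (MonoidAlgebra.of ℚ (K m) ⟨x, hx⟩ - 1) := by
    rw [map_sub, map_one, mapDomainAlgHom_of]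
    rfl
  rw [SubOneMem, e, ← mem_J_comap_iff] at h1
  -- the representation `y ↦ 1 + φ(y) ε` of `K m` over the dual numbers
  let ρ : K m →* DualNumber ℚ :=
    { toFun y := 1 + TrivSqZeroExt.inr (φ (K.cls m y y.2))
      map_one' := by
        rw [show K.cls m ((1 : K m) : G) (1 : K m).2 = 0 from
          (K.cls_eq_zero_iff _).2 (one_mem _)]
        simp
      map_mul' y z := by
        rw [show K.cls m ((y * z : K m) : G) (y * z).2 = _ from K.cls_mul y.2 z.2, map_add]
        ext <;> simp [add_comm] }
  let E : ℕ → Submodule ℚ (DualNumber ℚ) := fun i =>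
    if i = 0 then ⊤ else if i ≤ m then LinearMap.ker (TrivSqZeroExt.fstHom ℚ ℚ ℚ).toLinearMap
    else ⊥
  have key := (K.comap (K m).subtype).map_J_mem ℚ (MonoidAlgebra.lift ℚ _ _ ρ) E ?_ ?_ ?_ ?_ h1
  · have h0 : ¬ ((m : ℕ) + 1 ≤ m) := by omega
    simp only [E, if_neg h0, Nat.add_eq_zero_iff, one_ne_zero, and_false, if_false,
      Submodule.mem_bot] at key
    rw [map_sub, MonoidAlgebra.lift_of, map_one] at key
    have := congrArg TrivSqZeroExt.snd key
    simpa [ρ] using this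
  · intro i j a b ha hb
    rcases eq_or_ne i 0 with rfl | hi
    · rw [zero_add]
      simp only [E] at hb ⊢
      split_ifs at hb ⊢ with h2 h3
      · trivial
      · have : b.fst = 0 := hb
        change (a * b).fst = 0
        simp [this]
      · rw [Submodule.mem_bot] at hb ⊢
        rw [hb, mul_zero]
    rcases eq_or_ne j 0 with rfl | hj
    · rw [add_zero]
      simp only [E] at ha ⊢
      split_ifs at ha ⊢ with h2 h3
      · trivial
      · have : a.fst = 0 := ha
        change (a * b).fst = 0
        simp [this]
      · rw [Submodule.mem_bot] at ha ⊢
        rw [ha, zero_mul]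
    · have hker : ∀ {i : ℕ} {a : DualNumber ℚ}, i ≠ 0 → a ∈ E i → a.fst = 0 := by
        intro i a hi ha
        simp only [E, if_neg hi] at ha
        split_ifs at ha
        · exact ha
        · rw [Submodule.mem_bot] at ha
          rw [ha]; rfl
      have : a * b = 0 := by
        ext <;> simp [hker hi ha, hker hj hb]
      rw [this]
      exact zero_mem _
  · intro i
    simp only [E]
    split_ifs <;> first | exact le_top | exact le_rfl | exact bot_le | (exfalso; omega)
  · intro g
    simp [E]
  · intro i y hi hy
    rw [MonoidAlgebra.lift_of]
    simp only [E, if_neg (show i ≠ 0 by omega)]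
    split_ifs with h2
    · change (1 + TrivSqZeroExt.inr _ - 1 : DualNumber ℚ).fst = 0
      simp
    · have h3 : (y : G) ∈ K (m + 1) := K.antitone (by omega) hy
      change (1 + TrivSqZeroExt.inr (φ (K.cls m y y.2)) - 1 : DualNumber ℚ) ∈ _
      rw [(K.cls_eq_zero_iff y.2).2 h3]
      simp

end Restriction

end ExtendedNSeries

namespace ExtendedNSeries

/-! ### Polynomial functions on the group -/

section Poly

variable {G : Type*} [Group G] (K : ExtendedNSeries G)

/-- The difference operator `f ↦ (g ↦ f (x g) - f g)`. -/
def diff (x : G) : (G → ℚ) →ₗ[ℚ] (G → ℚ) where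
  toFun f g := f (x * g) - f g
  map_add' f f' := by ext g; simp only [Pi.add_apply]; ring
  map_smul' q f := by ext g; simp only [Pi.smul_apply, smul_eq_mul, RingHom.id_apply]; ring

theorem diff_apply (x : G) (f : G → ℚ) (g : G) : diff x f g = f (x * g) - f g := rfl

theorem diff_mul (x : G) (f f' : G → ℚ) :
    diff x (f * f') = diff x f * f' + f * diff x f' + diff x f * diff x f' := by
  ext g; simp only [diff_apply, Pi.mul_apply, Pi.add_apply]; ring

/-- The iterated difference operator of a weighted word; the first letter acts first. -/
def diffWord : List (ℕ × G) → (G → ℚ) →ₗ[ℚ] (G → ℚ)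
  | [] => LinearMap.id
  | p :: l => diffWord l ∘ₗ diff p.2

@[simp] theorem diffWord_nil (f : G → ℚ) : diffWord [] f = f := rfl

@[simp] theorem diffWord_cons (p : ℕ × G) (l : List (ℕ × G)) (f : G → ℚ) :
    diffWord (p :: l) f = diffWord l (diff p.2 f) := rfl

/-- The functions killed by the iterated differences of weight at least `k`, and by those of
weight at least `k - 1` with fewer than `p` letters. The first condition says that the function
is polynomial of weighted degree less than `k`; the second one says that, up to terms of degree
less than `k - 1`, it is a combination of products of at least `p` factors. -/
def polyFil (k p : ℕ) : Submodule ℚ (G → ℚ) where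
  carrier := {f | ∀ l, K.IsWord l → (k ≤ wt l ∨ (k ≤ wt l + 1 ∧ l.length < p)) →
    diffWord l f = 0}
  zero_mem' := fun _ _ _ => map_zero _
  add_mem' := fun ha hb l hl h => by rw [map_add, ha l hl h, hb l hl h, add_zero]
  smul_mem' := fun q f hf l hl h => by rw [map_smul, hf l hl h, smul_zero]

variable {K}

theorem polyFil_mono {k k' p p' : ℕ} (hk : k ≤ k') (hp : p' ≤ p) :
    K.polyFil k p ≤ K.polyFil k' p' :=
  fun _ hf l hl h => hf l hl (by omega)

theorem polyFil_le_of_lt {k k' p p' : ℕ} (hk : k < k') : K.polyFil k p ≤ K.polyFil k' p' :=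
  fun _ hf l hl h => hf l hl (by omega)

theorem diff_mem_polyFil {k p n : ℕ} {f : G → ℚ} (hf : f ∈ K.polyFil k p) (hn : 1 ≤ n) {x : G}
    (hx : x ∈ K n) : diff x f ∈ K.polyFil (k - n) (p - 1) := by
  intro l hl h
  refine hf ((n, x) :: l) (K.isWord_cons.2 ⟨⟨hn, hx⟩, hl⟩) ?_
  simp only [wt_cons, List.length_cons]
  omega

theorem diff_eq_zero {k p n : ℕ} {f : G → ℚ} (hf : f ∈ K.polyFil k p) (hn : 1 ≤ n) (hk : k ≤ n)
    {x : G} (hx : x ∈ K n) : diff x f = 0 :=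
  hf [(n, x)] (K.isWord_cons.2 ⟨⟨hn, hx⟩, K.isWord_nil⟩) (by simp [hk])

/-- Multiplicativity, from the product rule `diff_mul` by induction on the word. -/
theorem mul_mem_polyFil {a b p q : ℕ} {f f' : G → ℚ} (hf : f ∈ K.polyFil (a + 1) p)
    (hf' : f' ∈ K.polyFil (b + 1) q) : f * f' ∈ K.polyFil (a + b + 1) (p + q) := by
  intro l hl h
  induction l generalizing a b p q f f' with
  | nil =>
    simp only [wt_nil, List.length_nil] at h
    rcases Nat.eq_zero_or_pos p with hp | hp
    · have := hf' [] K.isWord_nil (by simp; omega)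
      rw [diffWord_nil] at this
      rw [this, mul_zero, map_zero]
    · have := hf [] K.isWord_nil (by simp; omega)
      rw [diffWord_nil] at this
      rw [this, zero_mul, map_zero]
  | cons r l ih =>
    obtain ⟨n, x⟩ := r
    obtain ⟨⟨hn, hx⟩, hl'⟩ := K.isWord_cons.1 hl
    simp only [wt_cons, List.length_cons] at h
    have hd : ∀ {c r : ℕ} {u : G → ℚ}, u ∈ K.polyFil (c + 1) r → n ≤ c →
        diff x u ∈ K.polyFil (c - n + 1) (r - 1) := fun hu hc => by
      have := diff_mem_polyFil hu hn hx
      rwa [Nat.sub_add_comm hc] at this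
    have h0 : ∀ {c r : ℕ} {u : G → ℚ}, u ∈ K.polyFil (c + 1) r → ¬ n ≤ c → diff x u = 0 :=
      fun hu hc => diff_eq_zero hu hn (by omega) hx
    have h1 : diffWord l (diff x f * f') = 0 := by
      by_cases hna : n ≤ a
      · exact ih (hd hf hna) hf' hl' (by omega)
      · rw [h0 hf hna, zero_mul, map_zero]
    have h2 : diffWord l (f * diff x f') = 0 := by
      by_cases hnb : n ≤ b
      · exact ih hf (hd hf' hnb) hl' (by omega)
      · rw [h0 hf' hnb, mul_zero, map_zero]
    have h3 : diffWord l (diff x f * diff x f') = 0 := by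
      by_cases hna : n ≤ a
      · by_cases hnb : n ≤ b
        · exact ih (hd hf hna) (hd hf' hnb) hl' (by omega)
        · rw [h0 hf' hnb, mul_zero, map_zero]
      · rw [h0 hf hna, zero_mul, map_zero]
    rw [diffWord_cons, diff_mul, map_add, map_add, h1, h2, h3, add_zero, add_zero]

/-- Functions that are constant on the cosets of `K 1` are scalars for the difference operators. -/
theorem diffWord_mul_of_invariant {u : G → ℚ} (hu : ∀ x ∈ K 1, ∀ g, u (x * g) = u g)
    {l : List (ℕ × G)} (hl : K.IsWord l) (f : G → ℚ) :
    diffWord l (u * f) = u * diffWord l f := by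
  induction l generalizing f with
  | nil => rfl
  | cons p l ih =>
    obtain ⟨⟨hn, hx⟩, hl'⟩ := K.isWord_cons.1 hl
    rw [diffWord_cons, diffWord_cons, ← ih hl']
    congr 1
    ext g
    simp only [diff_apply, Pi.mul_apply]
    rw [hu _ (K.antitone hn hx)]
    ring

theorem one_mem_polyFil : (1 : G → ℚ) ∈ K.polyFil 1 0 := by
  intro l _ h
  cases l with
  | nil => simp at h
  | cons p l =>
    have : diff p.2 (1 : G → ℚ) = 0 := by ext; simp [diff_apply]
    rw [diffWord_cons, this, map_zero]

theorem linLift_augProd_mul (f : G → ℚ) (l : List (ℕ × G)) (g : G) :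
    linLift f (augProd ℚ l * MonoidAlgebra.of ℚ G g) = diffWord l f g := by
  induction l generalizing f with
  | nil => simp only [augProd_nil, one_mul, linLift_of, diffWord_nil]
  | cons p l ih =>
    rw [diffWord_cons, ← ih, augProd_cons, mul_assoc]
    have : linLift f ∘ₗ LinearMap.mulLeft ℚ (MonoidAlgebra.of ℚ G p.2 - 1) =
        linLift (diff p.2 f) := by
      refine linearMap_ext_of fun g => ?_
      rw [LinearMap.comp_apply, LinearMap.mulLeft_apply, sub_mul, one_mul, map_sub, ← map_mul,
        linLift_of, linLift_of, linLift_of, diff_apply]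
    exact LinearMap.congr_fun this _

theorem linLift_eq_zero {k : ℕ} {f : G → ℚ} (hf : f ∈ K.polyFil k 0) {a : MonoidAlgebra ℚ G}
    (ha : a ∈ K.J ℚ k) : linLift f a = 0 := by
  rw [J_eq_wordSpan] at ha
  have : K.wordSpan ℚ ⊤ k ≤ LinearMap.ker (linLift f) := by
    refine Submodule.span_le.2 ?_
    rintro _ ⟨l, g, h1, -, -, h4, rfl⟩
    change linLift f _ = 0
    rw [linLift_augProd_mul, hf l h1 (Or.inl h4)]
    rfl
  exact this ha

/-- The functionals on `ℚ[G] / J k` are polynomial functions of weighted degree less than `k`. -/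
theorem mem_polyFil_of_functional {k : ℕ} (ψ : MonoidAlgebra ℚ G →ₗ[ℚ] ℚ)
    (hψ : ∀ a ∈ K.J ℚ k, ψ a = 0) : (fun g => ψ (MonoidAlgebra.of ℚ G g)) ∈ K.polyFil k 0 := by
  intro l hl h
  have hk : k ≤ wt l := by omega
  have e : linLift (fun g => ψ (MonoidAlgebra.of ℚ G g)) = ψ :=
    linearMap_ext_of fun g => linLift_of _ g
  ext g
  rw [← linLift_augProd_mul, e]
  exact hψ _ (K.mul_of_mem_J ℚ (K.J_antitone ℚ hk (K.augProd_mem_J ℚ hl)) _)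

end Poly

/-! ### Pairing of monomials -/

section Pairing

variable {G : Type*} [Group G]

/-- A family of elements `x i ∈ K (m i)`, together with polynomial functions `lam i` of weighted
degree at most `m i` which are dual to the `x i` in each degree. -/
structure DualFamily (K : ExtendedNSeries G) (ι : Type*) where
  m : ι → ℕ
  one_le : ∀ i, 1 ≤ m i
  x : ι → G
  mem : ∀ i, x i ∈ K (m i)
  lam : ι → G → ℚ
  lam_mem : ∀ i, lam i ∈ K.polyFil (m i + 1) 0
  diff_self : ∀ i, diff (x i) (lam i) = 1
  diff_ne : ∀ i j, m i = m j → i ≠ j → diff (x j) (lam i) = 0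

namespace DualFamily

variable {K : ExtendedNSeries G} {ι : Type*} (D : DualFamily K ι)

/-- The weight of a multiset of indices. -/
def mwt (s : Multiset ι) : ℕ := (s.map D.m).sum

/-- The product of the polynomial functions attached to a multiset of indices. -/
def mono (s : Multiset ι) : G → ℚ := (s.map D.lam).prod

/-- The weighted word attached to a list of indices. -/
def word (l : List ι) : List (ℕ × G) := l.map fun i => (D.m i, D.x i)

theorem isWord_word (l : List ι) : K.IsWord (D.word l) := by
  intro p hp
  obtain ⟨i, -, rfl⟩ := List.mem_map.1 hp
  exact ⟨D.one_le i, D.mem i⟩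

@[simp] theorem word_cons (i : ι) (l : List ι) :
    D.word (i :: l) = (D.m i, D.x i) :: D.word l := rfl

@[simp] theorem length_word (l : List ι) : (D.word l).length = l.length := List.length_map _

theorem wt_word (l : List ι) : wt (D.word l) = D.mwt l := by
  simp [wt, word, mwt, Function.comp_def]

@[simp] theorem mwt_cons (i : ι) (s : Multiset ι) : D.mwt (i ::ₘ s) = D.m i + D.mwt s := by
  simp [mwt]

@[simp] theorem mono_cons (i : ι) (s : Multiset ι) : D.mono (i ::ₘ s) = D.lam i * D.mono s := by
  simp [mono]

theorem le_mwt {i : ι} {s : Multiset ι} (h : i ∈ s) : D.m i ≤ D.mwt s :=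
  Multiset.single_le_sum (fun _ _ => Nat.zero_le _) _ (Multiset.mem_map_of_mem _ h)

theorem lam_mem_one (i : ι) : D.lam i ∈ K.polyFil (D.m i + 1) 1 := by
  intro l hl h
  refine D.lam_mem i l hl (Or.inl ?_)
  have := D.one_le i
  rcases h with h | ⟨h, h'⟩
  · exact h
  · rw [Nat.lt_one_iff, List.length_eq_zero_iff] at h'
    subst h'
    simp at h; omega

theorem mono_mem (s : Multiset ι) : D.mono s ∈ K.polyFil (D.mwt s + 1) (Multiset.card s) := by
  induction s using Multiset.induction_on with
  | empty => simpa [mono, mwt] using one_mem_polyFil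
  | cons i s ih =>
    rw [mono_cons, mwt_cons, Multiset.card_cons, add_comm (Multiset.card s)]
    exact mul_mem_polyFil (D.lam_mem_one i) ih

/-- To leading order, the difference operators act on monomials as derivations. -/
theorem diff_mono [DecidableEq ι] (j : ι) (s : Multiset ι) (hj : D.m j ≤ D.mwt s) :
    diff (D.x j) (D.mono s) - (s.count j) • D.mono (s.erase j) ∈
      K.polyFil (D.mwt s - D.m j + 1) (Multiset.card s) := by
  induction s using Multiset.induction_on with
  | empty =>
    have := D.one_le j
    simp [mwt] at hj; omega
  | cons i s ih =>
    have hj1 := D.one_le j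
    set n := D.m j with hn
    have hlam := D.lam_mem i
    have hF := D.mono_mem s
    have hF0 := polyFil_mono le_rfl (Nat.zero_le _) hF
    have hDlam : n ≤ D.m i → diff (D.x j) (D.lam i) ∈ K.polyFil (D.m i - n + 1) 0 := fun h => by
      have := diff_mem_polyFil hlam hj1 (D.mem j)
      rwa [Nat.sub_add_comm h] at this
    have hDF : n ≤ D.mwt s → diff (D.x j) (D.mono s) ∈ K.polyFil (D.mwt s - n + 1) 0 := fun h => by
      have := diff_mem_polyFil hF0 hj1 (D.mem j)
      rwa [Nat.sub_add_comm h] at this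
    have hDlam0 : ¬ n ≤ D.m i → diff (D.x j) (D.lam i) = 0 := fun h =>
      diff_eq_zero hlam hj1 (by omega) (D.mem j)
    have hDF0 : ¬ n ≤ D.mwt s → diff (D.x j) (D.mono s) = 0 := fun h =>
      diff_eq_zero hF hj1 (by omega) (D.mem j)
    rw [mwt_cons] at hj ⊢
    rw [Multiset.card_cons]
    have hA : D.lam i * diff (D.x j) (D.mono s) - s.count j • (D.lam i * D.mono (s.erase j)) ∈
        K.polyFil (D.m i + D.mwt s - n + 1) (Multiset.card s + 1) := by
      by_cases h : n ≤ D.mwt s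
      · have := mul_mem_polyFil (D.lam_mem_one i) (ih h)
        rw [mul_sub, mul_smul_comm] at this
        exact polyFil_mono (by omega) (by omega) this
      · have hc : s.count j = 0 := Multiset.count_eq_zero.2 fun hjs => h (D.le_mwt hjs)
        rw [hDF0 h, hc, mul_zero, zero_smul, sub_zero]
        exact zero_mem _
    have hB : diff (D.x j) (D.lam i) * D.mono s - (if j = i then 1 else 0 : ℕ) • D.mono s ∈
        K.polyFil (D.m i + D.mwt s - n + 1) (Multiset.card s + 1) := by
      rcases lt_trichotomy n (D.m i) with h | h | h
      · have hij : j ≠ i := fun hij => by rw [← hij] at h; exact lt_irrefl _ h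
        have h1 : diff (D.x j) (D.lam i) ∈ K.polyFil (D.m i - n + 1) 1 := by
          intro l hl h'
          refine hDlam h.le l hl (Or.inl ?_)
          rcases h' with h' | ⟨h', h''⟩
          · exact h'
          · rw [Nat.lt_one_iff, List.length_eq_zero_iff] at h''
            subst h''
            simp at h'; omega
        rw [if_neg hij, zero_smul, sub_zero]
        exact polyFil_mono (by omega) (by omega) (mul_mem_polyFil h1 hF)
      · by_cases hij : j = i
        · subst hij
          rw [if_pos rfl, D.diff_self, one_mul, one_smul, sub_self]
          exact zero_mem _
        · rw [if_neg hij, D.diff_ne i j (by rw [← h]) (Ne.symm hij), zero_mul, zero_smul, sub_self]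
          exact zero_mem _
      · have hij : j ≠ i := fun hij => by rw [← hij] at h; exact lt_irrefl _ h
        rw [if_neg hij, hDlam0 (by omega), zero_mul, zero_smul, sub_self]
        exact zero_mem _
    have hC : diff (D.x j) (D.lam i) * diff (D.x j) (D.mono s) ∈
        K.polyFil (D.m i + D.mwt s - n + 1) (Multiset.card s + 1) := by
      by_cases h : n ≤ D.m i
      · by_cases h' : n ≤ D.mwt s
        · exact polyFil_le_of_lt (by omega) (mul_mem_polyFil (hDlam h) (hDF h'))
        · rw [hDF0 h', mul_zero]; exact zero_mem _
      · rw [hDlam0 h, zero_mul]; exact zero_mem _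
    have e : (i ::ₘ s).count j • D.mono ((i ::ₘ s).erase j) =
        s.count j • (D.lam i * D.mono (s.erase j)) +
          (if j = i then 1 else 0 : ℕ) • D.mono s := by
      rw [Multiset.count_cons, add_smul]
      by_cases hij : j = i
      · subst hij
        rw [Multiset.erase_cons_head]
        congr 1
        by_cases hjs : j ∈ s
        · rw [← mono_cons, Multiset.cons_erase hjs]
        · rw [Multiset.count_eq_zero.2 hjs, zero_smul, zero_smul]
      · rw [if_neg hij, zero_smul, zero_smul, Multiset.erase_cons_tail _ (Ne.symm hij), mono_cons]
    rw [e, mono_cons, diff_mul]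
    have := add_mem (add_mem hA hB) hC
    convert this using 1
    abel

/-- A monomial is killed by shorter words of the same weight. -/
theorem diffWord_mono_of_lt {l : List ι} {s : Multiset ι} (hw : D.mwt l = D.mwt s)
    (hl : l.length < Multiset.card s) : diffWord (D.word l) (D.mono s) = 0 :=
  D.mono_mem s _ (D.isWord_word l) (Or.inr ⟨by rw [wt_word, hw], by simpa using hl⟩)

/-- Monomials of the same weight and the same length are orthogonal, and each pairs with itself
to a non-zero constant, the product of the factorials of the multiplicities. -/
theorem diffWord_mono {l : List ι} {s : Multiset ι} (hw : D.mwt l = D.mwt s)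
    (hl : l.length = Multiset.card s) :
    ((l : Multiset ι) ≠ s → diffWord (D.word l) (D.mono s) = 0) ∧
      ((l : Multiset ι) = s → ∃ c : ℚ, c ≠ 0 ∧ diffWord (D.word l) (D.mono s) = c • 1) := by
  classical
  induction l generalizing s with
  | nil =>
    have hs : s = 0 := by
      rw [← Multiset.card_eq_zero, ← hl]; rfl
    subst hs
    exact ⟨fun h => absurd rfl h, fun _ => ⟨1, one_ne_zero, by simp [mono, word]⟩⟩
  | cons j l ih =>
    rw [← Multiset.cons_coe, mwt_cons] at hw
    rw [List.length_cons] at hl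
    have hE := D.diff_mono j s (by omega) (D.word l) (D.isWord_word l)
      (Or.inr ⟨by rw [wt_word]; omega, by rw [length_word]; omega⟩)
    rw [map_sub, map_nsmul, sub_eq_zero] at hE
    rw [word_cons, diffWord_cons, hE, ← Multiset.cons_coe]
    by_cases hj : j ∈ s
    · have hs : j ::ₘ s.erase j = s := Multiset.cons_erase hj
      have hw' : D.mwt l = D.mwt (s.erase j) := by
        rw [← hs, mwt_cons] at hw; omega
      have hl' : l.length = Multiset.card (s.erase j) := by
        rw [← hs, Multiset.card_cons] at hl; omega
      obtain ⟨h1, h2⟩ := ih hw' hl'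
      have hiff : (j ::ₘ (l : Multiset ι)) = s ↔ (l : Multiset ι) = s.erase j := by
        conv_lhs => rw [← hs]
        exact Multiset.cons_inj_right j
      refine ⟨fun h => by rw [h1 (mt hiff.2 h), smul_zero], fun h => ?_⟩
      obtain ⟨c, hc, hc'⟩ := h2 (hiff.1 h)
      refine ⟨s.count j * c, mul_ne_zero (Nat.cast_ne_zero.2 (Multiset.count_ne_zero.2 hj)) hc, ?_⟩
      rw [hc', ← Nat.cast_smul_eq_nsmul ℚ, smul_smul]
    · rw [Multiset.count_eq_zero.2 hj, zero_smul]
      exact ⟨fun _ => rfl, fun h => absurd (h ▸ Multiset.mem_cons_self j _) hj⟩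

end DualFamily

end Pairing

end ExtendedNSeries

namespace ExtendedNSeries

/-! ### Existence of a dual family -/

section DualBasis

variable {G : Type u} [Group G] (K : ExtendedNSeries G)

/-- A common denominator makes every element of `ℚ ⊗ A` a pure tensor. -/
theorem exists_rat_tmul {A : Type*} [AddCommGroup A] (z : ℚ ⊗[ℤ] A) :
    ∃ (q : ℚ) (a : A), z = q ⊗ₜ[ℤ] a := by
  have key : ∀ z : ℚ ⊗[ℤ] A, ∃ (n : ℕ) (a : A), n ≠ 0 ∧ (n : ℚ) • z = 1 ⊗ₜ[ℤ] a := by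
    intro z
    induction z using TensorProduct.induction_on with
    | zero => exact ⟨1, 0, one_ne_zero, by simp⟩
    | tmul q a =>
      refine ⟨q.den, q.num • a, q.den_ne_zero, ?_⟩
      rw [TensorProduct.smul_tmul', smul_eq_mul, Rat.den_mul_eq_num, TensorProduct.tmul_smul,
        TensorProduct.smul_tmul', zsmul_eq_mul, mul_one]
    | add x y hx hy =>
      obtain ⟨n, a, hn, hna⟩ := hx
      obtain ⟨n', a', hn', hna'⟩ := hy
      refine ⟨n * n', n' • a + n • a', mul_ne_zero hn hn', ?_⟩
      rw [TensorProduct.tmul_add, TensorProduct.tmul_smul, TensorProduct.tmul_smul, ← hna, ← hna',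
        Nat.cast_mul, smul_add, mul_comm, mul_smul, mul_comm, mul_smul]
      simp only [Nat.cast_smul_eq_nsmul]
  obtain ⟨n, a, hn, hna⟩ := key z
  refine ⟨(n : ℚ)⁻¹, a, ?_⟩
  rw [← mul_one ((n : ℚ)⁻¹), ← smul_eq_mul, ← TensorProduct.smul_tmul', ← hna, smul_smul,
    inv_mul_cancel₀ (Nat.cast_ne_zero.2 hn), one_smul]

/-- The map `ℚ ⊗ (K m / K (m + 1)) → ℚ[G] / J (m + 1)`, `q ⊗ x ↦ q (x - 1)`. -/
noncomputable def augMap (m : ℕ+) : ℚ ⊗[ℤ] K.gr m →ₗ[ℚ] MonoidAlgebra ℚ G ⧸ K.J ℚ (m + 1) :=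
  (K.liftGr m (fun x _ => (K.J ℚ (m + 1)).mkQ (MonoidAlgebra.of ℚ G x - 1))
    (fun x hx y hy => by
      rw [← map_add, ← sub_eq_zero, ← map_sub]
      have e : MonoidAlgebra.of ℚ G (x * y) - 1 -
          (MonoidAlgebra.of ℚ G x - 1 + (MonoidAlgebra.of ℚ G y - 1)) =
          (MonoidAlgebra.of ℚ G x - 1) * (MonoidAlgebra.of ℚ G y - 1) := by
        rw [map_mul]; noncomm_ring
      rw [e, Submodule.mkQ_apply, Submodule.Quotient.mk_eq_zero]
      exact K.J_antitone ℚ (by have := m.pos; omega)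
        ((K.groupRingFiltration ℚ).mul_mem (K.of_sub_one_mem_J ℚ hx) (K.of_sub_one_mem_J ℚ hy)))
    (fun x _ hx' => (Submodule.Quotient.mk_eq_zero _).2
      (K.of_sub_one_mem_J ℚ (m := m + 1) hx'))).toIntLinearMap.liftBaseChange ℚ

theorem augMap_tmul_cls (m : ℕ+) (q : ℚ) {x : G} (hx : x ∈ K m) :
    K.augMap m (q ⊗ₜ[ℤ] K.cls m x hx) =
      q • (K.J ℚ (m + 1)).mkQ (MonoidAlgebra.of ℚ G x - 1) :=
  LinearMap.liftBaseChange_tmul _ _ _ _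

theorem ker_augMap (m : ℕ+) : LinearMap.ker (K.augMap m) = ⊥ := by
  rw [eq_bot_iff]
  intro z hz
  obtain ⟨q, a, rfl⟩ := exists_rat_tmul z
  obtain ⟨x, hx, rfl⟩ := K.exists_cls a
  rw [LinearMap.mem_ker, augMap_tmul_cls, smul_eq_zero] at hz
  rw [Submodule.mem_bot]
  rcases hz with rfl | hz
  · exact TensorProduct.zero_tmul _ _
  · rw [Submodule.mkQ_apply, Submodule.Quotient.mk_eq_zero] at hz
    refine (Module.forall_dual_apply_eq_zero_iff ℚ _).1 fun ψ => ?_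
    let φ : K.gr m →+ ℚ :=
      { toFun a := ψ (q ⊗ₜ[ℤ] a)
        map_zero' := by rw [TensorProduct.tmul_zero, map_zero]
        map_add' a b := by rw [TensorProduct.tmul_add, map_add] }
    exact K.hom_cls_eq_zero_of_mem_J hx hz φ

/-- A maximal set of elements of `K m / K (m + 1)` that is linearly independent over `ℚ`, viewed
in `ℚ ⊗ (K m / K (m + 1))`. -/
theorem exists_basisSet (m : ℕ+) : ∃ b : Set (ℚ ⊗[ℤ] K.gr m),
    (∀ z ∈ b, ∃ x, ∃ hx : x ∈ K m, z = 1 ⊗ₜ[ℤ] K.cls m x hx) ∧ Submodule.span ℚ b = ⊤ ∧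
    LinearIndependent ℚ (Subtype.val : b → ℚ ⊗[ℤ] K.gr m) := by
  obtain ⟨b, hb, hspan, hli⟩ := exists_linearIndependent ℚ
    (Set.range fun a : K.gr m => (1 : ℚ) ⊗ₜ[ℤ] a)
  refine ⟨b, fun z hz => ?_, ?_, hli⟩
  · obtain ⟨a, rfl⟩ := hb hz
    obtain ⟨x, hx, rfl⟩ := K.exists_cls a
    exact ⟨x, hx, rfl⟩
  · rw [hspan, eq_top_iff]
    intro z _
    obtain ⟨q, a, rfl⟩ := exists_rat_tmul z
    rw [← mul_one q, ← smul_eq_mul, ← TensorProduct.smul_tmul']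
    exact Submodule.smul_mem _ _ (Submodule.subset_span ⟨a, rfl⟩)

theorem exists_dual_functional {V ι : Type*} [AddCommGroup V] [Module ℚ V] {v : ι → V}
    (hv : LinearIndependent ℚ v) (i : ι) :
    ∃ ψ : V →ₗ[ℚ] ℚ, ψ (v i) = 1 ∧ ∀ j, i ≠ j → ψ (v j) = 0 := by
  classical
  obtain ⟨ψ, hψ⟩ := LinearMap.exists_extend (Finsupp.lapply i ∘ₗ hv.repr)
  have key : ∀ j, ψ (v j) = (Finsupp.single j (1 : ℚ)) i := by
    intro j
    have := LinearMap.congr_fun hψ ⟨v j, Submodule.subset_span ⟨j, rfl⟩⟩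
    simp only [LinearMap.comp_apply, Submodule.subtype_apply, Finsupp.lapply_apply] at this
    rw [this, hv.repr_eq_single j _ rfl]
  exact ⟨ψ, by rw [key, Finsupp.single_eq_same],
    fun j hij => by rw [key, Finsupp.single_eq_of_ne hij]⟩

/-- Spreading a function from `K 1` to all of `K 0` along a set of coset representatives. The
difference operators of elements of `K 1` commute with this, and a function that is only invariant
under `K 1` becomes constant. -/
noncomputable def spread (f : G → ℚ) (g : G) : ℚ :=
  f (g * (Quotient.out (QuotientGroup.mk g : K.grZero))⁻¹)

theorem diff_spread {x : G} (hx : x ∈ K 1) (f : G → ℚ) :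
    diff x (K.spread f) = K.spread (diff x f) := by
  ext g
  have h : (QuotientGroup.mk (x * g) : K.grZero) = QuotientGroup.mk g := by
    rw [QuotientGroup.mk_mul, (QuotientGroup.eq_one_iff x).2 hx, one_mul]
  simp only [diff_apply, spread, h, mul_assoc]

theorem diffWord_spread {l : List (ℕ × G)} (hl : K.IsWord l) (f : G → ℚ) :
    diffWord l (K.spread f) = K.spread (diffWord l f) := by
  induction l generalizing f with
  | nil => rfl
  | cons p l ih =>
    obtain ⟨⟨h1, h2⟩, h3⟩ := K.isWord_cons.1 hl
    rw [diffWord_cons, diffWord_cons, K.diff_spread (K.antitone h1 h2), ih h3]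

theorem spread_mem {k p : ℕ} {f : G → ℚ} (hf : f ∈ K.polyFil k p) :
    K.spread f ∈ K.polyFil k p := by
  intro l hl h
  rw [K.diffWord_spread hl, hf l hl h]
  rfl

theorem spread_eq_const {f : G → ℚ} (hf : f ∈ K.polyFil 1 0) : K.spread f = f 1 • 1 := by
  ext g
  have hmem : g * (Quotient.out (QuotientGroup.mk g : K.grZero))⁻¹ ∈ K 1 := by
    rw [← QuotientGroup.eq_one_iff, QuotientGroup.mk_mul, QuotientGroup.mk_inv]
    rw [show (QuotientGroup.mk (Quotient.out (QuotientGroup.mk g : K.grZero)) : K.grZero) =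
      QuotientGroup.mk g from Quotient.out_eq _, mul_inv_cancel]
  have := congrFun (diff_eq_zero hf le_rfl le_rfl hmem) 1
  rw [diff_apply, mul_one, Pi.zero_apply, sub_eq_zero] at this
  simp [spread, this]

/-- The weight of an index, as a positive integer. -/
def DualFamily.pm {K : ExtendedNSeries G} {ι : Type*} (D : DualFamily K ι) (i : ι) : ℕ+ :=
  ⟨D.m i, D.one_le i⟩

theorem DualFamily.mem_pm {K : ExtendedNSeries G} {ι : Type*} (D : DualFamily K ι) (i : ι) :
    D.x i ∈ K (D.pm i) := D.mem i

/-- The element of the rational graded Lie algebra attached to an index. -/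
noncomputable def DualFamily.elt {K : ExtendedNSeries G} {ι : Type*} (D : DualFamily K ι)
    (i : ι) : K.GrPlusRat :=
  (1 : ℚ) ⊗ₜ[ℤ] K.toGr (D.pm i) (D.x i) (D.mem_pm i)

/-- Functionals on `ℚ[G] / J (m + 1)` dual to the classes of the `x - 1`, for a maximal
independent set of `x` in each degree, give a dual family. -/
theorem exists_dualFamily : ∃ (ι : Type u) (D : DualFamily K ι),
    Submodule.span ℚ (Set.range D.elt) = ⊤ := by
  choose b hb hspan hli using K.exists_basisSet
  choose x hx hbx using hb
  let ι := Σ m, b m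
  have hv : ∀ m, LinearIndependent ℚ (fun z : b m =>
      (K.J ℚ (m + 1)).mkQ (MonoidAlgebra.of ℚ G (x m z z.2) - 1)) := by
    intro m
    have e : (fun z : b m => (K.J ℚ (m + 1)).mkQ (MonoidAlgebra.of ℚ G (x m z z.2) - 1)) =
        K.augMap m ∘ Subtype.val := funext fun z =>
      ((congrArg (K.augMap m) (hbx m z z.2)).trans (by rw [augMap_tmul_cls, one_smul])).symm
    rw [e]
    exact (hli m).map' (K.augMap m) (K.ker_augMap m)
  choose ψ hψ1 hψ0 using fun m => exists_dual_functional (hv m)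
  let lam0 : ∀ m, b m → G → ℚ := fun m z g => ψ m z ((K.J ℚ (m + 1)).mkQ (MonoidAlgebra.of ℚ G g))
  have hlam0 : ∀ (m : ℕ+) z, lam0 m z ∈ K.polyFil (m + 1) 0 := fun m z =>
    mem_polyFil_of_functional (ψ m z ∘ₗ (K.J ℚ (m + 1)).mkQ) fun a ha => by
      rw [LinearMap.comp_apply, Submodule.mkQ_apply, (Submodule.Quotient.mk_eq_zero _).2 ha,
        map_zero]
  have hdiff : ∀ (m : ℕ+) (z z' : b m), diff (x m z' z'.2) (K.spread (lam0 m z)) =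
      ψ m z ((K.J ℚ (m + 1)).mkQ (MonoidAlgebra.of ℚ G (x m z' z'.2) - 1)) • 1 := by
    intro m z z'
    have h1 := diff_mem_polyFil (hlam0 m z) m.pos (hx m z' z'.2)
    rw [Nat.add_sub_cancel_left] at h1
    rw [K.diff_spread (K.mem_of_pos (hx m z' z'.2)), K.spread_eq_const h1, diff_apply, mul_one,
      ← map_sub, ← map_sub, map_one]
  let D : DualFamily K ι :=
    { m i := i.1
      one_le i := i.1.pos
      x i := x i.1 i.2 i.2.2
      mem i := hx i.1 i.2 i.2.2
      lam i := K.spread (lam0 i.1 i.2)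
      lam_mem i := K.spread_mem (hlam0 i.1 i.2)
      diff_self i := by rw [hdiff, hψ1, one_smul]
      diff_ne := by
        rintro ⟨m, z⟩ ⟨m', z'⟩ hm hne
        obtain rfl : m = m' := PNat.coe_injective hm
        have : z ≠ z' := fun h => hne (by rw [h])
        change diff (x m z' z'.2) (K.spread (lam0 m z)) = 0
        rw [hdiff, hψ0 m z z' this, zero_smul] }
  refine ⟨ι, D, ?_⟩
  rw [eq_top_iff]
  have hm : ∀ m, ∀ z : ℚ ⊗[ℤ] K.gr m, ((K.incl m).toIntLinearMap.baseChange ℚ) z ∈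
      Submodule.span ℚ (Set.range D.elt) := by
    intro m z
    have hz : z ∈ Submodule.span ℚ (b m) := by rw [hspan]; trivial
    have : Submodule.span ℚ (b m) ≤ (Submodule.span ℚ (Set.range D.elt)).comap
        ((K.incl m).toIntLinearMap.baseChange ℚ) := by
      refine Submodule.span_le.2 fun z hz => Submodule.subset_span ⟨⟨m, ⟨z, hz⟩⟩, ?_⟩
      conv_rhs => rw [hbx m z hz]
      rw [LinearMap.baseChange_tmul]
      rfl
    exact this hz
  intro z _
  obtain ⟨q, a, rfl⟩ := exists_rat_tmul z
  induction a using K.plus_ind with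
  | h0 => rw [TensorProduct.tmul_zero]; exact zero_mem _
  | hadd x y hx hy => rw [TensorProduct.tmul_add]; exact add_mem (hx trivial) (hy trivial)
  | h m x hx => exact hm m (q ⊗ₜ[ℤ] K.cls m x hx)

end DualBasis

end ExtendedNSeries

/-! ### Spanning monomials of the enveloping algebra -/

namespace LieEnveloping

section Monomials

attribute [local instance 100] LieRing.ofAssociativeRing

variable {R L ι : Type*} [CommRing R] [LieRing L] [LieAlgebra R L] (e : ι → L)

/-- The product in the enveloping algebra of a list of elements of a family in `L`. -/
noncomputable def listProd (R : Type*) [CommRing R] [LieAlgebra R L] (l : List ι) :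
    UniversalEnvelopingAlgebra R L :=
  (l.map fun i => UniversalEnvelopingAlgebra.ι R (e i)).prod

theorem listProd_cons (i : ι) (l : List ι) :
    listProd e R (i :: l) = UniversalEnvelopingAlgebra.ι R (e i) * listProd e R l := by
  simp [listProd]

/-- The span of the products of fewer than `n` elements of the family. -/
noncomputable def shortSpan (R : Type*) [CommRing R] [LieAlgebra R L] (n : ℕ) :
    Submodule R (UniversalEnvelopingAlgebra R L) :=
  Submodule.span R {u | ∃ l : List ι, l.length < n ∧ u = listProd e R l}

theorem mul_shortSpan (i : ι) {n : ℕ} {u : UniversalEnvelopingAlgebra R L}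
    (hu : u ∈ shortSpan e R n) :
    UniversalEnvelopingAlgebra.ι R (e i) * u ∈ shortSpan e R (n + 1) := by
  have : shortSpan e R n ≤ (shortSpan e R (n + 1)).comap
      (LinearMap.mulLeft R (UniversalEnvelopingAlgebra.ι R (e i))) := by
    refine Submodule.span_le.2 ?_
    rintro _ ⟨l, hl, rfl⟩
    exact Submodule.subset_span ⟨i :: l, by simpa using hl, (listProd_cons e i l).symm⟩
  exact this hu

variable (he : Submodule.span R (Set.range e) = ⊤)

include he

theorem ι_mul_listProd_mem (x : L) (l : List ι) :
    UniversalEnvelopingAlgebra.ι R x * listProd e R l ∈ shortSpan e R (l.length + 2) := by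
  have hx : x ∈ Submodule.span R (Set.range e) := by rw [he]; trivial
  have : Submodule.span R (Set.range e) ≤ (shortSpan e R (l.length + 2)).comap
      (LinearMap.mulRight R (listProd e R l) ∘ₗ
        (UniversalEnvelopingAlgebra.ι R : L →ₗ⁅R⁆ _).toLinearMap) := by
    refine Submodule.span_le.2 ?_
    rintro _ ⟨i, rfl⟩
    exact Submodule.subset_span ⟨i :: l, by simp, (listProd_cons e i l).symm⟩
  exact this hx

/-- Permuting the factors changes a product only by shorter products. -/
theorem listProd_sub_mem {l l' : List ι} (h : l.Perm l') :
    listProd e R l - listProd e R l' ∈ shortSpan e R l.length := by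
  induction h with
  | nil => simp
  | cons i _ ih =>
    rw [listProd_cons, listProd_cons, ← mul_sub]
    exact mul_shortSpan e i ih
  | swap i j l =>
    rw [listProd_cons, listProd_cons, listProd_cons, listProd_cons, ← mul_assoc, ← mul_assoc,
      ← sub_mul, ← LieRing.of_associative_ring_bracket, ← LieHom.map_lie]
    exact ι_mul_listProd_mem e he _ l
  | trans h1 _ ih1 ih2 =>
    rw [← h1.length_eq] at ih2
    simpa using add_mem ih1 ih2

theorem listProd_mem_span_toList (l : List ι) :
    listProd e R l ∈ Submodule.span R (Set.range fun s : Multiset ι => listProd e R s.toList) := by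
  induction hn : l.length using Nat.strong_induction_on generalizing l with
  | _ n ih =>
    subst hn
    have hp : l.Perm (l : Multiset ι).toList := by
      rw [← Multiset.coe_eq_coe, Multiset.coe_toList]
    have h1 : shortSpan e R l.length ≤
        Submodule.span R (Set.range fun s : Multiset ι => listProd e R s.toList) := by
      refine Submodule.span_le.2 ?_
      rintro _ ⟨l', hl', rfl⟩
      exact ih _ hl' l' rfl
    have h2 := add_mem (h1 (listProd_sub_mem e he hp))
      (Submodule.subset_span ⟨(l : Multiset ι), rfl⟩)
    simpa using h2

/-- The easy half of the Poincaré–Birkhoff–Witt theorem: one monomial for each multiset of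
elements of a spanning family of `L` suffices to span the enveloping algebra. -/
theorem span_listProd_toList :
    Submodule.span R (Set.range fun s : Multiset ι => listProd e R s.toList) = ⊤ := by
  have hadj : Algebra.adjoin R (Set.range fun i => UniversalEnvelopingAlgebra.ι R (e i)) = ⊤ := by
    rw [eq_top_iff, ← adjoin_range_ι, Algebra.adjoin_le_iff]
    rintro _ ⟨x, rfl⟩
    have hx : x ∈ Submodule.span R (Set.range e) := by rw [he]; trivial
    have : Submodule.span R (Set.range e) ≤
        (Subalgebra.toSubmodule (Algebra.adjoin R
          (Set.range fun i => UniversalEnvelopingAlgebra.ι R (e i)))).comap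
          (UniversalEnvelopingAlgebra.ι R : L →ₗ⁅R⁆ _).toLinearMap := by
      refine Submodule.span_le.2 ?_
      rintro _ ⟨i, rfl⟩
      exact Algebra.subset_adjoin ⟨i, rfl⟩
    exact this hx
  rw [eq_top_iff, ← Algebra.top_toSubmodule, ← hadj, Algebra.adjoin_eq_span, Submodule.span_le]
  intro u hu
  obtain ⟨us, hus, rfl⟩ := Submonoid.exists_list_of_mem_closure hu
  have hmem : us ∈ Set.range (List.map fun i => UniversalEnvelopingAlgebra.ι R (e i)) := by
    rw [Set.range_list_map]
    exact hus
  obtain ⟨l, rfl⟩ := hmem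
  exact listProd_mem_span_toList e he l

end Monomials

end LieEnveloping

namespace ExtendedNSeries

/-! ### Bijectivity of the rational `Υ` -/

section Bijective

attribute [local instance 100] LieRing.ofAssociativeRing

variable {G : Type u} [Group G] (K : ExtendedNSeries G)

theorem augProd_mem_filtration {l : List (ℕ × G)} (hl : K.IsWord l) :
    augProd ℚ l ∈ K.groupRingFiltration ℚ (wt l) :=
  K.augProd_mem_J ℚ hl

theorem word_mem_filtration {ι : Type*} (D : DualFamily K ι) (l : List ι) :
    augProd ℚ (D.word l) ∈ K.groupRingFiltration ℚ (D.mwt l) := by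
  rw [← D.wt_word]
  exact K.augProd_mem_J ℚ (D.isWord_word l)

theorem lift_listProd {ι : Type*} (D : DualFamily K ι) (l : List ι) :
    UniversalEnvelopingAlgebra.lift ℚ K.lieHomRat (LieEnveloping.listProd D.elt ℚ l) =
      (K.groupRingFiltration ℚ).toGr (D.mwt l) (augProd ℚ (D.word l))
        (K.word_mem_filtration D l) := by
  induction l with
  | nil =>
    rw [LieEnveloping.listProd, List.map_nil, List.prod_nil, map_one]
    rfl
  | cons i l ih =>
    rw [LieEnveloping.listProd_cons, map_mul, ih, UniversalEnvelopingAlgebra.lift_ι_apply,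
      DualFamily.elt, lieHomRat_tmul, one_smul, lieHom_toGr, grJOfLie,
      AlgFiltration.toGr_mul_toGr]
    refine (K.groupRingFiltration ℚ).toGr_congr _ _ ?_ ?_
    · rw [← Multiset.cons_coe, D.mwt_cons]; rfl
    · rw [DualFamily.word_cons, augProd_cons, sub_self]; exact zero_mem _

theorem word_mul_of_mem {ι : Type*} (D : DualFamily K ι) (l : List ι) (g : G) :
    augProd ℚ (D.word l) * MonoidAlgebra.of ℚ G g ∈ K.groupRingFiltration ℚ (D.mwt l) :=
  K.mul_of_mem_J ℚ (K.word_mem_filtration D l) _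

theorem upsilonRat_monomial {ι : Type*} (D : DualFamily K ι) (l : List ι) (g : G) :
    K.upsilonRat (SkewMonoidAlgebra.single (QuotientGroup.mk g : K.grZero)
      (LieEnveloping.listProd D.elt ℚ l)) =
      (K.groupRingFiltration ℚ).toGr (D.mwt l)
        (augProd ℚ (D.word l) * MonoidAlgebra.of ℚ G g) (K.word_mul_of_mem D l g) := by
  rw [upsilonRat_single, lift_listProd, groupHom_mk, grJOfGroup, AlgFiltration.toGr_mul_toGr]
  exact (K.groupRingFiltration ℚ).toGr_congr _ _ rfl (by rw [sub_self]; exact zero_mem _)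

/-- The functional on the degree `d` part of the associated graded algebra induced by a polynomial
function of weighted degree at most `d`. -/
noncomputable def evalPiece {f : G → ℚ} {d : ℕ} (hf : f ∈ K.polyFil (d + 1) 0) :
    (K.groupRingFiltration ℚ).grPiece d →ₗ[ℚ] ℚ :=
  Submodule.liftQ ((K.groupRingFiltration ℚ (d + 1)).submoduleOf (K.groupRingFiltration ℚ d))
    (linLift f ∘ₗ (K.groupRingFiltration ℚ d).subtype)
    (show _ ≤ LinearMap.ker _ from fun _ ha => LinearMap.mem_ker.2 (linLift_eq_zero hf ha))

/-- The extension of `evalPiece` to the associated graded algebra, by zero in the other degrees. -/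
noncomputable def evalGr {f : G → ℚ} {d : ℕ} (hf : f ∈ K.polyFil (d + 1) 0) :
    K.GrJ ℚ →ₗ[ℚ] ℚ :=
  LinearMap.comp (M₂ := (K.groupRingFiltration ℚ).grPiece d) (K.evalPiece hf)
    (DirectSum.component ℚ ℕ (K.groupRingFiltration ℚ).grPiece d)

theorem evalGr_toGr_self {f : G → ℚ} {d : ℕ} (hf : f ∈ K.polyFil (d + 1) 0)
    {a : MonoidAlgebra ℚ G} (ha : a ∈ K.groupRingFiltration ℚ d) :
    K.evalGr hf ((K.groupRingFiltration ℚ).toGr d a ha) = linLift f a := by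
  have : DirectSum.component ℚ ℕ (K.groupRingFiltration ℚ).grPiece d
      ((K.groupRingFiltration ℚ).toGr d a ha) = (K.groupRingFiltration ℚ).cls d a ha :=
    DirectSum.of_eq_same _ _
  exact congrArg (K.evalPiece hf) this

theorem evalGr_toGr_ne {f : G → ℚ} {d n : ℕ} (hf : f ∈ K.polyFil (d + 1) 0) (h : n ≠ d)
    {a : MonoidAlgebra ℚ G} (ha : a ∈ K.groupRingFiltration ℚ n) :
    K.evalGr hf ((K.groupRingFiltration ℚ).toGr n a ha) = 0 := by
  have : DirectSum.component ℚ ℕ (K.groupRingFiltration ℚ).grPiece d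
      ((K.groupRingFiltration ℚ).toGr n a ha) = 0 := DirectSum.of_eq_of_ne _ _ _ (Ne.symm h)
  exact (congrArg (K.evalPiece hf) this).trans (map_zero _)

open Classical in
/-- The indicator function of a coset of `K 1`. -/
noncomputable def cosetInd (h : K.grZero) (g : G) : ℚ :=
  if (QuotientGroup.mk g : K.grZero) = h then 1 else 0

theorem cosetInd_mul (h : K.grZero) {x : G} (hx : x ∈ K 1) (g : G) :
    K.cosetInd h (x * g) = K.cosetInd h g := by
  rw [cosetInd, cosetInd, QuotientGroup.mk_mul, (QuotientGroup.eq_one_iff x).2 hx, one_mul]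

theorem cosetInd_mul_mem (h : K.grZero) {k p : ℕ} {f : G → ℚ} (hf : f ∈ K.polyFil k p) :
    K.cosetInd h * f ∈ K.polyFil k p := by
  intro l hl hk
  rw [diffWord_mul_of_invariant (fun _ hx => K.cosetInd_mul h hx) hl, hf l hl hk, mul_zero]

/-- The crossed product is spanned by the products of monomials and group elements. -/
theorem span_crossed {ι : Type*} (D : DualFamily K ι)
    (hD : Submodule.span ℚ (Set.range D.elt) = ⊤) :
    Submodule.span ℚ (Set.range fun p : K.grZero × Multiset ι =>
      (SkewMonoidAlgebra.single p.1 (LieEnveloping.listProd D.elt ℚ p.2.toList) : K.URat)) = ⊤ := by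
  rw [eq_top_iff]
  rintro a -
  induction a using SkewMonoidAlgebra.induction_on with
  | zero => exact zero_mem _
  | add x y hx hy => exact add_mem hx hy
  | single g u =>
    have hu : u ∈ Submodule.span ℚ (Set.range fun s : Multiset ι =>
        LieEnveloping.listProd D.elt ℚ s.toList) := by
      rw [LieEnveloping.span_listProd_toList D.elt hD]; trivial
    induction hu using Submodule.span_induction with
    | zero => rw [SkewMonoidAlgebra.single_zero]; exact zero_mem _
    | add x y _ _ hx hy => rw [SkewMonoidAlgebra.single_add]; exact add_mem hx hy
    | smul r x _ hx =>
      rw [← SkewMonoidAlgebra.smul_single]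
      exact Submodule.smul_mem _ _ hx
    | mem x hx =>
      obtain ⟨s, rfl⟩ := hx
      exact Submodule.subset_span ⟨(g, s), rfl⟩

/-- The monomials are linearly independent after applying `Υ`: the functional of the dual monomial
of maximal length, cut off to one coset of `K 1`, kills all but one of them. -/
theorem upsilonRat_injective : Function.Injective K.upsilonRat := by
  classical
  obtain ⟨ι, D, hD⟩ := K.exists_dualFamily
  rw [injective_iff_map_eq_zero]
  intro a ha
  have hmem : a ∈ Submodule.span ℚ (Set.range fun p : K.grZero × Multiset ι =>
      (SkewMonoidAlgebra.single p.1 (LieEnveloping.listProd D.elt ℚ p.2.toList) : K.URat)) := by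
    rw [K.span_crossed D hD]; trivial
  obtain ⟨c, rfl⟩ := (Finsupp.mem_span_range_iff_exists_finsupp).1 hmem
  by_contra hne
  have hc : c.support.Nonempty := by
    rw [Finsupp.support_nonempty_iff]
    rintro rfl
    exact hne (by simp)
  -- a monomial of maximal length in the support is detected by the dual monomial
  obtain ⟨⟨h0, s0⟩, hp0, hmax⟩ := c.support.exists_max_image (fun p => Multiset.card p.2) hc
  have hf : K.cosetInd h0 * D.mono s0 ∈ K.polyFil (D.mwt s0 + 1) 0 :=
    polyFil_mono le_rfl (Nat.zero_le _) (K.cosetInd_mul_mem h0 (D.mono_mem s0))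
  -- in the weight of `s0`, the functional evaluates an iterated difference of the dual monomial at
  -- a coset representative; the indicator selects the coset `h0`
  have hval : ∀ (h : K.grZero) (s : Multiset ι), D.mwt s = D.mwt s0 →
      K.evalGr hf (K.upsilonRat (SkewMonoidAlgebra.single h
        (LieEnveloping.listProd D.elt ℚ s.toList))) =
      K.cosetInd h0 h.out * diffWord (D.word s.toList) (D.mono s0) h.out := by
    intro h s hs
    have hout : (QuotientGroup.mk h.out : K.grZero) = h := Quotient.out_eq _
    have hs' : D.mwt s.toList = D.mwt s0 := by rw [Multiset.coe_toList, hs]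
    have e1 := K.upsilonRat_monomial D s.toList h.out
    rw [hout] at e1
    have hw := K.word_mul_of_mem D s.toList h.out
    rw [e1, (K.groupRingFiltration ℚ).toGr_congr _ (hs' ▸ hw) hs'
      (by rw [sub_self]; exact zero_mem _), evalGr_toGr_self, linLift_augProd_mul,
      diffWord_mul_of_invariant (fun _ hx => K.cosetInd_mul h0 hx) (D.isWord_word _)]
    rfl
  have hval0 : ∀ (h : K.grZero) (s : Multiset ι), D.mwt s ≠ D.mwt s0 →
      K.evalGr hf (K.upsilonRat (SkewMonoidAlgebra.single h
        (LieEnveloping.listProd D.elt ℚ s.toList))) = 0 := by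
    intro h s hs
    have hout : (QuotientGroup.mk h.out : K.grZero) = h := Quotient.out_eq _
    have e1 := K.upsilonRat_monomial D s.toList h.out
    rw [hout] at e1
    rw [e1, evalGr_toGr_ne]
    rwa [Multiset.coe_toList]
  have hind : ∀ h : K.grZero, K.cosetInd h0 h.out = if h = h0 then 1 else 0 := by
    intro h
    rw [cosetInd, show (QuotientGroup.mk h.out : K.grZero) = h from Quotient.out_eq _]
  have hother : ∀ p ∈ c.support, p ≠ (h0, s0) → K.evalGr hf (K.upsilonRat
      (SkewMonoidAlgebra.single p.1 (LieEnveloping.listProd D.elt ℚ p.2.toList))) = 0 := by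
    rintro ⟨h, s⟩ hp hne
    by_cases hs : D.mwt s = D.mwt s0
    · rw [hval h s hs]
      by_cases hh : h = h0
      · have hss : s ≠ s0 := fun e => hne (by rw [hh, e])
        have hs' : D.mwt s.toList = D.mwt s0 := by rw [Multiset.coe_toList, hs]
        have hz : diffWord (D.word s.toList) (D.mono s0) = 0 := by
          rcases (hmax _ hp).lt_or_eq with hlt | heq
          · exact D.diffWord_mono_of_lt hs' (by rwa [Multiset.length_toList])
          · exact (D.diffWord_mono hs' (by rwa [Multiset.length_toList])).1
              (by rwa [Multiset.coe_toList])
        rw [hz, Pi.zero_apply, mul_zero]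
      · rw [hind, if_neg hh, zero_mul]
    · exact hval0 h s hs
  obtain ⟨r, hr, hr'⟩ := (D.diffWord_mono (l := s0.toList) (s := s0) (by rw [Multiset.coe_toList])
    (Multiset.length_toList _)).2 (Multiset.coe_toList _)
  have hmain := congrArg (K.evalGr hf) ha
  rw [map_zero, Finsupp.sum, map_sum, map_sum, Finset.sum_eq_single (h0, s0)] at hmain
  · rw [map_smul, map_smul, hval h0 s0 rfl, hind, if_pos rfl, one_mul, hr', Pi.smul_apply,
      Pi.one_apply, smul_eq_mul, smul_eq_mul, mul_one] at hmain
    exact mul_ne_zero (Finsupp.mem_support_iff.1 hp0) hr hmain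
  · intro p hp hne
    rw [map_smul, map_smul, hother p hp hne, smul_zero]
  · intro h
    exact absurd hp0 h

/-- The leading terms of the products `(x₁ - 1) ⋯ (xₚ - 1)` are products of values of `Υ`. -/
theorem toGr_augProd_mem_range {l : List (ℕ × G)} (hl : K.IsWord l) :
    (K.groupRingFiltration ℚ).toGr (wt l) (augProd ℚ l) (K.augProd_mem_filtration hl) ∈
      K.upsilonRat.range := by
  induction l with
  | nil => exact one_mem _
  | cons p l ih =>
    obtain ⟨⟨h1, h2⟩, h3⟩ := K.isWord_cons.1 hl
    have hp : MonoidAlgebra.of ℚ G p.2 - 1 ∈ K.groupRingFiltration ℚ p.1 :=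
      K.of_sub_one_mem_J ℚ (m := ⟨p.1, h1⟩) h2
    have hx : (K.groupRingFiltration ℚ).toGr p.1 _ hp ∈ K.upsilonRat.range :=
      ⟨_, K.isUpsilonRat_upsilonRat.2 ⟨p.1, h1⟩ p.2 h2⟩
    have := mul_mem hx (ih h3)
    rw [AlgFiltration.toGr_mul_toGr] at this
    rwa [(K.groupRingFiltration ℚ).toGr_congr _ (K.augProd_mem_filtration hl) (wt_cons p l).symm
      (by rw [augProd_cons, sub_self]; exact zero_mem _)] at this

theorem toGr_mem_range {d : ℕ} {a : MonoidAlgebra ℚ G} (ha : a ∈ K.groupRingFiltration ℚ d) :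
    (K.groupRingFiltration ℚ).toGr d a ha ∈ K.upsilonRat.range := by
  have key : ∀ a (_ : a ∈ K.wordSpan ℚ ⊤ d) (ha : a ∈ K.groupRingFiltration ℚ d),
      (K.groupRingFiltration ℚ).toGr d a ha ∈ K.upsilonRat.range := by
    intro a hspan
    induction hspan using Submodule.span_induction with
    | zero =>
      intro ha
      rw [(K.groupRingFiltration ℚ).toGr_eq_zero ha (zero_mem _)]
      exact zero_mem _
    | add x y hx hy ihx ihy =>
      intro ha
      have hx' : x ∈ K.groupRingFiltration ℚ d := (K.J_eq_wordSpan ℚ d).ge hx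
      have hy' : y ∈ K.groupRingFiltration ℚ d := (K.J_eq_wordSpan ℚ d).ge hy
      rw [AlgFiltration.toGr_add _ hx' hy']
      exact add_mem (ihx hx') (ihy hy')
    | smul r x hx ihx =>
      intro ha
      have hx' : x ∈ K.groupRingFiltration ℚ d := (K.J_eq_wordSpan ℚ d).ge hx
      have e : (K.groupRingFiltration ℚ).toGr d (r • x) ha =
          r • (K.groupRingFiltration ℚ).toGr d x hx' := by
        exact (DirectSum.lof ℚ ℕ (K.groupRingFiltration ℚ).grPiece d).map_smul r
          ((K.groupRingFiltration ℚ).cls d x hx')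
      rw [e]
      exact Subalgebra.smul_mem _ (ihx hx') r
    | mem x hx =>
      intro ha
      obtain ⟨l, g, hl, -, -, hd, rfl⟩ := hx
      rcases hd.eq_or_lt with rfl | hlt
      · have hg : K.grJOfGroup ℚ g ∈ K.upsilonRat.range := ⟨_, K.isUpsilonRat_upsilonRat.1 g⟩
        have := mul_mem (K.toGr_augProd_mem_range hl) hg
        rw [grJOfGroup, AlgFiltration.toGr_mul_toGr] at this
        rwa [(K.groupRingFiltration ℚ).toGr_congr _ ha (add_zero _)
          (by rw [sub_self]; exact zero_mem _)] at this
      · rw [(K.groupRingFiltration ℚ).toGr_eq_zero]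
        · exact zero_mem _
        · exact K.J_antitone ℚ hlt (K.mul_of_mem_J ℚ (K.augProd_mem_J ℚ hl) _)
  exact key a ((K.J_eq_wordSpan ℚ d).le ha) ha

theorem upsilonRat_surjective : Function.Surjective K.upsilonRat := by
  intro z
  change z ∈ K.upsilonRat.range
  induction z using DirectSum.induction_on with
  | zero => exact zero_mem _
  | of d y =>
    induction y using (K.groupRingFiltration ℚ).cls_ind with
    | h a ha => exact K.toGr_mem_range ha
  | add x y hx hy => exact add_mem hx hy

end Bijective

end ExtendedNSeries

theorem theorem10p2 {G : Type*} [Group G] (K : ExtendedNSeries G) :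
    (∃! Υ : K.U →+* K.GrJ ℤ, K.IsUpsilon Υ) ∧
      ∃ Υ : K.URat ≃ₐ[ℚ] K.GrJ ℚ, K.IsUpsilonRat Υ ∧
        ∀ Υ' : K.URat →ₐ[ℚ] K.GrJ ℚ, K.IsUpsilonRat Υ' → Υ' = Υ := by
  refine ⟨K.existsUnique_upsilon, AlgEquiv.ofBijective K.upsilonRat
    ⟨K.upsilonRat_injective, K.upsilonRat_surjective⟩, ?_, ?_⟩
  · exact K.isUpsilonRat_upsilonRat
  · exact fun Υ' h => K.eq_upsilonRat h
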